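/- Let $\Bbbk$ be a commutative ring. Maps act on the right, $(x)fg=((x)f)g$, and tensor products of homogeneous maps obey the Koszul rule $(x\otimes y)(f\otimes g)=(-1)^{\deg y\deg f}xf\otimes yg$. For a graded $\Bbbk$-quiver $\mathcal A$ let $s\mathcal A$ be its suspension, $(s\mathcal A)^d=\mathcal A^{d+1}$, and let $(s\mathcal A)^{\otimes n}(X,Y)=\bigoplus s\mathcal A(X_0,X_1)\otimes\dots\otimes s\mathcal A(X_{n-1},X_n)$ over all $X=X_0,X_1,\dots,X_n=Y$. An $A_\infty$-category is a graded quiver with maps $b_n:(s\mathcal A)^{\otimes n}\to s\mathcal A$, $n\ge1$, of degree $1$ with $\sum_{r+n+t=m}(1^{\otimes r}\otimes b_n\otimes1^{\otimes t})b_{r+1+t}=0$ for all $m\ge 1$. An $A_\infty$-functor $f:\mathcal A\to\mathcal B$ is a map on objects with maps $f_n:(s\mathcal A)^{\otimes n}(X,Y)\to s\mathcal B(Xf,Yf)$, $n\ge1$, of degree $0$ with $\sum (f_{i_1}\otimes\dots\otimes f_{i_l})b_l=\sum(1^{\otimes r}\otimes b_n\otimes1^{\otimes t})f_{r+1+t}$;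 its matrix elements are $f_{a\alpha}=\sum_{i_1+\dots+i_\alpha=a}f_{i_1}\otimes\dots\otimes f_{i_\alpha}$ (so $f_{00}=1$). For $A_\infty$-functors $f,g$ the graded module $sA_\infty(\mathcal A,\mathcal B)(f,g)$ consists in degree $d$ of all families $r=(r_n)_{n\ge0}$ of maps $r_n:(s\mathcal A)^{\otimes n}(X,Y)\to s\mathcal B(Xf,Yg)$ of degree $d$, with the differential $$(rB_1)_k=\sum_{a+q+c=k}^{\alpha,\beta}(f_{a\alpha}\otimes r_q\otimes g_{c\beta})b_{\alpha+1+\beta}-(-1)^d\sum_{\alpha+q+\beta=k}(1^{\otimes\alpha}\otimes b_q\otimes1^{\otimes\beta})r_{\alpha+1+\beta}.$$ Let $\mathcal Q$ be a differential graded $\Bbbk$-quiver; write $b_1=d$ for the differential of $s\mathcal Q$. The free $A_\infty$-category $\mathcal{FQ}$ has the objects of $\mathcal Q$ and $$s\mathcal{FQ}(X,Y)=\bigoplus_{n\ge1}\bigoplus_t s\mathcal F_t\mathcal Q(X,Y),\qquad s\mathcal F_t\mathcal Q(X,Y)=(s\mathcal Q)^{\otimes n}(X,Y)[-|t|],$$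 where $t$ runs over the plane rooted trees with $n$ inputs whose internal vertices all have at least two incoming edges, and $|t|$ is the number of internal vertices. For $k>1$ the operation $b_k$ is the sum of the maps $s^{|t_1|}\otimes\dots\otimes s^{|t_{k-1}|}\otimes s^{|t_k|-|t|}:s\mathcal F_{t_1}\mathcal Q\otimes\dots\otimes s\mathcal F_{t_k}\mathcal Q\to s\mathcal F_t\mathcal Q$, where $t$ is obtained by grafting $t_1,\dots,t_k$ onto a new root vertex; $b_1$ on $s\mathcal F_t\mathcal Q$ is the sum of the differential of $(s\mathcal Q)^{\otimes n}[-|t|]$ (which is $(-1)^{|t|}$ times that of $(s\mathcal Q)^{\otimes n}$) and of the maps $(-1)^{1+h}s^{-1}:s\mathcal F_t\mathcal Q\to s\mathcal F_{t'}\mathcal Q$ over all trees $t'$ with a chosen internal edge $e$ whose contraction gives $t$; here $h$ is the number of the upper vertex of $e$ when the internal vertices of $t'$ are numbered $1,2,\dots$ starting from the root vertex and then going through its subtrees from left to right. The summand of the trivial tree is $s\mathcal Q\subset s\mathcal{FQ}$. Let $\mathcal A$ be an $A_\infty$-category, let $\phi,\psi:\mathcal{FQ}\to\mathcal A$ be $A_\infty$-functors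 and let $P$ be a complex of $\Bbbk$-modules (differential $d$ of degree $1$). Let $sA_1(\mathcal Q,\mathcal A)(\phi,\psi)$ be the graded module of pairs $r=(r_0,r_1)$ in $\prod_{X}s\mathcal A(X\phi,X\psi)\times\prod_{X,Y}\mathsf C(s\mathcal Q(X,Y),s\mathcal A(X\phi,Y\psi))$, where $\mathsf C$ denotes the graded module of homogeneous maps, with the differential $(rB_1)_0=r_0b_1$, $(rB_1)_1=r_1b_1+(\phi_1\otimes r_0)b_2+(r_0\otimes\psi_1)b_2-(-1)^{\deg r}b_1r_1$. **Proposition.** The map $u\mapsto(u',u_k)_{k>1}$, where $u'$ is the composition of $u$ with the restriction $r\mapsto(r_0,r_1|_{s\mathcal Q})$ and $u_k=u\cdot\mathrm{pr}_k$, is a bijection from the set of chain maps $u:P\to sA_\infty(\mathcal{FQ},\mathcal A)(\phi,\psi)$ to the set of data consisting of 1. a chain map $u':P\to sA_1(\mathcal Q,\mathcal A)(\phi,\psi)$; 2. arbitrary $\Bbbk$-linear maps $u_k:P\to\prod_{X,Y\in\mathrm{Ob}\,\mathcal Q}\mathsf C\bigl((s\mathcal{FQ})^{\otimes k}(X,Y),s\mathcal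 A(X\phi,Y\psi)\bigr)$ of degree $0$, for all $k>1$. The inverse bijection is recovered from the recurrent formula $$(-1)^{\deg p}\,b^{\mathcal{FQ}}_k(pu_1)=-(pd)u_k+\sum_{a+q+c=k}^{\alpha,\beta}(\phi_{a\alpha}\otimes pu_q\otimes\psi_{c\beta})b^{\mathcal A}_{\alpha+1+\beta}-(-1)^{\deg p}\sum_{\alpha+q+\beta=k}^{\alpha+\beta>0}(1^{\otimes\alpha}\otimes b^{\mathcal{FQ}}_q\otimes1^{\otimes\beta})(pu_{\alpha+1+\beta}):(s\mathcal{FQ})^{\otimes k}\to s\mathcal A$$ for $k>1$ and homogeneous $p\in P$: for all data $(u',u_k)_{k>1}$ as above, the chain map corresponding to it is the unique $\Bbbk$-linear map $u:P\to sA_\infty(\mathcal{FQ},\mathcal A)(\phi,\psi)$ of degree $0$ which restricts to $u'$, has the components $u_k$ for $k>1$, and satisfies the recurrent formula for all $k>1$. -/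

import Mathlib

open scoped TensorProduct DirectSum

universe u

namespace AInf

/-! ## Composable words -/

/-- Composable words in a family `H X Y`, i.e. sequences
`x₁ ∈ H X₀ X₁, …, xₙ ∈ H Xₙ₋₁ Xₙ` with `n ≥ 0`, from `X₀` to `Xₙ`. The word `x₁ x₂ … xₙ` stands for
the pure tensor `x₁ ⊗ x₂ ⊗ … ⊗ xₙ`. -/
inductive Word {O : Type u} (H : O → O → Type u) : O → O → Type u
  | nil (X : O) : Word H X X
  | cons {X Y Z : O} (x : H X Y) (w : Word H Y Z) : Word H X Z

namespace Word

variable {O O' : Type u} {H : O → O → Type u} {H' : O' → O' → Type u}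

/-- The number of letters. -/
def length : {X Y : O} → Word H X Y → ℕ
  | _, _, nil _ => 0
  | _, _, cons _ w => w.length + 1

/-- Concatenation. -/
def append : {X Y Z : O} → Word H X Y → Word H Y Z → Word H X Z
  | _, _, _, nil _, v => v
  | _, _, _, cons x w, v => cons x (w.append v)

/-- The one-letter word. -/
def single {X Y : O} (x : H X Y) : Word H X Y := cons x (nil Y)

/-- Letterwise image of a word. -/
def map (F : O → O') (f : ∀ X Y, H X Y → H' (F X) (F Y)) :
    {X Y : O} → Word H X Y → Word H' (F X) (F Y)
  | _, _, nil X => nil (F X)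
  | _, _, cons x w => cons (f _ _ x) (w.map F f)

/-- Letterwise image of a word, objects being fixed. -/
def mapHom {H₂ : O → O → Type u} (f : ∀ X Y, H X Y → H₂ X Y) :
    {X Y : O} → Word H X Y → Word H₂ X Y
  | _, _, nil X => nil X
  | _, _, cons x w => cons (f _ _ x) (w.mapHom f)

/-- A decomposition of a word into two consecutive (possibly empty) pieces. -/
structure Cut (H : O → O → Type u) (X Z : O) where
  mid : O
  left : Word H X mid
  right : Word H mid Z

/-- All decompositions `w = left · right`. -/
def cuts : {X Z : O} → Word H X Z → List (Cut H X Z)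
  | _, _, nil X => [⟨X, nil X, nil X⟩]
  | X, _, cons x w =>
      ⟨X, nil X, cons x w⟩ :: (cuts w).map (fun c => ⟨c.mid, cons x c.left, c.right⟩)

/-- A decomposition of a word into three consecutive (possibly empty) pieces. -/
structure Cut₃ (H : O → O → Type u) (X W : O) where
  src : O
  tgt : O
  left : Word H X src
  mid : Word H src tgt
  right : Word H tgt W

/-- All decompositions `w = left · mid · right`. -/
def cuts₃ {X W : O} (w : Word H X W) : List (Cut₃ H X W) :=
  (cuts w).flatMap fun c => (cuts c.right).map fun c' => ⟨c.mid, c'.mid, c.left, c'.left, c'.right⟩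

/-- All decompositions of a word into consecutive *nonempty* blocks; such a decomposition is
a word of nonempty words. (The empty word has exactly one, the empty decomposition.) -/
def blocks : {X Y : O} → Word H X Y → List (Word (Word H) X Y)
  | _, _, nil X => [nil X]
  | _, _, cons x w => (blocks w).flatMap fun β =>
      cons (single x) β ::
        (match β with
          | nil _ => []
          | cons q β' => [cons (cons x q) β'])

end Word

/-- A function on composable words with values in modules is multilinear if it is linear in each
letter. Such a function is the same as a system, for all `n ≥ 0`, of linear maps on the
tensor powers `H(X₀,X₁) ⊗ … ⊗ H(Xₙ₋₁,Xₙ)`; for `n = 0`, of an element of `N X X` for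
each object `X`. -/
structure IsMultilinear (k : Type u) [CommRing k] {O : Type u} {H N : O → O → Type u}
    [∀ X Y, AddCommGroup (H X Y)] [∀ X Y, Module k (H X Y)]
    [∀ X Y, AddCommGroup (N X Y)] [∀ X Y, Module k (N X Y)]
    (r : ∀ X Y, Word H X Y → N X Y) : Prop where
  map_add : ∀ {X Y Z W : O} (p : Word H X Y) (x y : H Y Z) (q : Word H Z W),
    r X W (p.append (.cons (x + y) q)) = r X W (p.append (.cons x q)) + r X W (p.append (.cons y q))
  map_smul : ∀ {X Y Z W : O} (p : Word H X Y) (a : k) (x : H Y Z) (q : Word H Z W),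
    r X W (p.append (.cons (a • x) q)) = a • r X W (p.append (.cons x q))

/-! ## Graded quivers -/

/-- A graded `k`-linear quiver: objects and `ℤ`-graded `k`-modules of morphisms
`Hom X Y = ⨁ d, gr X Y d`. -/
structure GrQuiver (k : Type u) [CommRing k] where
  Ob : Type u
  Hom : Ob → Ob → Type u
  [instAdd : ∀ X Y, AddCommGroup (Hom X Y)]
  [instModule : ∀ X Y, Module k (Hom X Y)]
  gr : ∀ X Y, ℤ → Submodule k (Hom X Y)
  internal : ∀ X Y, DirectSum.IsInternal (gr X Y)

attribute [instance] GrQuiver.instAdd GrQuiver.instModule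

namespace GrQuiver

variable {k : Type u} [CommRing k]

/-- The suspension `sA`: the same modules with the grading `(sA)^d = A^{d+1}`.
The map `s : A → sA` is the identity map of underlying modules. -/
def sgr (A : GrQuiver k) (X Y : A.Ob) (d : ℤ) : Submodule k (A.Hom X Y) := A.gr X Y (d + 1)

lemma sgr_internal (A : GrQuiver k) (X Y : A.Ob) : DirectSum.IsInternal (A.sgr X Y) := by
  rw [DirectSum.isInternal_submodule_iff_iSupIndep_and_iSup_eq_top]
  obtain ⟨h1, h2⟩ :=
    (DirectSum.isInternal_submodule_iff_iSupIndep_and_iSup_eq_top _).1 (A.internal X Y)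
  refine ⟨h1.comp (f := fun d : ℤ => d + 1) (add_left_injective 1), ?_⟩
  rw [← h2]
  exact (Equiv.addRight (1 : ℤ)).iSup_comp (g := A.gr X Y)

/-- The Koszul operator: `x ↦ (-1)^{m · deg x} x` for homogeneous `x`, where `deg x` is the degree
of `x` in `sA`. -/
noncomputable def koszul (A : GrQuiver k) (m : ℤ) {X Y : A.Ob} : A.Hom X Y →ₗ[k] A.Hom X Y :=
  letI := (A.sgr_internal X Y).chooseDecomposition
  DirectSum.toModule k ℤ _ (fun e => ((m * e).negOnePow : ℤ) • (A.sgr X Y e).subtype) ∘ₗ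
    (DirectSum.decomposeLinearEquiv (A.sgr X Y)).toLinearMap

/-- The Koszul operator on words: `w ↦ (-1)^{m · deg w} w`. -/
noncomputable def koszulW (A : GrQuiver k) (m : ℤ) {X Y : A.Ob} (w : Word A.Hom X Y) :
    Word A.Hom X Y :=
  w.mapHom fun _ _ => A.koszul m

/-- `A.HasDeg w d`: all letters of `w` are homogeneous in `sA` and their degrees add up to `d`. -/
inductive HasDeg (A : GrQuiver k) : {X Y : A.Ob} → Word A.Hom X Y → ℤ → Prop
  | nil (X : A.Ob) : HasDeg A (.nil X) 0
  | cons {X Y Z : A.Ob} {x : A.Hom X Y} {w : Word A.Hom Y Z} {a e : ℤ}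
      (hx : x ∈ A.sgr X Y a) (hw : HasDeg A w e) : HasDeg A (.cons x w) (a + e)

lemma HasDeg.eq_zero {A : GrQuiver k} {X : A.Ob} {d : ℤ} (h : A.HasDeg (.nil X) d) : d = 0 := by
  cases h; rfl

lemma HasDeg.exists_eq {A : GrQuiver k} {X Y Z : A.Ob} {x : A.Hom X Y} {w : Word A.Hom Y Z} {d : ℤ}
    (h : A.HasDeg (.cons x w) d) : ∃ a e, x ∈ A.sgr X Y a ∧ A.HasDeg w e ∧ d = a + e := by
  cases h with
  | cons hx hw => exact ⟨_, _, hx, hw, rfl⟩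

lemma koszul_of_mem (A : GrQuiver k) (m : ℤ) {X Y : A.Ob} {e : ℤ} {x : A.Hom X Y}
    (hx : x ∈ A.sgr X Y e) : A.koszul m x = ((m * e).negOnePow : ℤ) • x := by
  let := (A.sgr_internal X Y).chooseDecomposition
  have h : DirectSum.decompose (A.sgr X Y) x = DirectSum.of _ e ⟨x, hx⟩ :=
    DirectSum.decompose_of_mem _ hx
  change DirectSum.toModule k ℤ _ _ (DirectSum.decompose (A.sgr X Y) x) = _
  rw [h]
  erw [DirectSum.toModule_lof]
  rfl

end GrQuiver

/-! ## `A∞`-categories, functors and transformations -/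

/-- A graded quiver with a system of linear maps
`bₙ : sA(X₀,X₁) ⊗ … ⊗ sA(Xₙ₋₁,Xₙ) → sA(X₀,Xₙ)`, `n ≥ 1`, of degree `1`
(put together into one function `b` on words, with the convention `b₀ = 0`). -/
structure OpQuiver (k : Type u) [CommRing k] extends GrQuiver k where
  b : ∀ X Y, Word Hom X Y → Hom X Y
  b_nil : ∀ X, b X X (.nil X) = 0
  b_multilinear : IsMultilinear k b
  b_degree : ∀ {X Y} (w : Word Hom X Y) (d : ℤ), toGrQuiver.HasDeg w d →
    b X Y w ∈ toGrQuiver.sgr X Y (d + 1)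

variable {k : Type u} [CommRing k]

/-- The value on a word `w` of `∑ (1^{⊗α} ⊗ b_q ⊗ 1^{⊗β}) r_{α+1+β}`, the sum being over all
`α + q + β = n`, where `n` is the length of `w` (the terms with `q = 0` vanish because `b₀ = 0`).
The Koszul sign moves `b`, which has degree `1`, past the last `β` letters. -/
noncomputable def innerSum (A : OpQuiver k) {N : A.Ob → A.Ob → Type u}
    [∀ X Y, AddCommGroup (N X Y)] (r : ∀ X Y, Word A.Hom X Y → N X Y)
    {X Y : A.Ob} (w : Word A.Hom X Y) : N X Y :=
  (w.cuts₃.map fun c =>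
    r X Y (c.left.append (.cons (A.b _ _ c.mid) (A.koszulW 1 c.right)))).sum

/-- The part of `innerSum` with `α + β > 0`. -/
noncomputable def innerSumPos (A : OpQuiver k) {N : A.Ob → A.Ob → Type u}
    [∀ X Y, AddCommGroup (N X Y)] (r : ∀ X Y, Word A.Hom X Y → N X Y)
    {X Y : A.Ob} (w : Word A.Hom X Y) : N X Y :=
  ((w.cuts₃.filter fun c => 0 < c.left.length + c.right.length).map fun c =>
    r X Y (c.left.append (.cons (A.b _ _ c.mid) (A.koszulW 1 c.right)))).sum

/-- An `A∞`-category: `∑ (1^{⊗r} ⊗ bₙ ⊗ 1^{⊗t}) b_{r+1+t} = 0`. -/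
structure AInfCat (k : Type u) [CommRing k] extends OpQuiver k where
  b_b : ∀ {X Y} (w : Word Hom X Y), innerSum toOpQuiver b w = 0

/-- An `A∞`-functor `f : A → B`: a map on objects and linear maps
`fₙ : sA(X₀,X₁) ⊗ … ⊗ sA(Xₙ₋₁,Xₙ) → sB(X₀f,Xₙf)`, `n ≥ 1`, of degree `0` (with `f₀ = 0`)
such that `∑ (f_{i₁} ⊗ … ⊗ f_{iₗ}) bₗ = ∑ (1^{⊗r} ⊗ bₙ ⊗ 1^{⊗t}) f_{r+1+t}`. -/
structure AInfFunctor (A B : OpQuiver k) where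
  obj : A.Ob → B.Ob
  f : ∀ X Y, Word A.Hom X Y → B.Hom (obj X) (obj Y)
  f_nil : ∀ X, f X X (.nil X) = 0
  f_multilinear : IsMultilinear k (N := fun X Y => B.Hom (obj X) (obj Y)) f
  f_degree : ∀ {X Y} (w : Word A.Hom X Y) (d : ℤ), A.HasDeg w d →
    f X Y w ∈ B.sgr (obj X) (obj Y) d
  comm : ∀ {X Y} (w : Word A.Hom X Y),
    (w.blocks.map fun β => B.b _ _ (β.map obj f)).sum
      = innerSum A (N := fun X Y => B.Hom (obj X) (obj Y)) f w

section Transformations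

variable {A B : OpQuiver k}

/-- The value on a word `w` of
`∑ (f_{i₁} ⊗ … ⊗ f_{iₐ} ⊗ r_n ⊗ g_{j₁} ⊗ … ⊗ g_{jₜ}) b_{a+1+t}`, the sum being over all
`i₁ + … + iₐ + n + j₁ + … + jₜ = length w` with `n ≥ 0` and `i₁, …, jₜ ≥ 1`,
i.e. of `∑ (f_{aα} ⊗ r_q ⊗ g_{cβ}) b_{α+1+β}` with the matrix elements of `f` and `g`. Here `r`
is of degree `d`, which gives a Koszul sign for moving `r` past the arguments of the `g`'s. -/
noncomputable def sandwich (f g : AInfFunctor A B) (d : ℤ)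
    (r : ∀ X Y, Word A.Hom X Y → B.Hom (f.obj X) (g.obj Y))
    {X Y : A.Ob} (w : Word A.Hom X Y) : B.Hom (f.obj X) (g.obj Y) :=
  (w.cuts₃.map fun c =>
    (c.left.blocks.map fun β =>
      ((A.koszulW d c.right).blocks.map fun γ =>
        B.b _ _ ((β.map f.obj f.f).append
          (.cons (r _ _ c.mid) (γ.map g.obj g.f)))).sum).sum).sum

/-- The module `(sA∞(A,B)(f,g))^d` of `A∞`-transformations `r : f → g` of degree `d`: systems of
linear maps `rₙ : sA(X₀,X₁) ⊗ … ⊗ sA(Xₙ₋₁,Xₙ) → sB(X₀f,Xₙg)` of degree `d`, `n ≥ 0`. -/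
def Trans (f g : AInfFunctor A B) (d : ℤ) :
    Submodule k (∀ X Y, Word A.Hom X Y → B.Hom (f.obj X) (g.obj Y)) where
  carrier := {r | IsMultilinear k (N := fun X Y => B.Hom (f.obj X) (g.obj Y)) r ∧
    ∀ X Y (w : Word A.Hom X Y) (e : ℤ), A.HasDeg w e →
      r X Y w ∈ B.sgr (f.obj X) (g.obj Y) (e + d)}
  add_mem' := by
    rintro r s ⟨hr, hr'⟩ ⟨hs, hs'⟩
    refine ⟨⟨fun p x y q => ?_, fun p a x q => ?_⟩,
      fun X Y w e h => Submodule.add_mem _ (hr' X Y w e h) (hs' X Y w e h)⟩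
    · simp only [Pi.add_apply, hr.map_add, hs.map_add]; abel
    · simp only [Pi.add_apply, hr.map_smul, hs.map_smul, smul_add]
  zero_mem' := ⟨⟨fun _ _ _ _ => by simp, fun _ _ _ _ => by simp⟩,
    fun _ _ _ _ _ => Submodule.zero_mem _⟩
  smul_mem' := by
    rintro a r ⟨hr, hr'⟩
    refine ⟨⟨fun p x y q => ?_, fun p c x q => ?_⟩,
      fun X Y w e h => Submodule.smul_mem _ a (hr' X Y w e h)⟩
    · simp only [Pi.smul_apply, hr.map_add, smul_add]
    · simp only [Pi.smul_apply, hr.map_smul, smul_comm a c]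

/-- The differential `r ↦ rB₁ = rb - (-)^r br` on transformations `r` of degree `d`, given by its
components. -/
noncomputable def B₁ (f g : AInfFunctor A B) (d : ℤ)
    (r : ∀ X Y, Word A.Hom X Y → B.Hom (f.obj X) (g.obj Y)) :
    ∀ X Y, Word A.Hom X Y → B.Hom (f.obj X) (g.obj Y) := fun _ _ w =>
  sandwich f g d r w -
    (d.negOnePow : ℤ) • innerSum A (N := fun X Y => B.Hom (f.obj X) (g.obj Y)) r w

/-- The degree `d` part of the graded module `∏_{X,Y} C((sA)^{⊗n}(X,Y), sB(Xf,Yg))`. -/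
def Comp (f g : AInfFunctor A B) (n : ℕ) (d : ℤ) :
    Submodule k (∀ X Y, {w : Word A.Hom X Y // w.length = n} → B.Hom (f.obj X) (g.obj Y)) where
  carrier := {r |
    (∀ {X Y Z W : A.Ob} (p : Word A.Hom X Y) (x y : A.Hom Y Z) (q : Word A.Hom Z W) (h h₁ h₂),
      r X W ⟨p.append (.cons (x + y) q), h⟩
        = r X W ⟨p.append (.cons x q), h₁⟩ + r X W ⟨p.append (.cons y q), h₂⟩) ∧
    (∀ {X Y Z W : A.Ob} (p : Word A.Hom X Y) (a : k) (x : A.Hom Y Z) (q : Word A.Hom Z W) (h h₁),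
      r X W ⟨p.append (.cons (a • x) q), h⟩ = a • r X W ⟨p.append (.cons x q), h₁⟩) ∧
    ∀ X Y (w : {w : Word A.Hom X Y // w.length = n}) (e : ℤ), A.HasDeg w.1 e →
      r X Y w ∈ B.sgr (f.obj X) (g.obj Y) (e + d)}
  add_mem' := by
    rintro r s ⟨hr, hr', hr''⟩ ⟨hs, hs', hs''⟩
    refine ⟨fun p x y q h h₁ h₂ => ?_, fun p a x q h h₁ => ?_,
      fun X Y w e h => Submodule.add_mem _ (hr'' X Y w e h) (hs'' X Y w e h)⟩
    · simp only [Pi.add_apply, hr p x y q h h₁ h₂, hs p x y q h h₁ h₂]; abel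
    · simp only [Pi.add_apply, hr' p a x q h h₁, hs' p a x q h h₁, smul_add]
  zero_mem' := ⟨fun _ _ _ _ _ _ _ => by simp, fun _ _ _ _ _ _ => by simp,
    fun _ _ _ _ _ => Submodule.zero_mem _⟩
  smul_mem' := by
    rintro a r ⟨hr, hr', hr''⟩
    refine ⟨fun p x y q h h₁ h₂ => ?_, fun p c x q h h₁ => ?_,
      fun X Y w e h => Submodule.smul_mem _ a (hr'' X Y w e h)⟩
    · simp only [Pi.smul_apply, hr p x y q h h₁ h₂, smul_add]
    · simp only [Pi.smul_apply, hr' p c x q h h₁, smul_comm a c]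

/-- The projection `pr_n` of a transformation to its component `rₙ`. -/
def pr (f g : AInfFunctor A B) (n : ℕ) (d : ℤ) : Trans f g d →ₗ[k] Comp f g n d where
  toFun r := ⟨fun X Y w => r.1 X Y w.1, fun p x y q _ _ _ => r.2.1.map_add p x y q,
    fun p a x q _ _ => r.2.1.map_smul p a x q, fun X Y w e h => r.2.2 X Y w.1 e h⟩
  map_add' _ _ := rfl
  map_smul' _ _ := rfl

end Transformations

/-! ## Differential graded quivers and `A₁`-transformations -/

/-- A differential graded quiver. As the suspension `s` is the identity on underlying modules,
`diff` is the differential of `Q` as well as the differential `b₁` of the suspension `sQ`,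
`s b₁ = diff s`. -/
structure DGQuiver (k : Type u) [CommRing k] extends GrQuiver k where
  diff : ∀ X Y, Hom X Y →ₗ[k] Hom X Y
  diff_degree : ∀ {X Y} (d : ℤ) (x : Hom X Y), x ∈ gr X Y d → diff X Y x ∈ gr X Y (d + 1)
  diff_diff : ∀ {X Y} (x : Hom X Y), diff X Y (diff X Y x) = 0

/-- An `A₁`-functor from a differential graded quiver to an `A∞`-category: a
chain map of differential graded quivers `f₁ : (sQ, b₁) → (sA, b₁)`. -/
structure A₁Functor (Q : DGQuiver k) (A : OpQuiver k) where
  obj : Q.Ob → A.Ob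
  f₁ : ∀ X Y, Q.Hom X Y →ₗ[k] A.Hom (obj X) (obj Y)
  f₁_degree : ∀ {X Y} (d : ℤ) (x : Q.Hom X Y), x ∈ Q.sgr X Y d →
    f₁ X Y x ∈ A.sgr (obj X) (obj Y) d
  comm : ∀ {X Y} (x : Q.Hom X Y),
    A.b _ _ (.single (f₁ X Y x)) = f₁ X Y (Q.diff X Y x)

section A₁

variable {Q : DGQuiver k} {A : OpQuiver k}

/-- Pairs `(r₀, r₁)`, `r₀ ∈ ∏ sA(Xf,Xg)` and `r₁ ∈ ∏ Hom(sQ(X,Y), sA(Xf,Yg))`. -/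
abbrev A₁Pair (f g : A₁Functor Q A) : Type u :=
  (∀ X, A.Hom (f.obj X) (g.obj X)) × (∀ X Y, Q.Hom X Y →ₗ[k] A.Hom (f.obj X) (g.obj Y))

/-- The module `(sA₁(Q,A)(f,g))^d` of `A₁`-transformations `f → g` of degree `d`. -/
def A₁Trans (f g : A₁Functor Q A) (d : ℤ) : Submodule k (A₁Pair f g) where
  carrier := {r | (∀ X, r.1 X ∈ A.sgr _ _ d) ∧
    ∀ X Y (e : ℤ) (x : Q.Hom X Y), x ∈ Q.sgr X Y e → r.2 X Y x ∈ A.sgr _ _ (e + d)}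
  add_mem' h h' := ⟨fun X => Submodule.add_mem _ (h.1 X) (h'.1 X),
    fun X Y e x hx => Submodule.add_mem _ (h.2 X Y e x hx) (h'.2 X Y e x hx)⟩
  zero_mem' := ⟨fun _ => Submodule.zero_mem _, fun _ _ _ _ _ => Submodule.zero_mem _⟩
  smul_mem' a _ h := ⟨fun X => Submodule.smul_mem _ a (h.1 X),
    fun X Y e x hx => Submodule.smul_mem _ a (h.2 X Y e x hx)⟩

/-- `(rB₁)₀ = r₀ b₁`. -/
def A₁B₁_zero (f g : A₁Functor Q A) (r : A₁Pair f g) (X : Q.Ob) :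
    A.Hom (f.obj X) (g.obj X) :=
  A.b _ _ (.single (r.1 X))

/-- `(rB₁)₁ = r₁ b₁ + (f₁ ⊗ r₀) b₂ + (r₀ ⊗ g₁) b₂ - (-)^r b₁ r₁`, for `r` of degree `d`. -/
noncomputable def A₁B₁_one (f g : A₁Functor Q A) (d : ℤ) (r : A₁Pair f g) (X Y : Q.Ob)
    (x : Q.Hom X Y) : A.Hom (f.obj X) (g.obj Y) :=
  A.b _ _ (.single (r.2 X Y x))
    + A.b _ _ (.cons (f.f₁ X Y x) (.single (r.1 Y)))
    + A.b _ _ (.cons (r.1 X) (.single (g.f₁ X Y (Q.koszul d x))))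
    - (d.negOnePow : ℤ) • r.2 X Y (Q.diff X Y x)

end A₁

/-! ## Plane rooted trees -/

/-- Plane rooted trees all of whose internal vertices have at least two incoming edges: either the
trivial tree (no internal vertices, one input), or a root vertex with a list of at least
two subtrees attached to it from left to right. -/
inductive PTree : Type
  | leaf : PTree
  | node (t₁ t₂ : PTree) (ts : List PTree) : PTree

namespace PTree

mutual
/-- The number of input vertices of a tree. -/
def leaves : PTree → ℕ
  | leaf => 1
  | node t₁ t₂ ts => (leavesF ts + leaves t₂) + leaves t₁
/-- The number of input vertices of a forest. -/
def leavesF : List PTree → ℕ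
  | [] => 0
  | t :: ts => leavesF ts + leaves t
end

mutual
/-- The number `|t|` of internal vertices of a tree. -/
def size : PTree → ℕ
  | leaf => 0
  | node t₁ t₂ ts => 1 + (size t₁ + (size t₂ + sizeF ts))
/-- The number of internal vertices of a forest. -/
def sizeF : List PTree → ℕ
  | [] => 0
  | t :: ts => size t + sizeF ts
end

/-- The tree `(t₁ ⊔ … ⊔ tₙ) · 𝔱ₙ`, for `n ≥ 2` (other lists do not occur). -/
def graft : List PTree → PTree
  | t₁ :: t₂ :: ts => node t₁ t₂ ts
  | _ => leaf

/-- All decompositions of a list into two consecutive pieces. -/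
def listCuts : List PTree → List (List PTree × List PTree)
  | [] => [([], [])]
  | a :: l => ([], a :: l) :: (listCuts l).map fun c => (a :: c.1, c.2)

/-- For a root vertex with the list `l` of subtrees, all ways to create a new edge at the root:
`l = A ⊔ B ⊔ C`, where `B` has at least two elements and is not all of `l`, is replaced with
`A ⊔ graft B ⊔ C`. The recorded number is the height of the new vertex, the root of `graft B`:
it comes right after the root vertex and the vertices of `A`. -/
def rootExpansions (l : List PTree) : List (ℕ × PTree) :=
  (listCuts l).flatMap fun c =>
    ((listCuts c.2).filter fun c' => 2 ≤ c'.1.length ∧ 0 < c.1.length + c'.2.length).map fun c' =>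
      (1 + sizeF c.1 + 1, graft (c.1 ++ graft c'.1 :: c'.2))

mutual
/-- The list of all pairs `(t', e)`, where `e` is an edge of `t'` between internal vertices such
that contracting `e` in `t'` gives `t`. The pair `(t', e)` is recorded as `(h, t')`, where `h` is
the height of the highest vertex of `e`: internal vertices of a tree are numbered
starting with `1` at the root vertex, then those of its subtrees from left to right. -/
def expansions : PTree → List (ℕ × PTree)
  | leaf => []
  | node t₁ t₂ ts => rootExpansions (t₁ :: t₂ :: ts) ++
      (((expansions t₁).map fun c => (c.1, c.2 :: t₂ :: ts)) ++
        ((expansions t₂).map fun c => (size t₁ + c.1, t₁ :: c.2 :: ts)) ++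
        ((expansionsF ts).map fun c => (size t₁ + (size t₂ + c.1), t₁ :: t₂ :: c.2))).map
      fun c => (1 + c.1, graft c.2)
/-- The same for forests. -/
def expansionsF : List PTree → List (ℕ × List PTree)
  | [] => []
  | t :: ts => ((expansions t).map fun c => (c.1, c.2 :: ts)) ++
      ((expansionsF ts).map fun c => (size t + c.1, t :: c.2))
end

end PTree

/-! ## The free `A∞`-category -/

namespace Free

open PTree

variable (Q : DGQuiver k)

/-- The tensor powers `Tⁿ sQ(X,Y) = ⨁ sQ(X₀,X₁) ⊗ … ⊗ sQ(Xₙ₋₁,Xₙ)`, defined by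
`T⁰(X,Y) = k` if `X = Y` and `0` otherwise, and
`Tⁿ⁺¹(X,Y) = ⨁_Z sQ(X,Z) ⊗ Tⁿ(Z,Y)`. -/
noncomputable def T : ℕ → Q.Ob → Q.Ob → ModuleCat.{u} k
  | 0, X, Y => ModuleCat.of k (PLift (X = Y) →₀ k)
  | n + 1, X, Y => ModuleCat.of k (⨁ Z : Q.Ob, Q.Hom X Z ⊗[k] T n Z Y)

/-- `1_X ∈ T⁰(X,X)`. -/
noncomputable def one (X : Q.Ob) : T Q 0 X X :=
  (Finsupp.single ⟨rfl⟩ 1 : PLift (X = X) →₀ k)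

open Classical in
/-- `x, y ↦ x ⊗ y`. -/
noncomputable def cons (n : ℕ) (X Z Y : Q.Ob) :
    Q.Hom X Z →ₗ[k] T Q n Z Y →ₗ[k] T Q (n + 1) X Y :=
  (TensorProduct.mk k (Q.Hom X Z) (T Q n Z Y)).compr₂
    (DirectSum.lof k Q.Ob (fun Z => Q.Hom X Z ⊗[k] T Q n Z Y) Z)

open Classical in
/-- The linear map on `Tⁿ⁺¹` determined by bilinear maps on `sQ(X,Z) × Tⁿ(Z,Y)`. -/
noncomputable def lift {n : ℕ} {X Y : Q.Ob} {N : Type u} [AddCommGroup N] [Module k N]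
    (φ : ∀ Z, Q.Hom X Z →ₗ[k] T Q n Z Y →ₗ[k] N) : T Q (n + 1) X Y →ₗ[k] N :=
  DirectSum.toModule k Q.Ob N (fun Z => TensorProduct.lift (φ Z))

/-- Concatenation of tensors, `x, y ↦ x ⊗ y`. -/
noncomputable def concat : (m n : ℕ) → (X Y Z : Q.Ob) →
    T Q m X Y →ₗ[k] T Q n Y Z →ₗ[k] T Q (n + m) X Z
  | 0, n, X, Y, Z =>
      (Finsupp.lsum k fun h : PLift (X = Y) =>
        LinearMap.toSpanSingleton k (T Q n Y Z →ₗ[k] T Q n X Z)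
          (h.down ▸ LinearMap.id) :
        (PLift (X = Y) →₀ k) →ₗ[k] (T Q n Y Z →ₗ[k] T Q n X Z))
  | m + 1, n, X, Y, Z =>
      lift Q fun V => LinearMap.mk₂ k (fun x y => (cons Q (n + m) X V Z x) ∘ₗ concat m n V Y Z y)
        (fun _ _ _ => by ext; simp) (fun _ _ _ => by ext; simp)
        (fun _ _ _ => by ext; simp) (fun _ _ _ => by ext; simp)

/-- The Koszul operator `y ↦ (-1)^{m · deg y} y` on `Tⁿ sQ`. -/
noncomputable def koszulT (m : ℤ) : (n : ℕ) → (X Y : Q.Ob) → T Q n X Y →ₗ[k] T Q n X Y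
  | 0, _, _ => LinearMap.id
  | n + 1, X, Y => lift Q fun Z => (cons Q n X Z Y).compl₁₂ (Q.koszul m) (koszulT m n Z Y)

/-- The differential `∑ 1^{⊗i} ⊗ d ⊗ 1^{⊗j}` of `Tⁿ sQ`: `(x ⊗ y)d = (-1)^{deg y} xd ⊗ y + x ⊗ yd`. -/
noncomputable def dT : (n : ℕ) → (X Y : Q.Ob) → T Q n X Y →ₗ[k] T Q n X Y
  | 0, _, _ => 0
  | n + 1, X, Y => lift Q fun Z =>
      (cons Q n X Z Y).compl₁₂ (Q.diff X Z) (koszulT Q 1 n Z Y) + (cons Q n X Z Y).compl₂ (dT n Z Y)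

/-- The degree `d` part of `Tⁿ sQ(X,Y)`. -/
noncomputable def grT : (n : ℕ) → (X Y : Q.Ob) → ℤ → Submodule k (T Q n X Y)
  | 0, _, _, d => if d = 0 then ⊤ else ⊥
  | n + 1, X, Y, d => Submodule.span k
      {z | ∃ (Z : Q.Ob) (a e : ℤ) (x : Q.Hom X Z) (y : T Q n Z Y),
        x ∈ Q.sgr X Z a ∧ y ∈ grT n Z Y e ∧ a + e = d ∧ z = cons Q n X Z Y x y}

/-- `sFQ(X,Y) = ⨁ₜ Tⁿ sQ(X,Y)[-|t|]`, the sum over all plane trees `t`, where `n` is the number of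
inputs of `t`. -/
abbrev Hom (X Y : Q.Ob) : Type u := ⨁ t : PTree, T Q t.leaves X Y

/-- The analogue of `Hom` with forests in place of trees. -/
abbrev FHom (X Y : Q.Ob) : Type u := ⨁ f : List PTree, T Q (leavesF f) X Y

open Classical in
/-- The inclusion of the summand `Tⁿ sQ(X,Y)` indexed by a tree `t` with `n` inputs (`0` if the
number of inputs is different from `n`). -/
noncomputable def gen (t : PTree) (n : ℕ) (X Y : Q.Ob) : T Q n X Y →ₗ[k] Hom Q X Y :=
  if h : t.leaves = n then h ▸ DirectSum.lof k PTree (fun t => T Q t.leaves X Y) t else 0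

open Classical in
/-- The inclusion of the summand of a forest. -/
noncomputable def genF (f : List PTree) (X Y : Q.Ob) : T Q (leavesF f) X Y →ₗ[k] FHom Q X Y :=
  DirectSum.lof k (List PTree) (fun f => T Q (leavesF f) X Y) f

open Classical in
/-- The operation `b₁`, on the summand of `t`: `d ⊕ (-1)^{β(t')} s^{-1}`, where the sum is over all
`t' = t + edge`, `β(t') = 1 + h`, and `h` is the height of the highest vertex of the edge.
On `Tⁿ sQ[-|t|]` the differential `d` is `(-1)^{|t|}` times that of `Tⁿ sQ`. -/
noncomputable def b₁ (X Y : Q.Ob) : Hom Q X Y →ₗ[k] Hom Q X Y :=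
  DirectSum.toModule k PTree _ fun t =>
    ((t.size : ℤ).negOnePow : ℤ) • (gen Q t t.leaves X Y ∘ₗ dT Q t.leaves X Y) +
    (t.expansions.map fun c =>
      (((1 + c.1 : ℕ) : ℤ).negOnePow : ℤ) • gen Q c.2 t.leaves X Y).sum

open Classical in
/-- Adding one more tree tensor to a forest tensor: `(t, y), (f, z) ↦ ± (t ⊔ f, y ⊗ z)`,
where the sign is `(-1)^{|t| · (deg z + |f|)}`; the degree of the second factor in the shifted
grading is `deg z + |f|`. -/
noncomputable def mul (X Y Z : Q.Ob) : Hom Q X Y →ₗ[k] FHom Q Y Z →ₗ[k] FHom Q X Z :=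
  DirectSum.toModule k PTree _ fun t => LinearMap.flip <|
    DirectSum.toModule k (List PTree) _ fun f => LinearMap.flip <|
      ((t.size * sizeF f : ℤ).negOnePow : ℤ) •
        ((concat Q t.leaves (leavesF f) X Y Z).compl₂ (koszulT Q t.size (leavesF f) Y Z)).compr₂
          (genF Q (t :: f) X Z)

/-- `x₁ ⊗ … ⊗ xₙ ↦ ± x₁ … xₙ`: for `xᵢ = (tᵢ, yᵢ)` the result is
`(t₁ ⊔ … ⊔ tₙ, (x₁ ⊗ … ⊗ xₙ)(s^{|t₁|} ⊗ … ⊗ s^{|tₙ|}))`. -/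
noncomputable def fold : {X Y : Q.Ob} → Word (Hom Q) X Y → FHom Q X Y
  | _, _, .nil X => genF Q [] X X (one Q X)
  | _, _, .cons x w => mul Q _ _ _ x (fold w)

open Classical in
/-- `(f, y) ↦ (f · 𝔱ₙ, y)` for forests `f` of `n ≥ 2` trees. -/
noncomputable def close (X Y : Q.Ob) : FHom Q X Y →ₗ[k] Hom Q X Y :=
  DirectSum.toModule k (List PTree) _ fun f => gen Q (graft f) (leavesF f) X Y

/-- The operations of the free `A∞`-category: `b₁` as above, and
`bₙ = s^{|t₁|} ⊗ … ⊗ s^{|tₙ₋₁|} ⊗ s^{|tₙ|-|t|}`, `t = (t₁ ⊔ … ⊔ tₙ) · 𝔱ₙ`, for `n ≥ 2`. -/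
noncomputable def b : (X Y : Q.Ob) → Word (Hom Q) X Y → Hom Q X Y
  | _, _, .nil _ => 0
  | _, _, .cons x (.nil _) => b₁ Q _ _ x
  | _, _, .cons x (.cons y w) => close Q _ _ (fold Q (.cons x (.cons y w)))

/-- The degree `d` part of `sFQ(X,Y)`: the summand of `t` is shifted by `|t|`. -/
noncomputable def grS (X Y : Q.Ob) (d : ℤ) : Submodule k (Hom Q X Y) :=
  Submodule.span k {z | ∃ (t : PTree) (e : ℤ) (y : T Q t.leaves X Y),
    y ∈ grT Q t.leaves X Y e ∧ e + t.size = d ∧ z = gen Q t t.leaves X Y y}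

/-! ### `sFQ` is a graded quiver -/

lemma internal_of_coaction {M : Type u} [AddCommGroup M] [Module k M] (g : ℤ → Submodule k M)
    (c : M →ₗ[k] (ℤ →₀ M)) (h : ∀ d, ∀ m ∈ g d, c m = Finsupp.single d m) (hs : ⨆ d, g d = ⊤) :
    DirectSum.IsInternal g := by
  have key : ∀ (x : ⨁ d, g d) (i : ℤ), c (DirectSum.coeAddMonoidHom g x) i = (x i : M) := by
    intro x i
    induction x using DirectSum.induction_on with
    | zero => simp
    | of d m =>
      rw [DirectSum.coeAddMonoidHom_of, h d m m.2, DirectSum.coe_of_apply, Finsupp.single_apply]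
      split_ifs <;> rfl
    | add x y hx hy => simp [hx, hy]
  refine ⟨fun x y hxy => ?_, fun m => ?_⟩
  · ext i
    rw [← key x i, ← key y i, hxy]
  · have hm : m ∈ ⨆ d, g d := hs ▸ Submodule.mem_top
    induction hm using Submodule.iSup_induction' with
    | mem d m hm => exact ⟨DirectSum.of _ d ⟨m, hm⟩, by simp⟩
    | zero => exact ⟨0, by simp⟩
    | add x y _ _ hx hy =>
      obtain ⟨a, rfl⟩ := hx
      obtain ⟨b, rfl⟩ := hy
      exact ⟨a + b, by simp⟩

lemma exists_coaction {M : Type u} [AddCommGroup M] [Module k M] (g : ℤ → Submodule k M)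
    (hg : DirectSum.IsInternal g) :
    ∃ c : M →ₗ[k] (ℤ →₀ M), ∀ d, ∀ m ∈ g d, c m = Finsupp.single d m := by
  let := hg.chooseDecomposition
  refine ⟨DirectSum.toModule k ℤ _ (fun e => Finsupp.lsingle e ∘ₗ (g e).subtype) ∘ₗ
    (DirectSum.decomposeLinearEquiv g).toLinearMap, fun d m hm => ?_⟩
  have h : DirectSum.decompose g m = DirectSum.of _ d ⟨m, hm⟩ := DirectSum.decompose_of_mem _ hm
  change DirectSum.toModule k ℤ _ _ (DirectSum.decompose g m) = _
  rw [h]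
  erw [DirectSum.toModule_lof]
  rfl

lemma lift_cons {n : ℕ} {X Y : Q.Ob} {N : Type u} [AddCommGroup N] [Module k N]
    (φ : ∀ Z, Q.Hom X Z →ₗ[k] T Q n Z Y →ₗ[k] N) (Z : Q.Ob) (x : Q.Hom X Z) (y : T Q n Z Y) :
    lift Q φ (cons Q n X Z Y x y) = φ Z x y := by
  classical
  change DirectSum.toModule k Q.Ob N (fun Z => TensorProduct.lift (φ Z))
    (DirectSum.lof k Q.Ob (fun Z => Q.Hom X Z ⊗[k] T Q n Z Y) Z (x ⊗ₜ y)) = _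
  rw [DirectSum.toModule_lof, TensorProduct.lift.tmul]

lemma T_induction {n : ℕ} {X Y : Q.Ob} (S : Submodule k (T Q (n + 1) X Y))
    (h : ∀ Z x y, cons Q n X Z Y x y ∈ S) : S = ⊤ := by
  refine Submodule.eq_top_iff'.2 fun z => ?_
  change (⨁ Z : Q.Ob, Q.Hom X Z ⊗[k] T Q n Z Y) at z
  induction z using DirectSum.induction_on with
  | zero => exact S.zero_mem
  | of Z z =>
    induction z using TensorProduct.induction_on with
    | zero => rw [map_zero]; exact S.zero_mem
    | tmul x y => exact h Z x y
    | add x y hx hy => rw [map_add]; exact S.add_mem hx hy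
  | add x y hx hy => exact S.add_mem hx hy

lemma grT_iSup : ∀ (n : ℕ) (X Y : Q.Ob), ⨆ d, grT Q n X Y d = ⊤
  | 0, X, Y => by
    refine top_unique (le_trans ?_ (le_iSup _ 0))
    simp [grT]
  | n + 1, X, Y => by
    refine T_induction Q _ fun Z x y => ?_
    have hx : x ∈ ⨆ d, Q.sgr X Z d := by
      rw [(Q.sgr_internal X Z).submodule_iSup_eq_top]; trivial
    have hy : y ∈ ⨆ d, grT Q n Z Y d := by rw [grT_iSup n Z Y]; trivial
    induction hx using Submodule.iSup_induction' with
    | zero => simp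
    | add x x' _ _ hx hx' => rw [map_add, LinearMap.add_apply]; exact Submodule.add_mem _ hx hx'
    | mem a x hx =>
      induction hy using Submodule.iSup_induction' with
      | zero => simp
      | add y y' _ _ hy hy' => rw [map_add]; exact Submodule.add_mem _ hy hy'
      | mem e y hy =>
        exact Submodule.mem_iSup_of_mem (a + e)
          (Submodule.subset_span ⟨Z, a, e, x, y, hx, hy, rfl, rfl⟩)

lemma grT_coaction : ∀ (n : ℕ) (X Y : Q.Ob), ∃ c : T Q n X Y →ₗ[k] (ℤ →₀ T Q n X Y),
    ∀ d, ∀ m ∈ grT Q n X Y d, c m = Finsupp.single d m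
  | 0, X, Y => by
    refine ⟨Finsupp.lsingle 0, fun d m hm => ?_⟩
    by_cases hd : d = 0
    · subst hd; rfl
    · simp only [grT, hd, if_false, Submodule.mem_bot] at hm
      subst hm; simp
  | n + 1, X, Y => by
    choose cQ hQ using fun Z => exists_coaction _ (Q.sgr_internal X Z)
    choose cT hT using fun Z => grT_coaction n Z Y
    let bil : ∀ Z, (ℤ →₀ Q.Hom X Z) →ₗ[k] (ℤ →₀ T Q n Z Y) →ₗ[k] (ℤ →₀ T Q (n + 1) X Y) :=
      fun Z => Finsupp.lsum k fun a => LinearMap.flip (Finsupp.lsum k fun e =>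
        LinearMap.flip ((cons Q n X Z Y).compr₂ (Finsupp.lsingle (a + e))))
    refine ⟨lift Q fun Z => (bil Z).compl₁₂ (cQ Z) (cT Z), fun d m hm => ?_⟩
    rw [grT] at hm
    induction hm using Submodule.span_induction with
    | zero => simp
    | add x y _ _ hx hy => rw [map_add, hx, hy, Finsupp.single_add]
    | smul a x _ hx => rw [map_smul, hx, Finsupp.smul_single]
    | mem z hz =>
      obtain ⟨Z, a, e, x, y, hx, hy, rfl, rfl⟩ := hz
      rw [lift_cons, LinearMap.compl₁₂_apply, hQ Z a x hx, hT Z e y hy]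
      simp [bil]

lemma gen_self (t : PTree) (X Y : Q.Ob) (y : T Q t.leaves X Y) :
    gen Q t t.leaves X Y y = (open Classical in
      DirectSum.lof k PTree (fun t => T Q t.leaves X Y) t y) := by
  simp [gen]

lemma grS_internal (X Y : Q.Ob) : DirectSum.IsInternal (grS Q X Y) := by
  classical
  choose c hc using fun n => grT_coaction Q n X Y
  refine internal_of_coaction _ (DirectSum.toModule k PTree _ fun t =>
    (Finsupp.lsum k fun e => Finsupp.lsingle (e + t.size) ∘ₗ gen Q t t.leaves X Y) ∘ₗ c t.leaves)
    (fun d m hm => ?_) ?_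
  · rw [grS] at hm
    induction hm using Submodule.span_induction with
    | zero => simp
    | add x y _ _ hx hy => rw [map_add, hx, hy, Finsupp.single_add]
    | smul a x _ hx => rw [map_smul, hx, Finsupp.smul_single]
    | mem z hz =>
      obtain ⟨t, e, y, hy, rfl, rfl⟩ := hz
      rw [gen_self]
      convert DirectSum.toModule_lof k (M := fun t : PTree => T Q t.leaves X Y) t y using 1
      rw [LinearMap.comp_apply, hc _ e y hy]
      simp [gen_self]
  · refine Submodule.eq_top_iff'.2 fun z => ?_
    induction z using DirectSum.induction_on with
    | zero => exact Submodule.zero_mem _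
    | add x y hx hy => exact Submodule.add_mem _ hx hy
    | of t y =>
      have hy : y ∈ ⨆ d, grT Q t.leaves X Y d := by rw [grT_iSup]; trivial
      induction hy using Submodule.iSup_induction' with
      | zero => simp
      | add x y _ _ hx hy => rw [map_add]; exact Submodule.add_mem _ hx hy
      | mem e y hy =>
        refine Submodule.mem_iSup_of_mem (e + t.size) (Submodule.subset_span ⟨t, e, y, hy, rfl, ?_⟩)
        rw [gen_self]
        rfl

/-- The graded quiver `FQ`, with `sFQ(X,Y)` as above. -/
noncomputable abbrev quiver : GrQuiver k where
  Ob := Q.Ob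
  Hom := Hom Q
  gr X Y d := grS Q X Y (d - 1)
  internal X Y := by
    rw [DirectSum.isInternal_submodule_iff_iSupIndep_and_iSup_eq_top]
    obtain ⟨h1, h2⟩ :=
      (DirectSum.isInternal_submodule_iff_iSupIndep_and_iSup_eq_top _).1 (grS_internal Q X Y)
    refine ⟨h1.comp (f := fun d : ℤ => d - 1) (sub_left_injective), ?_⟩
    rw [← h2]
    exact (Equiv.subRight (1 : ℤ)).iSup_comp (g := grS Q X Y)

lemma quiver_sgr (X Y : Q.Ob) (d : ℤ) : (quiver Q).sgr X Y d = grS Q X Y d := by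
  change grS Q X Y (d + 1 - 1) = _
  rw [add_sub_cancel_right]

/-! ### Degrees and multilinearity of the operations -/

lemma listCuts_append : ∀ (l : List PTree), ∀ c ∈ listCuts l, c.1 ++ c.2 = l
  | [], c, h => by simp only [listCuts, List.mem_singleton] at h; subst h; rfl
  | a :: l, c, h => by
    simp only [listCuts, List.mem_cons, List.mem_map] at h
    rcases h with rfl | ⟨c', h', rfl⟩
    · rfl
    · simp [listCuts_append l c' h']

lemma leavesF_append : ∀ l l' : List PTree, leavesF (l ++ l') = leavesF l' + leavesF l
  | [], l' => by simp [leavesF]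
  | a :: l, l' => by simp [leavesF, leavesF_append l l', add_assoc]

lemma sizeF_append : ∀ l l' : List PTree, sizeF (l ++ l') = sizeF l + sizeF l'
  | [], l' => by simp [sizeF]
  | a :: l, l' => by simp [sizeF, sizeF_append l l', add_assoc]

lemma graft_spec : ∀ l : List PTree, 2 ≤ l.length →
    (graft l).leaves = leavesF l ∧ (graft l).size = 1 + sizeF l
  | t₁ :: t₂ :: ts, _ => by simp [graft, leaves, leavesF, size, sizeF]

lemma rootExpansions_spec (l : List PTree) (c) (h : c ∈ rootExpansions l) :
    c.2.leaves = leavesF l ∧ c.2.size = 1 + sizeF l + 1 := by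
  simp only [rootExpansions, List.mem_flatMap, List.mem_map, List.mem_filter,
    decide_eq_true_eq] at h
  obtain ⟨⟨A, R⟩, hA, ⟨B, C⟩, ⟨hB, h2, h0⟩, rfl⟩ := h
  obtain rfl := listCuts_append _ _ hA
  obtain rfl := listCuts_append _ _ hB
  dsimp only at *
  have hg := graft_spec (A ++ graft B :: C) (by simp at h0 ⊢; omega)
  have hB := graft_spec B h2
  rw [hg.1, hg.2]
  simp only [leavesF_append, sizeF_append, leavesF, sizeF, hB.1, hB.2]
  exact ⟨trivial, by omega⟩

mutual
lemma expansions_spec : ∀ (t : PTree), ∀ c ∈ expansions t,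
    c.2.leaves = t.leaves ∧ c.2.size = t.size + 1
  | .leaf, c, h => by simp [expansions] at h
  | .node t₁ t₂ ts, c, h => by
    simp only [expansions, List.mem_append, List.mem_map] at h
    rcases h with h | ⟨c', (⟨c'', h, rfl⟩ | ⟨c'', h, rfl⟩) | ⟨c'', h, rfl⟩, rfl⟩
    · obtain ⟨h1, h2⟩ := rootExpansions_spec _ c h
      simp only [leaves, size, leavesF, sizeF] at h1 h2 ⊢
      omega
    · have := expansions_spec t₁ c'' h
      simp only [graft, leaves, size]
      omega
    · have := expansions_spec t₂ c'' h
      simp only [graft, leaves, size]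
      omega
    · have := expansionsF_spec ts c'' h
      simp only [graft, leaves, size]
      omega
lemma expansionsF_spec : ∀ (l : List PTree), ∀ c ∈ expansionsF l,
    leavesF c.2 = leavesF l ∧ sizeF c.2 = sizeF l + 1
  | [], c, h => by simp [expansionsF] at h
  | t :: ts, c, h => by
    simp only [expansionsF, List.mem_append, List.mem_map] at h
    rcases h with ⟨c'', h, rfl⟩ | ⟨c'', h, rfl⟩
    · have := expansions_spec t c'' h
      simp only [leavesF, sizeF]
      omega
    · have := expansionsF_spec ts c'' h
      simp only [leavesF, sizeF]
      omega
end

lemma gen_mem (t : PTree) {n : ℕ} (h : t.leaves = n) {X Y : Q.Ob} {e d : ℤ} (y : T Q n X Y)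
    (hy : y ∈ grT Q n X Y e) (hd : e + t.size = d) : gen Q t n X Y y ∈ grS Q X Y d := by
  subst h
  exact Submodule.subset_span ⟨t, e, y, hy, hd, rfl⟩

lemma koszul_mem (m : ℤ) {X Y : Q.Ob} {e : ℤ} {x : Q.Hom X Y} (hx : x ∈ Q.sgr X Y e) :
    Q.koszul m x ∈ Q.sgr X Y e := by
  rw [Q.koszul_of_mem m hx]
  exact zsmul_mem hx _

lemma cons_mem {n : ℕ} {X Z Y : Q.Ob} {a e d : ℤ} {x : Q.Hom X Z} {y : T Q n Z Y}
    (hx : x ∈ Q.sgr X Z a) (hy : y ∈ grT Q n Z Y e) (h : a + e = d) :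
    cons Q n X Z Y x y ∈ grT Q (n + 1) X Y d :=
  Submodule.subset_span ⟨Z, a, e, x, y, hx, hy, h, rfl⟩

lemma grT_succ_le {n : ℕ} {X Y : Q.Ob} {d : ℤ} (S : Submodule k (T Q (n + 1) X Y))
    (h : ∀ Z a e (x : Q.Hom X Z) (y : T Q n Z Y), x ∈ Q.sgr X Z a → y ∈ grT Q n Z Y e →
      a + e = d → cons Q n X Z Y x y ∈ S) : grT Q (n + 1) X Y d ≤ S := by
  rw [grT, Submodule.span_le]
  rintro _ ⟨Z, a, e, x, y, hx, hy, hd, rfl⟩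
  exact h Z a e x y hx hy hd

lemma koszulT_mem (m : ℤ) : ∀ (n : ℕ) (X Y : Q.Ob) (e : ℤ), ∀ y ∈ grT Q n X Y e,
    koszulT Q m n X Y y ∈ grT Q n X Y e
  | 0, _, _, _, _, hy => hy
  | n + 1, X, Y, e, y, hy => by
    revert y
    refine grT_succ_le Q ((grT Q (n + 1) X Y e).comap (koszulT Q m (n + 1) X Y)) ?_
    intro Z a e' x y hx hy hd
    rw [Submodule.mem_comap, koszulT, lift_cons]
    exact cons_mem Q (koszul_mem Q m hx) (koszulT_mem m n Z Y e' y hy) hd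

lemma dT_mem : ∀ (n : ℕ) (X Y : Q.Ob) (e : ℤ), ∀ y ∈ grT Q n X Y e,
    dT Q n X Y y ∈ grT Q n X Y (e + 1)
  | 0, _, _, _, _, _ => Submodule.zero_mem _
  | n + 1, X, Y, e, y, hy => by
    revert y
    refine grT_succ_le Q ((grT Q (n + 1) X Y (e + 1)).comap (dT Q (n + 1) X Y)) ?_
    intro Z a e' x y hx hy hd
    rw [Submodule.mem_comap, dT, lift_cons, LinearMap.add_apply, LinearMap.add_apply]
    exact Submodule.add_mem _
      (cons_mem Q (Q.diff_degree (a + 1) x hx) (koszulT_mem Q 1 n Z Y e' y hy) (by omega))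
      (cons_mem Q hx (dT_mem n Z Y e' y hy) (by omega))

lemma concat_mem : ∀ (m n : ℕ) (X Y Z : Q.Ob) (a e : ℤ), ∀ x ∈ grT Q m X Y a,
    ∀ y ∈ grT Q n Y Z e, concat Q m n X Y Z x y ∈ grT Q (n + m) X Z (a + e)
  | 0, n, X, Y, Z, a, e, x, hx, y, hy => by
    by_cases ha : a = 0
    · subst ha
      rw [zero_add]
      clear hx
      have h : ∀ x : PLift (X = Y) →₀ k, x ∈ Submodule.comap
          ((concat Q 0 n X Y Z).flip y : T Q 0 X Y →ₗ[k] _) (grT Q n X Z e) := by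
        intro x
        induction x using Finsupp.induction_linear with
        | zero => exact Submodule.zero_mem _
        | add f g hf hg => exact Submodule.add_mem _ hf hg
        | single h r =>
          obtain ⟨rfl⟩ := h
          change concat Q 0 n X X Z (Finsupp.single ⟨rfl⟩ r : PLift (X = X) →₀ k) y ∈ grT Q n X Z e
          have : concat Q 0 n X X Z (Finsupp.single ⟨rfl⟩ r : PLift (X = X) →₀ k) y = r • y := by
            rw [concat]
            erw [Finsupp.lsum_single]
            simp
          rw [this]
          exact Submodule.smul_mem _ _ hy
      exact h x
    · simp only [grT, ha, if_false, Submodule.mem_bot] at hx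
      subst hx
      rw [map_zero]
      exact Submodule.zero_mem _
  | m + 1, n, X, Y, Z, a, e, x, hx, y, hy => by
    revert x
    refine grT_succ_le Q ((grT Q (n + (m + 1)) X Z (a + e)).comap
      ((concat Q (m + 1) n X Y Z).flip y)) ?_
    intro V a' e' x z hx hz hd
    rw [Submodule.mem_comap, LinearMap.flip_apply, concat, lift_cons]
    exact cons_mem Q hx (concat_mem m n V Y Z e' e z hz y hy) (by omega)

lemma b₁_gen (t : PTree) (X Y : Q.Ob) (y : T Q t.leaves X Y) :
    b₁ Q X Y (gen Q t t.leaves X Y y) =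
      ((t.size : ℤ).negOnePow : ℤ) • gen Q t t.leaves X Y (dT Q t.leaves X Y y) +
      (t.expansions.map fun c =>
        (((1 + c.1 : ℕ) : ℤ).negOnePow : ℤ) • gen Q c.2 t.leaves X Y y).sum := by
  classical
  rw [gen_self, b₁]
  erw [DirectSum.toModule_lof]
  rw [LinearMap.add_apply]
  congr 1
  induction t.expansions with
  | nil => simp
  | cons c l ih => rw [List.map_cons, List.sum_cons, List.map_cons, List.sum_cons,
      LinearMap.add_apply, ih]; rfl

lemma b₁_mem {X Y : Q.Ob} {d : ℤ} {x : Hom Q X Y} (hx : x ∈ grS Q X Y d) :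
    b₁ Q X Y x ∈ grS Q X Y (d + 1) := by
  revert x
  change grS Q X Y d ≤ (grS Q X Y (d + 1)).comap (b₁ Q X Y)
  rw [grS, Submodule.span_le]
  rintro _ ⟨t, e, y, hy, hd, rfl⟩
  change b₁ Q X Y _ ∈ grS Q X Y (d + 1)
  rw [b₁_gen]
  refine Submodule.add_mem _ (zsmul_mem (gen_mem Q t rfl _ (dT_mem Q _ _ _ _ _ hy) ?_) _)
    (list_sum_mem fun z hz => ?_)
  · omega
  · obtain ⟨c, hc, rfl⟩ := List.mem_map.1 hz
    obtain ⟨h1, h2⟩ := expansions_spec t c hc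
    exact zsmul_mem (gen_mem Q c.2 h1 _ hy (by omega)) _

/-- The part of `FHom` spanned by forests of `l` trees, in degree `d`. -/
noncomputable def grF (l : ℕ) (X Y : Q.Ob) (d : ℤ) : Submodule k (FHom Q X Y) :=
  Submodule.span k {z | ∃ (f : List PTree) (e : ℤ) (y : T Q (leavesF f) X Y),
    f.length = l ∧ y ∈ grT Q (leavesF f) X Y e ∧ e + sizeF f = d ∧ z = genF Q f X Y y}

lemma mul_gen (t : PTree) (f : List PTree) (X Y Z : Q.Ob) (x : T Q t.leaves X Y)
    (y : T Q (leavesF f) Y Z) :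
    mul Q X Y Z (gen Q t t.leaves X Y x) (genF Q f Y Z y) =
      ((t.size * sizeF f : ℤ).negOnePow : ℤ) • genF Q (t :: f) X Z
        (concat Q t.leaves (leavesF f) X Y Z x (koszulT Q t.size (leavesF f) Y Z y)) := by
  classical
  rw [gen_self, mul]
  erw [DirectSum.toModule_lof]
  rw [LinearMap.flip_apply, genF]
  erw [DirectSum.toModule_lof]
  rfl

lemma mul_mem {l : ℕ} {X Y Z : Q.Ob} {a e d : ℤ} {x : Hom Q X Y} {y : FHom Q Y Z}
    (hx : x ∈ grS Q X Y a) (hy : y ∈ grF Q l Y Z e) (hd : a + e = d) :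
    mul Q X Y Z x y ∈ grF Q (l + 1) X Z d := by
  rw [grS] at hx
  induction hx using Submodule.span_induction with
  | zero => simp
  | add x x' _ _ hx hx' => rw [map_add, LinearMap.add_apply]; exact Submodule.add_mem _ hx hx'
  | smul r x _ hx => rw [map_smul, LinearMap.smul_apply]; exact Submodule.smul_mem _ r hx
  | mem z hz =>
    obtain ⟨t, a', x, hx, ha, rfl⟩ := hz
    rw [grF] at hy
    induction hy using Submodule.span_induction with
    | zero => simp
    | add x x' _ _ hx hx' => rw [map_add]; exact Submodule.add_mem _ hx hx'
    | smul r x _ hx => rw [map_smul]; exact Submodule.smul_mem _ r hx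
    | mem z hz =>
      obtain ⟨f, e', y, hl, hy, he, rfl⟩ := hz
      rw [mul_gen]
      rw [grF]
      refine zsmul_mem (Submodule.subset_span ?_) _
      refine ⟨t :: f, a' + e', _, by simp [hl],
        concat_mem Q _ _ _ _ _ _ _ x hx _ (koszulT_mem Q _ _ _ _ _ y hy), ?_, rfl⟩
      simp only [sizeF]
      omega

lemma fold_mem : ∀ {X Y : Q.Ob} (w : Word (Hom Q) X Y) (d : ℤ),
    GrQuiver.HasDeg (quiver Q) w d → fold Q w ∈ grF Q w.length X Y d
  | _, _, .nil X, d, h => by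
    obtain rfl := GrQuiver.HasDeg.eq_zero h
    exact Submodule.subset_span ⟨[], 0, one Q X, rfl,
      by change one Q X ∈ grT Q 0 X X 0; simp [grT], rfl, rfl⟩
  | _, _, .cons x w, d, h => by
    obtain ⟨a, e, hx, hw, rfl⟩ := GrQuiver.HasDeg.exists_eq h
    exact mul_mem Q ((quiver_sgr Q _ _ _) ▸ hx) (fold_mem w e hw) rfl

lemma close_mem {l : ℕ} (hl : 2 ≤ l) {X Y : Q.Ob} {d : ℤ} {y : FHom Q X Y}
    (hy : y ∈ grF Q l X Y d) : close Q X Y y ∈ grS Q X Y (d + 1) := by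
  classical
  revert y
  change grF Q l X Y d ≤ (grS Q X Y (d + 1)).comap (close Q X Y)
  rw [grF, Submodule.span_le]
  rintro _ ⟨f, e, y, hf, hy, hd, rfl⟩
  change close Q X Y _ ∈ grS Q X Y (d + 1)
  rw [close, genF]
  erw [DirectSum.toModule_lof]
  obtain ⟨h1, h2⟩ := graft_spec f (hf ▸ hl)
  exact gen_mem Q _ h1 y hy (by omega)

lemma b_mem : ∀ {X Y : Q.Ob} (w : Word (Hom Q) X Y) (d : ℤ), (quiver Q).HasDeg w d →
    b Q X Y w ∈ grS Q X Y (d + 1)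
  | _, _, .nil _, _, _ => Submodule.zero_mem _
  | _, _, .cons x (.nil _), _, h => by
    obtain ⟨a, e, hx, hw, rfl⟩ := GrQuiver.HasDeg.exists_eq h
    obtain rfl := GrQuiver.HasDeg.eq_zero hw
    rw [quiver_sgr] at hx
    rw [add_zero]
    exact b₁_mem Q hx
  | _, _, .cons x (.cons y w), _, h =>
    close_mem Q (by simp [Word.length]) (fold_mem Q _ _ h)

lemma fold_add : ∀ {X Y Z W : Q.Ob} (p : Word (Hom Q) X Y) (x y : Hom Q Y Z)
    (q : Word (Hom Q) Z W), fold Q (p.append (.cons (x + y) q)) =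
      fold Q (p.append (.cons x q)) + fold Q (p.append (.cons y q))
  | _, _, _, _, .nil _, x, y, q => by simp [Word.append, fold]
  | _, _, _, _, .cons z p, x, y, q => by simp [Word.append, fold, fold_add p x y q]

lemma fold_smul : ∀ {X Y Z W : Q.Ob} (p : Word (Hom Q) X Y) (a : k) (x : Hom Q Y Z)
    (q : Word (Hom Q) Z W), fold Q (p.append (.cons (a • x) q)) =
      a • fold Q (p.append (.cons x q))
  | _, _, _, _, .nil _, a, x, q => by simp [Word.append, fold]
  | _, _, _, _, .cons z p, a, x, q => by simp [Word.append, fold, fold_smul p a x q]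

lemma b_multilinear : IsMultilinear k (b Q) where
  map_add p x y q := by
    cases p with
    | nil =>
      cases q with
      | nil => simp [Word.append, b]
      | cons z q => simp [Word.append, b, fold]
    | cons u p =>
      have h := fold_add Q (Word.cons u p) x y q
      cases p <;> simp only [Word.append, b] at h ⊢ <;> rw [h, map_add]
  map_smul p a x q := by
    cases p with
    | nil =>
      cases q with
      | nil => simp [Word.append, b]
      | cons z q => simp [Word.append, b, fold]
    | cons u p =>
      have h := fold_smul Q (Word.cons u p) a x q
      cases p <;> simp only [Word.append, b] at h ⊢ <;> rw [h, map_smul]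

end Free

/-- The free `A∞`-category `FQ` generated by a differential graded quiver `Q`: its graded
quiver and its operations. -/
noncomputable abbrev FQ (Q : DGQuiver k) : OpQuiver k where
  toGrQuiver := Free.quiver Q
  b := Free.b Q
  b_nil _ := rfl
  b_multilinear := Free.b_multilinear Q
  b_degree w d h := by
    rw [Free.quiver_sgr]
    exact Free.b_mem Q w d h

/-- The inclusion `sQ → sFQ` as the summand of the trivial tree. -/
noncomputable def incl (Q : DGQuiver k) (X Y : Q.Ob) : Q.Hom X Y →ₗ[k] (FQ Q).Hom X Y :=
  Free.gen Q .leaf 1 X Y ∘ₗ (Free.cons Q 0 X Y Y).flip (Free.one Q Y)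

lemma incl_mem (Q : DGQuiver k) {X Y : Q.Ob} {d : ℤ} {x : Q.Hom X Y} (hx : x ∈ Q.sgr X Y d) :
    incl Q X Y x ∈ (FQ Q).sgr X Y d := by
  change _ ∈ (Free.quiver Q).sgr X Y d
  rw [Free.quiver_sgr]
  refine Free.gen_mem Q .leaf rfl (e := d) _ (Free.cons_mem Q hx (e := 0) ?_ (add_zero d)) ?_
  · simp [Free.grT]
  · simp [PTree.size]

lemma b_incl (Q : DGQuiver k) {X Y : Q.Ob} (x : Q.Hom X Y) :
    (FQ Q).b X Y (.single (incl Q X Y x)) = incl Q X Y (Q.diff X Y x) := by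
  refine (Free.b₁_gen Q .leaf X Y (Free.cons Q 0 X Y Y x (Free.one Q Y))).trans ?_
  have h : Free.dT Q 1 X Y (Free.cons Q 0 X Y Y x (Free.one Q Y)) =
      Free.cons Q 0 X Y Y (Q.diff X Y x) (Free.one Q Y) := by
    rw [Free.dT, Free.lift_cons]
    simp [Free.dT, Free.koszulT]
  change ((0 : ℕ) : ℤ).negOnePow.val • Free.gen Q .leaf 1 X Y (Free.dT Q 1 X Y _) + 0 = _
  rw [h]
  simp [incl]

section Restriction

variable {Q : DGQuiver k} {A : OpQuiver k}

/-- The restriction of `r₁`, for a multilinear function `r` on words, to `sQ ⊂ sFQ`. -/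
noncomputable def restrLin {N : Q.Ob → Q.Ob → Type u} [∀ X Y, AddCommGroup (N X Y)]
    [∀ X Y, Module k (N X Y)]
    (r : ∀ X Y : Q.Ob, Word (FQ Q).Hom X Y → N X Y)
    (hr : IsMultilinear k (H := (FQ Q).Hom) (N := N) r) (X Y : Q.Ob) : Q.Hom X Y →ₗ[k] N X Y where
  toFun x := r X Y (.single (incl Q X Y x))
  map_add' x y := by
    rw [map_add]
    exact hr.map_add (.nil X) _ _ (.nil Y)
  map_smul' a x := by
    rw [map_smul]
    exact hr.map_smul (.nil X) a _ (.nil Y)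

/-- The restriction of an `A∞`-functor `φ : FQ → A` to an `A₁`-functor `Q → A`. -/
noncomputable def AInfFunctor.restr (φ : AInfFunctor (FQ Q) A) : A₁Functor Q A where
  obj := φ.obj
  f₁ := restrLin (N := fun X Y => A.Hom (φ.obj X) (φ.obj Y)) φ.f φ.f_multilinear
  f₁_degree {X Y} d x hx := by
    have h := φ.f_degree (.single (incl Q X Y x)) (d + 0) (.cons (incl_mem Q hx) (.nil _))
    rwa [add_zero] at h
  comm {X Y} x := by
    have h := φ.comm (Word.single (incl Q X Y x))
    have h0 : ∀ v : Word (FQ Q).Hom X Y, φ.f X Y (.cons (0 : (FQ Q).Hom X X) v) = 0 := fun v => by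
      have := φ.f_multilinear.map_smul (.nil X) (0 : k) (0 : (FQ Q).Hom X X) v
      simpa [Word.append] using this
    have h1 : ∀ v : (FQ Q).Hom X Y, φ.f X Y (.cons v (.cons (0 : (FQ Q).Hom Y Y) (.nil Y))) = 0 :=
      fun v => by
        have := φ.f_multilinear.map_smul (.single v) (0 : k) (0 : (FQ Q).Hom Y Y) (.nil Y)
        simpa [Word.append, Word.single] using this
    have h2 := b_incl Q x
    have hn : ∀ X : Q.Ob, Free.b Q X X (.nil X) = 0 := fun _ => rfl
    simp only [innerSum, Word.single, Word.blocks, Word.cuts₃, Word.cuts, Word.append, Word.map,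
      List.flatMap_cons, List.flatMap_nil, List.map_cons, List.map_nil, List.sum_cons, List.sum_nil,
      List.append_nil, List.nil_append, List.cons_append, GrQuiver.koszulW, Word.mapHom] at h h2
    rw [hn X, hn Y, h0, h1, h2] at h
    simpa [restrLin, Word.single] using h

/-- The restriction `r ↦ (r₀, r₁|_{sQ})` of transformations,
`sA∞(FQ,A)(φ,ψ) → sA₁(FQ,A)(φ,ψ) → sA₁(Q,A)(φ,ψ)`. -/
noncomputable def restrTrans (φ ψ : AInfFunctor (FQ Q) A) (d : ℤ) :
    Trans φ ψ d →ₗ[k] A₁Trans φ.restr ψ.restr d where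
  toFun r := ⟨(fun X => r.1 X X (.nil X),
      restrLin (N := fun X Y => A.Hom (φ.obj X) (ψ.obj Y)) r.1 r.2.1),
    fun X => by
      have h := r.2.2 X X (.nil X) 0 (GrQuiver.HasDeg.nil (A := (FQ Q).toGrQuiver) X)
      rwa [zero_add] at h,
    fun X Y e x hx => by
      have h := r.2.2 X Y (.single (incl Q X Y x)) (e + 0) (.cons (incl_mem Q hx) (.nil _))
      rwa [add_zero] at h⟩
  map_add' _ _ := rfl
  map_smul' _ _ := rfl

end Restriction

/-! ## Chain maps into complexes of transformations -/

section ChainMaps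

variable {Q : DGQuiver k} {A : OpQuiver k} (φ ψ : AInfFunctor (FQ Q) A)
  (P : CochainComplex (ModuleCat.{u} k) ℤ)

/-- Linear maps of degree `0` from (the graded module underlying) `P` to a graded module `C`. -/
abbrev GMap (C : ℤ → Type u) [∀ d, AddCommGroup (C d)] [∀ d, Module k (C d)] : Type u :=
  ∀ d, P.X d →ₗ[k] C d

/-- `u : P → sA∞(FQ,A)(φ,ψ)` is a chain map: `(pd)u = (pu)B₁`. -/
def IsChainMap (u : GMap P fun d => Trans φ ψ d) : Prop :=
  ∀ (d : ℤ) (p : P.X d), (u (d + 1) ((P.d d (d + 1)).hom p)).1 = B₁ φ ψ d (u d p).1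

variable {P} in
/-- `u' : P → sA₁(Q,A)(f,g)` is a chain map: `(pd)u' = (pu')B₁`. -/
def IsChainMap₁ {f g : A₁Functor Q A} (u' : GMap P fun d => A₁Trans f g d) : Prop :=
  ∀ (d : ℤ) (p : P.X d),
    (∀ X, (u' (d + 1) ((P.d d (d + 1)).hom p)).1.1 X = A₁B₁_zero f g (u' d p).1 X) ∧
    (∀ X Y x, (u' (d + 1) ((P.d d (d + 1)).hom p)).1.2 X Y x = A₁B₁_one f g d (u' d p).1 X Y x)

/-- The data `(u', uₙ)_{n > 1}`: degree `0` maps `u' : P → sA₁(Q,A)(φ,ψ)` and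
`uₙ : P → ∏_{X,Y} C((sFQ)^{⊗n}(X,Y), sA(Xφ,Yψ))`. -/
abbrev RestrData : Type u :=
  (GMap P fun d => A₁Trans φ.restr ψ.restr d) ×
    (∀ n : {n : ℕ // 1 < n}, GMap P fun d => Comp φ ψ n d)

/-- The assignment `u ↦ (u · restr, u · prₙ)_{n > 1}`. -/
noncomputable def restrData (u : GMap P fun d => Trans φ ψ d) : RestrData φ ψ P :=
  (fun d => restrTrans φ ψ d ∘ₗ u d, fun n d => pr φ ψ n d ∘ₗ u d)

/-- The recurrent formula
`(-)^p b_n^{FQ} (pu₁) = -(pd)uₙ + ∑ (φ_{aα} ⊗ pu_q ⊗ ψ_{cβ}) b^A_{α+1+β}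
  - (-)^p ∑_{α+β>0} (1^{⊗α} ⊗ b_q^{FQ} ⊗ 1^{⊗β}) (pu_{α+1+β}) : (sFQ)^{⊗n} → sA` for all `n > 1`. -/
def Recurrence (u : GMap P fun d => Trans φ ψ d) : Prop :=
  ∀ (d : ℤ) (p : P.X d) (X Y : Q.Ob) (w : Word (FQ Q).Hom X Y), 1 < w.length →
    (d.negOnePow : ℤ) • (u d p).1 X Y (.single ((FQ Q).b X Y w)) =
      -(u (d + 1) ((P.d d (d + 1)).hom p)).1 X Y w + sandwich φ ψ d (u d p).1 w
        - (d.negOnePow : ℤ) •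
          innerSumPos (FQ Q) (N := fun X Y => A.Hom (φ.obj X) (ψ.obj Y)) (u d p).1 w

end ChainMaps

end AInf

-- Split the chain map equation (pd)u = (pu)B₁ into its components on words of length k. For k = 0,
-- and for k = 1 on letters from sQ, it says that u' is a chain map (`B₁_nil`, `B₁_single_incl`).
-- For k > 1 exactly one term of the inner sum has no outer letters, namely b_k followed by pu₁;
-- solving for this term gives the recurrent formula (`recurrence_iff`). It remains to see that the
-- recurrent formula has exactly one solution for arbitrary data, and that the k = 1 equation, known
-- on sQ, then holds on all of sFQ.
--
-- Solving the recurrence. Every nontrivial tree is in a unique way a grafting of at least two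
-- trees. Hence a linear map on sFQ(X,Y) can be prescribed by its restriction to sQ(X,Y) together
-- with a multilinear function that gives its composites with all b_k, k > 1 (`homLift_incl`,
-- `homLift_b`), and a family of submodules that contains sQ and is closed under these b_k is
-- everything (`Free.hom_induction`). At a word w the right hand side of the recurrent formula reads
-- pu₁ only on the letters of w (`sandwich_innerSumPos_congr`); all else, including (pd)u_k, is
-- given. So this is a recursion along trees. As letters are arbitrary sums of tree tensors, the
-- recursion is run as a sequence of approximations of pu₁ that becomes stationary at each element
-- (`exists_recurrence`). Uniqueness (`eq_of_recurrence`) makes the solution linear in p.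
--
-- The equation for k = 1. Let Δ = (pd)u - (pu)B₁ for a solution u. Its components of length
-- different from 1 vanish, and so does Δ₁ on sQ. Because B₁B₁ = 0 and d² = 0, the recurrent formula
-- for pd shows that ΔB₁ vanishes on words of length > 1. With only Δ₁ present, this reads: b_k
-- followed by Δ₁ is, up to sign, a sum of terms that apply Δ₁ to letters of w. Thus the kernel of
-- Δ₁ contains sQ and is closed under b_k, k > 1, and Δ₁ = 0 (`Recurrence.isChainMap`).
--
-- The identity B₁B₁ = 0 (`B₁_B₁`) needs b·b = 0 in FQ, which has to be proved. On words of length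
-- at least 2 it is a comparison of signs: b₁ of a grafted forest adds an edge either inside one of
-- the trees or at the root, and these are the insertions of b₁ and of b_j, j ≥ 2, into the word
-- (`b₁_close`, `ins_b_b_of_two_le`). On single letters it follows by generation (`Free.ins_b_b`).
--
-- Throughout, elements of the tensor coalgebra are not formed. A map into it is represented by how
-- a functional ρ on words is evaluated on its output: `sumCuts` is deconcatenation, `hat` the
-- coalgebra map of a functor, `ins` the coderivation of an operation, `cod` the coderivation of a
-- transformation.

namespace AInf

variable {k : Type u} [CommRing k]

/-! ## Sums over decompositions of words -/

namespace Word

variable {O O' : Type u} {H : O → O → Type u} {H' : O' → O' → Type u}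
variable {M M' : Type*} [AddCommGroup M] [AddCommGroup M']

@[simp] lemma nil_append {X Z : O} (v : Word H X Z) : (nil X).append v = v := rfl

@[simp] lemma cons_append {X Y Z W : O} (x : H X Y) (u : Word H Y Z) (v : Word H Z W) :
    (cons x u).append v = cons x (u.append v) := rfl

lemma append_assoc : ∀ {X Y Z W : O} (u : Word H X Y) (v : Word H Y Z) (w : Word H Z W),
    (u.append v).append w = u.append (v.append w)
  | _, _, _, _, nil _, _, _ => rfl
  | _, _, _, _, cons x u, v, w => by simp only [cons_append, append_assoc u v w]

@[simp] lemma length_nil (X : O) : (nil X : Word H X X).length = 0 := rfl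

@[simp] lemma length_cons {X Y Z : O} (x : H X Y) (w : Word H Y Z) :
    (cons x w).length = w.length + 1 := rfl

@[simp] lemma length_append : ∀ {X Y Z : O} (u : Word H X Y) (v : Word H Y Z),
    (u.append v).length = u.length + v.length
  | _, _, _, nil _, v => by simp
  | _, _, _, cons x u, v => by simp only [cons_append, length_cons, length_append u v]; omega

lemma mapHom_append {H₂ : O → O → Type u} (f : ∀ X Y, H X Y → H₂ X Y) :
    ∀ {X Y Z : O} (u : Word H X Y) (v : Word H Y Z),
      (u.append v).mapHom f = (u.mapHom f).append (v.mapHom f)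
  | _, _, _, nil _, _ => rfl
  | _, _, _, cons x u, v => by simp only [cons_append, mapHom, mapHom_append f u v]

@[simp] lemma length_mapHom {H₂ : O → O → Type u} (f : ∀ X Y, H X Y → H₂ X Y) :
    ∀ {X Y : O} (u : Word H X Y), (u.mapHom f).length = u.length
  | _, _, nil _ => rfl
  | _, _, cons x u => by simp only [mapHom, length_cons, length_mapHom f u]

/-- The sum of `F u v` over all decompositions `w = u · v`. -/
def sumCuts : {X Z : O} → Word H X Z → (∀ Y, Word H X Y → Word H Y Z → M) → M
  | _, _, nil X, F => F X (nil X) (nil X)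
  | _, _, cons x w, F => F _ (nil _) (cons x w) + sumCuts w fun Y l r => F Y (cons x l) r

@[simp] lemma sumCuts_nil {X : O} (F : ∀ Y, Word H X Y → Word H Y X → M) :
    sumCuts (nil X) F = F X (nil X) (nil X) := rfl

lemma sumCuts_cons {X Y Z : O} (x : H X Y) (w : Word H Y Z)
    (F : ∀ V, Word H X V → Word H V Z → M) :
    sumCuts (cons x w) F = F _ (nil _) (cons x w) + sumCuts w fun V l r => F V (cons x l) r := rfl

lemma sum_map_cuts : ∀ {X Z : O} (w : Word H X Z) (F : ∀ Y, Word H X Y → Word H Y Z → M),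
    (w.cuts.map fun c => F c.mid c.left c.right).sum = w.sumCuts F
  | _, _, nil X, F => by simp [cuts]
  | _, _, cons x w, F => by
    rw [cuts, sumCuts_cons, List.map_cons, List.sum_cons, List.map_map,
      ← sum_map_cuts w fun V l r => F V (cons x l) r]
    rfl

/-- Passage from the lists in the definitions to nested deconcatenations, on which coassociativity
can be used. -/
lemma sum_map_cuts₃ {X W : O} (w : Word H X W)
    (F : ∀ Y Z, Word H X Y → Word H Y Z → Word H Z W → M) :
    (w.cuts₃.map fun c => F c.src c.tgt c.left c.mid c.right).sum =
      w.sumCuts fun Y l s => s.sumCuts fun Z m r => F Y Z l m r := by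
  rw [← sum_map_cuts, cuts₃]
  simp only [← sum_map_cuts]
  induction w.cuts with
  | nil => rfl
  | cons c L ih =>
    rw [List.flatMap_cons, List.map_append, List.sum_append, ih, List.map_map, List.map_cons,
      List.sum_cons]
    rfl

lemma sumCuts_congr : ∀ {X Z : O} (w : Word H X Z) {F G : ∀ Y, Word H X Y → Word H Y Z → M},
    (∀ Y (l : Word H X Y) (r : Word H Y Z), l.append r = w → F Y l r = G Y l r) →
      w.sumCuts F = w.sumCuts G
  | _, _, nil X, F, G, h => h _ _ _ rfl
  | _, _, cons x w, F, G, h => by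
    rw [sumCuts_cons, sumCuts_cons, h _ (nil _) _ rfl]
    congr 1
    exact sumCuts_congr w fun Y l r hlr => h _ _ _ (by rw [cons_append, hlr])

lemma sumCuts_congr' {X Z : O} (w : Word H X Z) {F G : ∀ Y, Word H X Y → Word H Y Z → M}
    (h : ∀ Y (l : Word H X Y) (r : Word H Y Z), F Y l r = G Y l r) :
    w.sumCuts F = w.sumCuts G :=
  sumCuts_congr w fun Y l r _ => h Y l r

lemma sumCuts_add : ∀ {X Z : O} (w : Word H X Z) (F G : ∀ Y, Word H X Y → Word H Y Z → M),
    (w.sumCuts fun Y l r => F Y l r + G Y l r) = w.sumCuts F + w.sumCuts G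
  | _, _, nil X, F, G => rfl
  | _, _, cons x w, F, G => by
    rw [sumCuts_cons, sumCuts_cons, sumCuts_cons, sumCuts_add w]
    abel

lemma map_sumCuts (φ : M →+ M') : ∀ {X Z : O} (w : Word H X Z)
    (F : ∀ Y, Word H X Y → Word H Y Z → M),
    φ (w.sumCuts F) = w.sumCuts fun Y l r => φ (F Y l r)
  | _, _, nil X, F => rfl
  | _, _, cons x w, F => by rw [sumCuts_cons, sumCuts_cons, map_add, map_sumCuts φ w]

lemma sumCuts_zero {X Z : O} (w : Word H X Z) : (w.sumCuts fun _ _ _ => (0 : M)) = 0 := by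
  have := map_sumCuts (0 : M →+ M) w fun _ _ _ => 0
  simpa using this.symm

lemma sumCuts_neg {X Z : O} (w : Word H X Z) (F : ∀ Y, Word H X Y → Word H Y Z → M) :
    (w.sumCuts fun Y l r => -F Y l r) = -w.sumCuts F :=
  (map_sumCuts (negAddMonoidHom : M →+ M) w F).symm

lemma sumCuts_zsmul {X Z : O} (n : ℤ) (w : Word H X Z) (F : ∀ Y, Word H X Y → Word H Y Z → M) :
    (w.sumCuts fun Y l r => n • F Y l r) = n • w.sumCuts F :=
  (map_sumCuts (DistribSMul.toAddMonoidHom M n) w F).symm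

/-- Coassociativity of deconcatenation. -/
lemma sumCuts_assoc : ∀ {X W : O} (w : Word H X W)
    (F : ∀ Y Z, Word H X Y → Word H Y Z → Word H Z W → M),
    (w.sumCuts fun Z l r => l.sumCuts fun Y a b => F Y Z a b r) =
      w.sumCuts fun Y a s => s.sumCuts fun Z b r => F Y Z a b r
  | _, _, nil X, F => rfl
  | _, _, cons x w, F => by
    rw [sumCuts_cons, sumCuts_cons, sumCuts_nil]
    simp only [sumCuts_cons]
    rw [sumCuts_add, sumCuts_assoc w fun Y Z a b r => F Y Z (cons x a) b r]
    abel

lemma sumCuts_mapHom {H₂ : O → O → Type u} (f : ∀ X Y, H X Y → H₂ X Y) :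
    ∀ {X Z : O} (w : Word H X Z) (F : ∀ Y, Word H₂ X Y → Word H₂ Y Z → M),
    (w.mapHom f).sumCuts F = w.sumCuts fun Y l r => F Y (l.mapHom f) (r.mapHom f)
  | _, _, nil X, F => rfl
  | _, _, cons x w, F => by
    rw [mapHom, sumCuts_cons, sumCuts_cons, sumCuts_mapHom f w]
    rfl

/-- A cut of l·y·q lies either before the letter y, hence inside l, or after it, hence inside q. -/
lemma sumCuts_append_cons : ∀ {X Y Y' Z : O} (l : Word H X Y) (y : H Y Y') (q : Word H Y' Z)
    (F : ∀ V, Word H X V → Word H V Z → M),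
    (l.append (cons y q)).sumCuts F =
      (l.sumCuts fun V l₁ l₂ => F V l₁ (l₂.append (cons y q))) +
        q.sumCuts fun V q₁ q₂ => F V (l.append (cons y q₁)) q₂
  | _, _, _, _, nil _, y, q, F => rfl
  | _, _, _, _, cons x l, y, q, F => by
    rw [cons_append, sumCuts_cons, sumCuts_cons, sumCuts_append_cons l y q, add_assoc]
    rfl

/-! ### Multiplicative extension of a functor to words -/

/-- `hat f w ρ` is the sum of `ρ (f β₁ ⋯ f βₙ)` over all decompositions of `w` into nonempty
blocks `β₁, …, βₙ`. -/
def hat {F : O → O'} (f : ∀ X Y, Word H X Y → H' (F X) (F Y)) {X Z : O} (w : Word H X Z)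
    (ρ : Word H' (F X) (F Z) → M) : M :=
  (w.blocks.map fun β => ρ (β.map F f)).sum

variable {F : O → O'} (f : ∀ X Y, Word H X Y → H' (F X) (F Y))

@[simp] lemma hat_nil {X : O} (ρ : Word H' (F X) (F X) → M) : hat f (nil X) ρ = ρ (nil (F X)) := by
  simp [hat, blocks, map]

/-- Put a letter in front of the first block and evaluate; `0` if there are no blocks. -/
def evalGlue {X Z : O} : {Y : O} → H X Y → (Word (Word H) X Z → M) → Word (Word H) Y Z → M
  | _, _, _, nil _ => 0
  | _, x, G, cons q β => G (cons (cons x q) β)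

/-- The first block consists of x and a prefix l of w; the other blocks decompose the complementary
suffix. In the recursion, `evalGlue x G` accounts for the decompositions in which x shares its block
with the next letter. -/
lemma sum_map_blocks_cons : ∀ {X Y Z : O} (x : H X Y) (w : Word H Y Z)
    (G : Word (Word H) X Z → M),
    ((cons x w).blocks.map G).sum =
      w.sumCuts fun _ l r => (r.blocks.map fun β => G (cons (cons x l) β)).sum
  | _, _, _, x, nil _, G => by simp [blocks, single]
  | X, _, Z, x, cons (Y := Y') y w, G => by
    rw [sumCuts_cons]
    refine Eq.trans (b := ((cons y w).blocks.map fun β => G (cons (single x) β)).sum +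
      ((cons y w).blocks.map (evalGlue x G)).sum) ?_ ?_
    · rw [blocks]
      induction (cons y w).blocks with
      | nil => simp
      | cons β L ih =>
        rw [List.flatMap_cons, List.map_append, List.sum_append, ih, List.map_cons, List.map_cons,
          List.sum_cons, List.map_cons, List.sum_cons, List.sum_cons]
        cases β <;> simp [evalGlue] <;> abel
    · rw [sum_map_blocks_cons y w (evalGlue x G)]
      rfl

lemma hat_cons {X Y Z : O} (x : H X Y) (w : Word H Y Z) (ρ : Word H' (F X) (F Z) → M) :
    hat f (cons x w) ρ =
      w.sumCuts fun _ l r => hat f r fun z => ρ (cons (f _ _ (cons x l)) z) := by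
  rw [hat, sum_map_blocks_cons]
  rfl

lemma hat_congr {X Z : O} (w : Word H X Z) {ρ ρ' : Word H' (F X) (F Z) → M}
    (h : ∀ z, ρ z = ρ' z) : hat f w ρ = hat f w ρ' := by
  rw [funext h]

lemma hat_add {X Z : O} (w : Word H X Z) (ρ ρ' : Word H' (F X) (F Z) → M) :
    (hat f w fun z => ρ z + ρ' z) = hat f w ρ + hat f w ρ' := by
  simp only [hat, List.sum_map_add]

lemma map_hat (φ : M →+ M') {X Z : O} (w : Word H X Z) (ρ : Word H' (F X) (F Z) → M) :
    φ (hat f w ρ) = hat f w fun z => φ (ρ z) := by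
  rw [hat, hat, map_list_sum, List.map_map]
  rfl

lemma hat_zero {X Z : O} (w : Word H X Z) : (hat f w fun _ => (0 : M)) = 0 := by
  simp [hat]

lemma hat_zsmul {X Z : O} (n : ℤ) (w : Word H X Z) (ρ : Word H' (F X) (F Z) → M) :
    (hat f w fun z => n • ρ z) = n • hat f w ρ :=
  (map_hat f (DistribSMul.toAddMonoidHom M n) w ρ).symm

/-- `hat` commutes with finite sums over decompositions of another word. -/
lemma hat_sumCuts {O₂ : Type u} {H₂ : O₂ → O₂ → Type u} {X Z : O} (w : Word H X Z)
    {V V' : O₂} (v : Word H₂ V V')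
    (G : ∀ Y, Word H₂ V Y → Word H₂ Y V' → Word H' (F X) (F Z) → M) :
    (hat f w fun z => v.sumCuts fun Y l r => G Y l r z) =
      v.sumCuts fun Y l r => hat f w (G Y l r) := by
  let φ : (Word H' (F X) (F Z) → M) →+ M :=
    { toFun := hat f w, map_zero' := hat_zero f w, map_add' := hat_add f w }
  refine Eq.trans ?_ (map_sumCuts φ v G)
  refine hat_congr f w fun z => ?_
  exact (map_sumCuts (Pi.evalAddMonoidHom (fun _ => M) z) v G).symm

/-- The extension of a functor to words is compatible with deconcatenation. -/
lemma hat_conv : ∀ (n : ℕ) {X Z : O} (w : Word H X Z) (_ : w.length ≤ n)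
    (G : ∀ V, Word H' (F X) V → Word H' V (F Z) → M),
    (hat f w fun z => z.sumCuts G) =
      w.sumCuts fun Y l r => hat f l fun z₁ => hat f r fun z₂ => G (F Y) z₁ z₂
  | _, _, _, nil X, _, G => by simp
  | 0, _, _, cons x w, h, G => absurd h (by simp)
  | n + 1, _, _, cons x w, h, G => by
    -- A cut of the image word is either in front of its first letter or in the part coming from the
    -- remaining blocks. The recursive call is made at a suffix r of w, which is not a structural
    -- subterm; hence the bound n on the length.
    have h1 : (hat f (cons x w) fun z => z.sumCuts G) =
        (w.sumCuts fun Y l r => hat f r fun z => G _ (nil _) (cons (f _ _ (cons x l)) z)) +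
        w.sumCuts fun Y l s => s.sumCuts fun _ r₁ r₂ => hat f r₁ fun z₁ => hat f r₂ fun z₂ =>
          G _ (cons (f _ _ (cons x l)) z₁) z₂ := by
      rw [hat_cons, ← sumCuts_add]
      refine sumCuts_congr w fun Y l r hlr => ?_
      have hr : r.length ≤ n := by
        have := congrArg length hlr
        simp only [length_append, length_cons] at this h
        omega
      rw [← hat_conv n r hr fun V z₁ z₂ => G V (cons (f _ _ (cons x l)) z₁) z₂, ← hat_add]
      rfl
    rw [h1, sumCuts_cons, hat_nil, hat_cons, ← sumCuts_assoc]
    congr 1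
    refine sumCuts_congr' w fun Y s r => ?_
    rw [hat_cons]

end Word

/-! ## Multilinear functions with fixed end points -/

section MLin

variable {O O' : Type u} {H : O → O → Type u} {H' : O' → O' → Type u}
variable [∀ X Y, AddCommGroup (H X Y)] [∀ X Y, Module k (H X Y)]
variable [∀ X Y, AddCommGroup (H' X Y)] [∀ X Y, Module k (H' X Y)]
variable {M M' : Type*} [AddCommGroup M] [Module k M] [AddCommGroup M'] [Module k M']

variable (k) in
/-- Multilinearity of a function on the words between two fixed objects. -/
structure MLin {X W : O} (ρ : Word H X W → M) : Prop where
  isLinear : ∀ {Y Z : O} (p : Word H X Y) (q : Word H Z W),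
    IsLinearMap k fun x : H Y Z => ρ (p.append (.cons x q))

lemma IsMultilinear.mlin {N : O → O → Type u} [∀ X Y, AddCommGroup (N X Y)]
    [∀ X Y, Module k (N X Y)] {r : ∀ X Y, Word H X Y → N X Y} (hr : IsMultilinear k r) (X W : O) :
    MLin k (r X W) :=
  ⟨fun p q => ⟨fun x y => hr.map_add p x y q, fun a x => hr.map_smul p a x q⟩⟩

lemma isMultilinear_of_mlin {N : O → O → Type u} [∀ X Y, AddCommGroup (N X Y)]
    [∀ X Y, Module k (N X Y)] {r : ∀ X Y, Word H X Y → N X Y} (h : ∀ X W, MLin k (r X W)) :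
    IsMultilinear k r :=
  ⟨fun p x y q => ((h _ _).isLinear p q).map_add x y, fun p a x q => ((h _ _).isLinear p q).map_smul a x⟩

lemma _root_.IsLinearMap.map_zsmul' {V : Type*} [AddCommGroup V] [Module k V] {f : V → M}
    (hf : IsLinearMap k f) (n : ℤ) (x : V) : f (n • x) = n • f x :=
  _root_.map_zsmul (IsLinearMap.mk' f hf) n x

lemma isLinearMap_add {V : Type*} [AddCommGroup V] [Module k V] {f g : V → M}
    (hf : IsLinearMap k f) (hg : IsLinearMap k g) : IsLinearMap k fun x => f x + g x :=
  (IsLinearMap.mk' f hf + IsLinearMap.mk' g hg).isLinear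

lemma isLinearMap_zsmul {V : Type*} [AddCommGroup V] [Module k V] {f : V → M}
    (hf : IsLinearMap k f) (n : ℤ) : IsLinearMap k fun x => n • f x :=
  (n • IsLinearMap.mk' f hf).isLinear

lemma isLinearMap_comp {V V' : Type*} [AddCommGroup V] [Module k V] [AddCommGroup V'] [Module k V']
    {f : V' → M} {g : V → V'} (hf : IsLinearMap k f) (hg : IsLinearMap k g) :
    IsLinearMap k fun x => f (g x) :=
  (IsLinearMap.mk' f hf ∘ₗ IsLinearMap.mk' g hg).isLinear

lemma isLinearMap_list_sum {V ι : Type*} [AddCommGroup V] [Module k V] (L : List ι)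
    {f : ι → V → M} (hf : ∀ i, IsLinearMap k (f i)) :
    IsLinearMap k fun x => (L.map fun i => f i x).sum := by
  induction L with
  | nil => exact (0 : V →ₗ[k] M).isLinear
  | cons i L ih =>
    simp only [List.map_cons, List.sum_cons]
    exact isLinearMap_add (hf i) ih

lemma isLinearMap_sumCuts {V : Type*} [AddCommGroup V] [Module k V]
    {O : Type u} {H : O → O → Type u} {X Z : O} (w : Word H X Z)
    {F : V → ∀ Y, Word H X Y → Word H Y Z → M}
    (hF : ∀ Y l r, IsLinearMap k fun x => F x Y l r) :
    IsLinearMap k fun x => w.sumCuts (F x) := by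
  simp only [← Word.sum_map_cuts]
  exact isLinearMap_list_sum _ fun c => hF _ _ _

lemma isLinearMap_hat {V : Type*} [AddCommGroup V] [Module k V]
    {O O' : Type u} {H : O → O → Type u} {H' : O' → O' → Type u} {F : O → O'}
    (f : ∀ X Y, Word H X Y → H' (F X) (F Y)) {X Z : O} (w : Word H X Z)
    {ρ : V → Word H' (F X) (F Z) → M} (hρ : ∀ z, IsLinearMap k fun x => ρ x z) :
    IsLinearMap k fun x => Word.hat f w (ρ x) :=
  isLinearMap_list_sum _ fun _ => hρ _

namespace MLin

variable {X Y Z W : O}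

lemma add {ρ ρ' : Word H X W → M} (h : MLin k ρ) (h' : MLin k ρ') :
    MLin k fun w => ρ w + ρ' w := ⟨fun p q => isLinearMap_add (h.isLinear p q) (h'.isLinear p q)⟩

lemma zsmul {ρ : Word H X W → M} (h : MLin k ρ) (n : ℤ) :
    MLin k fun w => n • ρ w := ⟨fun p q => isLinearMap_zsmul (h.isLinear p q) n⟩

lemma zero : MLin k fun _ : Word H X W => (0 : M) := ⟨fun _ _ => (0 : _ →ₗ[k] M).isLinear⟩

lemma neg {ρ : Word H X W → M} (h : MLin k ρ) : MLin k fun w => -ρ w := by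
  simpa using h.zsmul (-1)

lemma sub {ρ ρ' : Word H X W → M} (h : MLin k ρ) (h' : MLin k ρ') :
    MLin k fun w => ρ w - ρ' w := by
  simpa only [sub_eq_add_neg] using h.add h'.neg

lemma comp {ρ : Word H X W → M} (h : MLin k ρ) {φ : M → M'} (hφ : IsLinearMap k φ) :
    MLin k fun w => φ (ρ w) := ⟨fun p q => isLinearMap_comp hφ (h.isLinear p q)⟩

lemma cons_left {ρ : Word H X W → M} (h : MLin k ρ) (x : H X Y) :
    MLin k fun w => ρ (.cons x w) := ⟨fun p q => h.isLinear (.cons x p) q⟩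

lemma append_left {ρ : Word H X W → M} (h : MLin k ρ) (v : Word H X Y) :
    MLin k fun w => ρ (v.append w) := ⟨fun p q => by
  simpa only [Word.append_assoc] using h.isLinear (v.append p) q⟩

lemma append_right {ρ : Word H X W → M} (h : MLin k ρ) (v : Word H Y W) :
    MLin k fun w => ρ (w.append v) := ⟨fun p q => by
  simpa only [Word.append_assoc, Word.cons_append] using h.isLinear p (q.append v)⟩

lemma head {ρ : Word H X W → M} (h : MLin k ρ) (w : Word H Y W) :
    IsLinearMap k fun x : H X Y => ρ (.cons x w) := h.isLinear (.nil X) w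

lemma mapHom {H₂ : O → O → Type u} [∀ X Y, AddCommGroup (H₂ X Y)] [∀ X Y, Module k (H₂ X Y)]
    (f : ∀ X Y, H X Y →ₗ[k] H₂ X Y) {ρ : Word H₂ X W → M} (h : MLin k ρ) :
    MLin k fun w => ρ (w.mapHom fun X Y => f X Y) := ⟨fun p q => by
  simp only [Word.mapHom_append, Word.mapHom]
  exact isLinearMap_comp
    (f := fun y => ρ ((p.mapHom fun X Y => f X Y).append (.cons y (q.mapHom fun X Y => f X Y))))
    (h.isLinear _ _) (f _ _).isLinear⟩

lemma sumCuts {F : ∀ Y, Word H X Y → Word H Y W → M} (h₁ : ∀ Y r, MLin k fun l => F Y l r)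
    (h₂ : ∀ Y l, MLin k (F Y l)) : MLin k fun w => w.sumCuts F := ⟨fun p q => by
  simp only [Word.sumCuts_append_cons]
  exact isLinearMap_add (isLinearMap_sumCuts _ fun V l₁ l₂ => (h₂ V l₁).isLinear l₂ q)
    (isLinearMap_sumCuts _ fun V q₁ q₂ => (h₁ V q₂).isLinear p q₁)⟩

/-- Induction on the length of the prefix in front of the varying letter. If this letter belongs to
the first block, linearity comes from f and ρ; otherwise the first block is cut off the prefix,
which becomes shorter. -/
lemma hat {F : O → O'} {f : ∀ X Y, Word H X Y → H' (F X) (F Y)} (hf : ∀ X Y, MLin k (f X Y))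
    {ρ : Word H' (F X) (F W) → M} (hρ : MLin k ρ) : MLin k fun w => Word.hat f w ρ := by
  have key : ∀ (n : ℕ) {X Y Z : O} (p : Word H X Y) (q : Word H Z W), p.length ≤ n →
      ∀ {ρ : Word H' (F X) (F W) → M}, MLin k ρ →
      IsLinearMap k fun x : H Y Z => Word.hat f (p.append (.cons x q)) ρ := by
    intro n
    induction n with
    | zero =>
      intro X Y Z p q hp ρ hρ
      cases p with
      | cons x p => simp at hp
      | nil =>
        simp only [Word.nil_append, Word.hat_cons]
        exact isLinearMap_sumCuts _ fun V l r => isLinearMap_hat _ _ fun z =>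
          isLinearMap_comp (f := fun y => ρ (.cons y z)) (hρ.head z) ((hf _ _).head l)
    | succ n ih =>
      intro X Y Z p q hp ρ hρ
      cases p with
      | nil => exact ih (.nil _) q (by simp) hρ
      | cons x₀ p =>
        simp only [Word.cons_append, Word.hat_cons, Word.sumCuts_append_cons]
        refine isLinearMap_add ?_ (isLinearMap_sumCuts _ fun V l r => isLinearMap_hat _ _ fun z =>
          isLinearMap_comp (f := fun y => ρ (.cons y z)) (hρ.head z)
            ((hf _ _).isLinear (.cons x₀ p) l))
        simp only [← Word.sum_map_cuts]
        have hlen : ∀ c ∈ p.cuts, c.right.length ≤ n := by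
          have : ∀ {X Y : O} (p : Word H X Y), ∀ c ∈ p.cuts, c.right.length ≤ p.length := by
            intro X Y p
            induction p with
            | nil => simp [Word.cuts]
            | cons x p ih =>
              intro c hc
              simp only [Word.cuts, List.mem_cons, List.mem_map] at hc
              rcases hc with rfl | ⟨c', hc', rfl⟩
              · simp
              · have := ih c' hc'
                simp only [Word.length_cons]
                omega
          intro c hc
          have := this p c hc
          simp at hp
          omega
        revert hlen
        induction p.cuts with
        | nil => exact fun _ => (0 : H Y Z →ₗ[k] M).isLinear
        | cons c L ihL =>
          intro hlen
          simp only [List.map_cons, List.sum_cons]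
          exact isLinearMap_add (ih c.right q (hlen c (by simp)) (hρ.cons_left _))
            (ihL fun c' hc' => hlen c' (by simp [hc']))
  exact ⟨fun p q => key _ p q le_rfl hρ⟩

end MLin

end MLin

/-! ## Koszul operators -/

namespace GrQuiver

variable (A : GrQuiver k) {M : Type*} [AddCommGroup M] [Module k M]

lemma hom_induction {X Y : A.Ob} (S : Submodule k (A.Hom X Y))
    (h : ∀ d, ∀ x ∈ A.sgr X Y d, x ∈ S) (x : A.Hom X Y) : x ∈ S := by
  have hx : x ∈ ⨆ d, A.sgr X Y d := by
    rw [(A.sgr_internal X Y).submodule_iSup_eq_top]; trivial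
  exact (iSup_le h : ⨆ d, A.sgr X Y d ≤ S) hx

lemma koszul_koszul (m n : ℤ) {X Y : A.Ob} (x : A.Hom X Y) :
    A.koszul m (A.koszul n x) = A.koszul (m + n) x := by
  refine A.hom_induction (LinearMap.eqLocus (A.koszul m ∘ₗ A.koszul n) (A.koszul (m + n)))
    (fun d x hx => ?_) x
  change A.koszul m (A.koszul n x) = A.koszul (m + n) x
  rw [A.koszul_of_mem n hx, map_zsmul, A.koszul_of_mem m hx, A.koszul_of_mem _ hx, smul_smul,
    add_mul, Int.negOnePow_add, mul_comm]
  rfl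

lemma koszul_even {m : ℤ} (hm : Even m) {X Y : A.Ob} (x : A.Hom X Y) : A.koszul m x = x := by
  refine A.hom_induction (LinearMap.eqLocus (A.koszul m) LinearMap.id) (fun d x hx => ?_) x
  change A.koszul m x = x
  rw [A.koszul_of_mem m hx, Int.negOnePow_even _ (hm.mul_right d)]
  simp

lemma koszul_mem (m : ℤ) {X Y : A.Ob} {d : ℤ} {x : A.Hom X Y} (hx : x ∈ A.sgr X Y d) :
    A.koszul m x ∈ A.sgr X Y d := by
  rw [A.koszul_of_mem m hx]
  exact zsmul_mem hx _

@[simp] lemma koszulW_nil (m : ℤ) (X : A.Ob) : A.koszulW m (.nil X) = .nil X := rfl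

@[simp] lemma koszulW_cons (m : ℤ) {X Y Z : A.Ob} (x : A.Hom X Y) (w : Word A.Hom Y Z) :
    A.koszulW m (.cons x w) = .cons (A.koszul m x) (A.koszulW m w) := rfl

lemma koszulW_append (m : ℤ) {X Y Z : A.Ob} (u : Word A.Hom X Y) (v : Word A.Hom Y Z) :
    A.koszulW m (u.append v) = (A.koszulW m u).append (A.koszulW m v) :=
  Word.mapHom_append _ u v

@[simp] lemma length_koszulW (m : ℤ) {X Y : A.Ob} (w : Word A.Hom X Y) :
    (A.koszulW m w).length = w.length := Word.length_mapHom _ w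

lemma sumCuts_koszulW {M : Type*} [AddCommGroup M] (m : ℤ) {X Z : A.Ob} (w : Word A.Hom X Z)
    (F : ∀ Y, Word A.Hom X Y → Word A.Hom Y Z → M) :
    (A.koszulW m w).sumCuts F = w.sumCuts fun Y l r => F Y (A.koszulW m l) (A.koszulW m r) :=
  Word.sumCuts_mapHom _ w F

lemma koszulW_koszulW (m n : ℤ) : ∀ {X Y : A.Ob} (w : Word A.Hom X Y),
    A.koszulW m (A.koszulW n w) = A.koszulW (m + n) w
  | _, _, .nil _ => rfl
  | _, _, .cons x w => by
    rw [koszulW_cons, koszulW_cons, koszulW_cons, koszul_koszul, koszulW_koszulW m n w]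

lemma koszulW_even {m : ℤ} (hm : Even m) : ∀ {X Y : A.Ob} (w : Word A.Hom X Y),
    A.koszulW m w = w
  | _, _, .nil _ => rfl
  | _, _, .cons x w => by rw [koszulW_cons, koszul_even A hm, koszulW_even hm w]

variable {A} in
lemma HasDeg.koszulW (m : ℤ) {X Y : A.Ob} {w : Word A.Hom X Y} {d : ℤ} (h : A.HasDeg w d) :
    A.HasDeg (A.koszulW m w) d := by
  induction h with
  | nil X => exact .nil X
  | cons hx _ ih => exact .cons (A.koszul_mem m hx) ih

variable {A} in
lemma HasDeg.append {X Y Z : A.Ob} {u : Word A.Hom X Y} {v : Word A.Hom Y Z} {d e : ℤ}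
    (hu : A.HasDeg u d) (hv : A.HasDeg v e) : A.HasDeg (u.append v) (d + e) := by
  induction hu with
  | nil X => simpa using hv
  | cons hx _ ih => rw [add_assoc]; exact .cons hx (ih hv)

variable {A} in
lemma HasDeg.of_append {X Y Z : A.Ob} (u : Word A.Hom X Y) {v : Word A.Hom Y Z} {d : ℤ}
    (h : A.HasDeg (u.append v) d) : ∃ a e, A.HasDeg u a ∧ A.HasDeg v e ∧ d = a + e := by
  induction u generalizing d with
  | nil X => exact ⟨0, d, HasDeg.nil X, h, by simp⟩
  | cons x u ih =>
    obtain ⟨a, e, hx, hw, rfl⟩ := h.exists_eq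
    obtain ⟨a', e', hu, hv, rfl⟩ := ih hw
    exact ⟨a + a', e', .cons hx hu, hv, by ring⟩

end GrQuiver

section Koszul

variable {A B : GrQuiver k} {M : Type*} [AddCommGroup M] [Module k M]

lemma MLin.koszulW {X W : A.Ob} {ρ : Word A.Hom X W → M} (h : MLin k ρ) (m : ℤ) :
    MLin k fun w => ρ (A.koszulW m w) :=
  h.mapHom fun _ _ => A.koszul m

/-- Multilinear functions are determined by their values on homogeneous words. -/
lemma MLin.ext_homogeneous {X W : A.Ob} {ρ ρ' : Word A.Hom X W → M} (hρ : MLin k ρ)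
    (hρ' : MLin k ρ') (h : ∀ w d, A.HasDeg w d → ρ w = ρ' w) (w : Word A.Hom X W) : ρ w = ρ' w := by
  induction w with
  | nil X => exact h _ _ (GrQuiver.HasDeg.nil X)
  | cons x w ih =>
    refine A.hom_induction (LinearMap.eqLocus (IsLinearMap.mk' _ (hρ.head w))
      (IsLinearMap.mk' _ (hρ'.head w))) (fun d x hx => ?_) x
    exact ih (hρ.cons_left x) (hρ'.cons_left x) fun w e hw => h _ _ (.cons hx hw)

/-- The signs of the letters multiply to the sign for the total degree. The functional ρ is needed
because words themselves cannot be multiplied by scalars. -/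
lemma MLin.koszulW_of_hasDeg {X W : A.Ob} {ρ : Word A.Hom X W → M} (hρ : MLin k ρ) (m : ℤ)
    {w : Word A.Hom X W} {e : ℤ} (h : A.HasDeg w e) :
    ρ (A.koszulW m w) = ((m * e).negOnePow : ℤ) • ρ w := by
  induction h with
  | nil X => simp
  | @cons _ _ _ x w _ _ hx hw ih =>
    rw [A.koszulW_cons, A.koszul_of_mem m hx, (hρ.head _).map_zsmul',
      ih (ρ := fun w => ρ (.cons x w)) (hρ.cons_left x), smul_smul, mul_add, Int.negOnePow_add]
    rfl

/-- A multilinear function `β` of degree `d` commutes with the Koszul operators up to a sign. -/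
lemma koszul_apply {X W : A.Ob} {X' W' : B.Ob} {β : Word A.Hom X W → B.Hom X' W'}
    (hβ : MLin k β) {d : ℤ}
    (hd : ∀ w e, A.HasDeg w e → β w ∈ B.sgr X' W' (e + d)) (m : ℤ) (w : Word A.Hom X W) :
    B.koszul m (β w) = ((m * d).negOnePow : ℤ) • β (A.koszulW m w) := by
  refine MLin.ext_homogeneous (ρ := fun w => B.koszul m (β w))
    (ρ' := fun w => ((m * d).negOnePow : ℤ) • β (A.koszulW m w))
    (hβ.comp (φ := fun y => B.koszul m y) (B.koszul m).isLinear) ((hβ.koszulW m).zsmul _) (fun w e hw => ?_) w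
  rw [B.koszul_of_mem m (hd w e hw), hβ.koszulW_of_hasDeg m hw, smul_smul, mul_add,
    Int.negOnePow_add, mul_comm]
  rfl

end Koszul

/-! ## Insertions of an operation into words -/

namespace GrQuiver

variable (A : GrQuiver k) (m : ℤ) (β : ∀ X Y, Word A.Hom X Y → A.Hom X Y)
variable {M M' : Type*} [AddCommGroup M] [AddCommGroup M']

/-- The sum of `ρ (l · β(c) · r)` over all decompositions `w = l · c · r` with `c` nonempty, with
the Koszul sign for an operation `β` of degree `m`. -/
noncomputable def ins : {X Z : A.Ob} → Word A.Hom X Z → (Word A.Hom X Z → M) → M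
  | _, _, .nil _, _ => 0
  | _, _, .cons x w, ρ =>
    (w.sumCuts fun _ u v => ρ (.cons (β _ _ (.cons x u)) (A.koszulW m v))) +
      ins w fun z => ρ (.cons x z)

@[simp] lemma ins_nil {X : A.Ob} (ρ : Word A.Hom X X → M) : A.ins m β (.nil X) ρ = 0 := rfl

lemma ins_cons {X Y Z : A.Ob} (x : A.Hom X Y) (w : Word A.Hom Y Z) (ρ : Word A.Hom X Z → M) :
    A.ins m β (.cons x w) ρ =
      (w.sumCuts fun _ u v => ρ (.cons (β _ _ (.cons x u)) (A.koszulW m v))) +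
        A.ins m β w fun z => ρ (.cons x z) := rfl

/-- An insertion never produces the empty word: its result contains the letter β(c). -/
lemma ins_congr_of_length {X Z : A.Ob} (w : Word A.Hom X Z) {ρ ρ' : Word A.Hom X Z → M}
    (h : ∀ z, 0 < z.length → ρ z = ρ' z) : A.ins m β w ρ = A.ins m β w ρ' := by
  induction w with
  | nil => rfl
  | cons x w ih =>
    rw [ins_cons, ins_cons]
    congr 1
    · exact Word.sumCuts_congr' w fun _ _ _ => h _ (by simp)
    · exact ih fun z _ => h _ (by simp)

lemma ins_add {X Z : A.Ob} (w : Word A.Hom X Z) (ρ ρ' : Word A.Hom X Z → M) :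
    (A.ins m β w fun z => ρ z + ρ' z) = A.ins m β w ρ + A.ins m β w ρ' := by
  induction w with
  | nil => simp
  | cons x w ih =>
    rw [ins_cons, ins_cons, ins_cons, ih, Word.sumCuts_add]
    abel

lemma map_ins (φ : M →+ M') {X Z : A.Ob} (w : Word A.Hom X Z) (ρ : Word A.Hom X Z → M) :
    φ (A.ins m β w ρ) = A.ins m β w fun z => φ (ρ z) := by
  induction w with
  | nil => simp
  | cons x w ih => rw [ins_cons, ins_cons, map_add, ih, Word.map_sumCuts]

lemma ins_zero {X Z : A.Ob} (w : Word A.Hom X Z) : (A.ins m β w fun _ => (0 : M)) = 0 := by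
  have := A.map_ins m β (0 : M →+ M) w fun _ => 0
  simpa using this.symm

lemma ins_zsmul {X Z : A.Ob} (n : ℤ) (w : Word A.Hom X Z) (ρ : Word A.Hom X Z → M) :
    (A.ins m β w fun z => n • ρ z) = n • A.ins m β w ρ :=
  (A.map_ins m β (DistribSMul.toAddMonoidHom M n) w ρ).symm

/-- `ins` as an additive map in its functional. -/
noncomputable def insHom {X Z : A.Ob} (w : Word A.Hom X Z) : (Word A.Hom X Z → M) →+ M where
  toFun := A.ins m β w
  map_zero' := A.ins_zero m β w
  map_add' := A.ins_add m β w

lemma ins_sumCuts {O₂ : Type u} {H₂ : O₂ → O₂ → Type u} {X Z : A.Ob} (w : Word A.Hom X Z)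
    {V V' : O₂} (v : Word H₂ V V')
    (G : ∀ Y, Word H₂ V Y → Word H₂ Y V' → Word A.Hom X Z → M) :
    (A.ins m β w fun z => v.sumCuts fun Y l r => G Y l r z) =
      v.sumCuts fun Y l r => A.ins m β w (G Y l r) := by
  refine Eq.trans ?_ (Word.map_sumCuts (A.insHom m β w) v G)
  congr 1
  funext z
  exact (Word.map_sumCuts (Pi.evalAddMonoidHom (fun _ => M) z) v G).symm

lemma ins_hat {O O' : Type u} {H : O → O → Type u} {H' : O' → O' → Type u} {F : O → O'}
    (f : ∀ X Y, Word H X Y → H' (F X) (F Y)) {X Z : A.Ob} (w : Word A.Hom X Z)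
    {V V' : O} (v : Word H V V') (G : Word H' (F V) (F V') → Word A.Hom X Z → M) :
    (A.ins m β w fun z => Word.hat f v fun y => G y z) =
      Word.hat f v fun y => A.ins m β w (G y) := by
  refine Eq.trans ?_ (map_list_sum (A.insHom m β w) (v.blocks.map fun b => G (b.map F f))) |>.trans ?_
  · change _ = A.ins m β w _
    congr 1
    funext z
    refine Eq.trans ?_
      (map_list_sum (Pi.evalAddMonoidHom (fun _ : Word A.Hom X Z => M) z) _).symm
    rw [List.map_map]
    rfl
  · rw [List.map_map]
    rfl

/-- The Leibniz rule for insertions with respect to deconcatenation. -/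
lemma ins_conv {X Z : A.Ob} (w : Word A.Hom X Z)
    (F : ∀ Y, Word A.Hom X Y → Word A.Hom Y Z → M) :
    (A.ins m β w fun z => z.sumCuts F) = w.sumCuts fun Y l r =>
      (A.ins m β l fun z => F Y z (A.koszulW m r)) + A.ins m β r (F Y l) := by
  induction w with
  | nil => simp
  | cons x w ih =>
    rw [ins_cons]
    simp only [Word.sumCuts_cons, ins_add, A.sumCuts_koszulW]
    rw [ih, Word.sumCuts_add, ins_nil, zero_add, ins_cons, ← Word.sumCuts_assoc]
    simp only [ins_cons, Word.sumCuts_add]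
    abel

/-- Insertions into a word `l · y · q` with a distinguished letter `y`. -/
lemma ins_append_cons {X Y Y' Z : A.Ob} (l : Word A.Hom X Y) (y : A.Hom Y Y')
    (q : Word A.Hom Y' Z) (ρ : Word A.Hom X Z → M) :
    A.ins m β (l.append (.cons y q)) ρ =
      (A.ins m β l fun z => ρ (z.append (A.koszulW m (.cons y q)))) +
      (l.sumCuts fun _ l₁ l₂ => q.sumCuts fun _ q₁ q₂ =>
        ρ (l₁.append (.cons (β _ _ (l₂.append (.cons y q₁))) (A.koszulW m q₂)))) +
      A.ins m β q fun z => ρ (l.append (.cons y z)) := by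
  induction l with
  | nil => simp [ins_cons]
  | cons x l ih =>
    simp only [Word.cons_append, ins_cons, Word.sumCuts_append_cons, Word.sumCuts_cons, ih,
      Word.nil_append, A.koszulW_append]
    abel

lemma ins_eq_zero {X Z : A.Ob} (w : Word A.Hom X Z) {ρ : Word A.Hom X Z → M}
    (h : ∀ Y Y' (l : Word A.Hom X Y) (c : Word A.Hom Y Y') (r : Word A.Hom Y' Z),
      0 < c.length → l.append (c.append r) = w →
        ρ (l.append (.cons (β _ _ c) (A.koszulW m r))) = 0) : A.ins m β w ρ = 0 := by
  induction w with
  | nil => rfl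
  | cons x w ih =>
    rw [ins_cons, ih fun Y Y' l c r hc hw => h _ _ (.cons x l) c r hc (by
      rw [Word.cons_append, hw]), add_zero]
    refine Eq.trans (Word.sumCuts_congr w fun Y u v huv => ?_) (Word.sumCuts_zero w)
    exact h _ _ (.nil _) (.cons x u) v (by simp) (by rw [← huv]; rfl)

section Linear

variable [Module k M] [Module k M']

variable {A m β}

/-- Letters untouched by the insertion commute with the Koszul operator, and the inserted letter
β(c) contributes ε. For β of degree m one has ε = (-1)^{nm}. -/
lemma ins_koszulW {n ε : ℤ}
    (hβ : ∀ {X Y} (w : Word A.Hom X Y), A.koszul n (β _ _ w) = ε • β _ _ (A.koszulW n w))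
    {X Z : A.Ob} (w : Word A.Hom X Z) {ρ : Word A.Hom X Z → M} (hρ : MLin k ρ) :
    (A.ins m β w fun z => ρ (A.koszulW n z)) = ε • A.ins m β (A.koszulW n w) ρ := by
  induction w with
  | nil => simp
  | cons x w ih =>
    rw [koszulW_cons, ins_cons, ins_cons, A.sumCuts_koszulW, smul_add, ← Word.sumCuts_zsmul]
    congr 1
    · refine Word.sumCuts_congr' w fun _ u v => ?_
      rw [koszulW_cons, hβ, (hρ.head _).map_zsmul', koszulW_koszulW, koszulW_koszulW, add_comm n m,
        koszulW_cons]
    · rw [← ih (hρ.cons_left _)]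
      rfl

/-- `ins` is the sum over all decompositions into three pieces, if `β` vanishes on empty words. -/
lemma sumCuts_eq_ins (hβ : ∀ X, β X X (.nil X) = 0) {X Z : A.Ob} (w : Word A.Hom X Z)
    {ρ : Word A.Hom X Z → M} (hρ : MLin k ρ) :
    (w.sumCuts fun _ l s => s.sumCuts fun _ c r =>
      ρ (l.append (.cons (β _ _ c) (A.koszulW m r)))) = A.ins m β w ρ := by
  induction w with
  | nil X => simp [hβ, (hρ.head _).map_zero]
  | cons x w ih =>
    rw [Word.sumCuts_cons, Word.sumCuts_cons, ins_cons, ← ih (hρ.cons_left x), hβ,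
      Word.nil_append, (hρ.head _).map_zero, zero_add]
    rfl

lemma isLinearMap_ins {V : Type*} [AddCommGroup V] [Module k V] {X Z : A.Ob}
    (w : Word A.Hom X Z) {σ : V → Word A.Hom X Z → M} (hσ : ∀ z, IsLinearMap k fun x => σ x z) :
    IsLinearMap k fun x => A.ins m β w (σ x) := by
  induction w with
  | nil => exact (0 : V →ₗ[k] M).isLinear
  | cons y w ih =>
    simp only [ins_cons]
    exact isLinearMap_add (isLinearMap_sumCuts _ fun _ _ _ => hσ _) (ih fun _ => hσ _)

lemma mlin_ins (hβ : ∀ X Y, MLin k (β X Y)) {X Z : A.Ob} {ρ : Word A.Hom X Z → M}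
    (hρ : MLin k ρ) : MLin k fun w => A.ins m β w ρ where
  isLinear p q := by
    simp only [ins_append_cons]
    refine isLinearMap_add (isLinearMap_add ?_ ?_) ?_
    · exact isLinearMap_ins p fun z => isLinearMap_comp
        (f := fun y => ρ (z.append (.cons y (A.koszulW m q)))) (hρ.isLinear z _)
        (A.koszul m).isLinear
    · exact isLinearMap_sumCuts _ fun _ l₁ l₂ => isLinearMap_sumCuts _ fun _ q₁ q₂ =>
        isLinearMap_comp (f := fun y => ρ (l₁.append (.cons y (A.koszulW m q₂))))
          (hρ.isLinear l₁ _) ((hβ _ _).isLinear l₂ q₁)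
    · exact isLinearMap_ins q fun z => hρ.isLinear p z

end Linear

end GrQuiver

namespace Word

variable {O O' : Type u} {H : O → O → Type u} {H' : O' → O' → Type u}
variable {M : Type*} [AddCommGroup M]

lemma sumCuts_comm {X Z : O} {X' Z' : O'} (w : Word H X Z) (w' : Word H' X' Z')
    (F : ∀ Y, Word H X Y → Word H Y Z → ∀ Y', Word H' X' Y' → Word H' Y' Z' → M) :
    (w.sumCuts fun Y l r => w'.sumCuts (F Y l r)) =
      w'.sumCuts fun Y' l' r' => w.sumCuts fun Y l r => F Y l r Y' l' r' := by
  induction w' with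
  | nil => rfl
  | cons x w' ih =>
    simp only [sumCuts_cons, sumCuts_add]
    rw [ih]

lemma sumCuts_mem {S : Type*} [SetLike S M] [AddSubmonoidClass S M] (s : S) {X Z : O}
    (w : Word H X Z) {F : ∀ Y, Word H X Y → Word H Y Z → M}
    (h : ∀ Y l r, l.append r = w → F Y l r ∈ s) : w.sumCuts F ∈ s := by
  induction w with
  | nil => exact h _ _ _ rfl
  | cons x w ih =>
    exact add_mem (h _ _ _ rfl) (ih fun Y l r hlr => h _ _ _ (by rw [cons_append, hlr]))

lemma hat_comm {O₂ O₂' : Type u} {H₂ : O₂ → O₂ → Type u} {H₂' : O₂' → O₂' → Type u}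
    {F : O → O'} (f : ∀ X Y, Word H X Y → H' (F X) (F Y))
    {F₂ : O₂ → O₂'} (f₂ : ∀ X Y, Word H₂ X Y → H₂' (F₂ X) (F₂ Y))
    {X Z : O} (w : Word H X Z) {X' Z' : O₂} (w' : Word H₂ X' Z')
    (G : Word H' (F X) (F Z) → Word H₂' (F₂ X') (F₂ Z') → M) :
    (hat f w fun z => hat f₂ w' (G z)) = hat f₂ w' fun z' => hat f w fun z => G z z' := by
  unfold hat
  induction w'.blocks with
  | nil => simp
  | cons b L ih => simp only [List.map_cons, List.sum_cons, List.sum_map_add, ih]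

end Word

/-! ## The operations of an `A∞`-category and of an `A∞`-functor on words -/

namespace OpQuiver

variable (A : OpQuiver k) {M : Type*} [AddCommGroup M] [Module k M]

lemma mlin_b (X Y : A.Ob) : MLin k (A.b X Y) := A.b_multilinear.mlin X Y

lemma koszul_b (n : ℤ) {X Y : A.Ob} (w : Word A.Hom X Y) :
    A.koszul n (A.b X Y w) = (n.negOnePow : ℤ) • A.b X Y (A.koszulW n w) := by
  have := koszul_apply (A.mlin_b X Y) (d := 1) (fun w e h => A.b_degree w e h) n w
  rwa [mul_one] at this

/-- Since b₀ = 0, the empty middle pieces contribute nothing by multilinearity, and only the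
nonempty ones counted by `ins` remain. -/
lemma innerSum_eq_ins {N : A.Ob → A.Ob → Type u} [∀ X Y, AddCommGroup (N X Y)]
    [∀ X Y, Module k (N X Y)] {r : ∀ X Y, Word A.Hom X Y → N X Y}
    {X Y : A.Ob} (hr : MLin k (r X Y)) (w : Word A.Hom X Y) : innerSum A r w = A.ins 1 A.b w (r X Y) := by
  rw [innerSum, ← GrQuiver.sumCuts_eq_ins A.b_nil w hr, ← Word.sum_map_cuts₃ w fun _ _ l c s =>
    r X Y (l.append (.cons (A.b _ _ c) (A.koszulW 1 s)))]

/-- The square of the coderivation `b` is the insertion of `b · b`. -/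
lemma ins_ins {X Z : A.Ob} (w : Word A.Hom X Z) {ρ : Word A.Hom X Z → M} (hρ : MLin k ρ) :
    (A.ins 1 A.b w fun z => A.ins 1 A.b z ρ) = A.ins 2 (fun X Y v => A.ins 1 A.b v (A.b X Y)) w ρ := by
  induction w with
  | nil => rfl
  | cons x w ih =>
    -- Two copies of b inserted at disjoint places occur in both orders. Exchanging them costs the
    -- sign (-1)^{1·1}, so these terms cancel and only the nested insertions survive.
    have h1 : ∀ {Y Z : A.Ob} (v : Word A.Hom Y Z) {σ : Word A.Hom Y Z → M} (_ : MLin k σ),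
        (A.ins 1 A.b v fun z => σ (A.koszulW 1 z)) = -A.ins 1 A.b (A.koszulW 1 v) σ := fun v σ hσ => by
      have := GrQuiver.ins_koszulW (m := 1) (β := A.b) (n := 1) (ε := -1)
        (fun w => by rw [koszul_b]; simp) v hσ
      simpa using this
    -- The composite b·b has degree 2, so it passes letters without a sign.
    have h2 : ∀ {Y Z : A.Ob} (v : Word A.Hom Y Z), A.koszulW 2 v = v := fun v =>
      A.koszulW_even (by decide) v
    rw [GrQuiver.ins_cons]
    simp only [GrQuiver.ins_cons, GrQuiver.ins_add, GrQuiver.ins_conv, Word.sumCuts_add,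
      A.sumCuts_koszulW, A.koszulW_koszulW]
    rw [show A.ins 1 A.b w (fun z => A.ins 1 A.b z fun z => ρ (.cons x z)) = _ from
      ih (hρ.cons_left x)]
    simp only [show (1 : ℤ) + 1 = 2 from rfl, h2]
    rw [show (w.sumCuts fun Y l r => A.ins 1 A.b r fun v =>
        ρ (.cons (A.b _ _ (.cons x l)) (A.koszulW 1 v))) = _ from
      Word.sumCuts_congr' w fun Y l r => h1 r (hρ.cons_left _), Word.sumCuts_neg]
    have h4 : ∀ {Y : A.Ob} (u : Word A.Hom _ Y) (v : Word A.Hom Y _),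
        ρ (.cons ((u.sumCuts fun _ u' v' => A.b _ _ (.cons (A.b _ _ (.cons x u'))
          (A.koszulW 1 v'))) + A.ins 1 A.b u fun z => A.b _ _ (.cons x z)) v) =
        (u.sumCuts fun _ u' v' => ρ (.cons (A.b _ _ (.cons (A.b _ _ (.cons x u'))
          (A.koszulW 1 v'))) v)) + A.ins 1 A.b u fun z => ρ (.cons (A.b _ _ (.cons x z)) v) := by
      intro Y u v
      let φ := (IsLinearMap.mk' _ (hρ.head v)).toAddMonoidHom
      change φ _ = _
      rw [map_add, Word.map_sumCuts, GrQuiver.map_ins]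
      rfl
    simp only [h4, Word.sumCuts_add, ← Word.sumCuts_assoc]
    abel

end OpQuiver

-- Functors as coalgebra maps commuting with b

namespace AInfFunctor

variable {A B : OpQuiver k} (f g : AInfFunctor A B) {M : Type*} [AddCommGroup M]

lemma mlin (X Y : A.Ob) : MLin k (f.f X Y) :=
  f.f_multilinear.mlin (N := fun X Y => B.Hom (f.obj X) (f.obj Y)) X Y

lemma koszul_f (n : ℤ) {X Y : A.Ob} (w : Word A.Hom X Y) :
    B.koszul n (f.f X Y w) = f.f X Y (A.koszulW n w) := by
  have := koszul_apply (f.mlin X Y) (d := 0)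
    (fun w e h => by rw [add_zero]; exact f.f_degree w e h) n w
  simpa using this

lemma comm_ins {X Y : A.Ob} (w : Word A.Hom X Y) :
    A.ins 1 A.b w (f.f X Y) = Word.hat f.f w (B.b _ _) := by
  rw [← A.innerSum_eq_ins (N := fun X Y => B.Hom (f.obj X) (f.obj Y)) (f.mlin X Y)]
  exact (f.comm w).symm

/-- All f_n have degree 0, so the extension to words commutes with Koszul operators without a sign.
-/
lemma hat_koszulW (n : ℤ) : ∀ (N : ℕ) {X Z : A.Ob} (w : Word A.Hom X Z) (_ : w.length ≤ N)
    (ρ : Word B.Hom (f.obj X) (f.obj Z) → M),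
    (Word.hat f.f w fun z => ρ (B.koszulW n z)) = Word.hat f.f (A.koszulW n w) ρ
  | _, _, _, .nil X, _, ρ => by simp
  | 0, _, _, .cons x w, h, ρ => absurd h (by simp)
  | N + 1, _, _, .cons x w, h, ρ => by
    rw [A.koszulW_cons, Word.hat_cons, Word.hat_cons, A.sumCuts_koszulW]
    refine Word.sumCuts_congr w fun Y l r hlr => ?_
    have hr : r.length ≤ N := by
      have := congrArg Word.length hlr
      simp only [Word.length_append, Word.length_cons] at this h
      omega
    simp only [B.koszulW_cons, koszul_f, A.koszulW_cons]
    exact hat_koszulW n N r hr fun z => ρ (.cons (f.f _ _ _) z)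

variable [Module k M]

/-- Evaluation of `ρ` on `y · f(v)`, as a function of the letter `y`. -/
noncomputable def headHom {X : B.Ob} {Y Z : A.Ob} (v : Word A.Hom Y Z)
    {ρ : Word B.Hom X (f.obj Z) → M} (hρ : MLin k ρ) : B.Hom X (f.obj Y) →+ M :=
  (IsLinearMap.mk' (fun y => Word.hat f.f v fun t => ρ (.cons y t))
    (isLinearMap_hat _ _ fun t => hρ.head t)).toAddMonoidHom

lemma headHom_apply {X : B.Ob} {Y Z : A.Ob} (v : Word A.Hom Y Z)
    {ρ : Word B.Hom X (f.obj Z) → M} (hρ : MLin k ρ) (y) :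
    f.headHom v hρ y = Word.hat f.f v fun t => ρ (.cons y t) := rfl

/-- As f₀ = 0, an empty first block may be admitted. This makes `hat` a sum over all cuts, the form
to which the Leibniz rule `ins_conv` applies. -/
lemma hat_cons_eq_sumCuts {X Z : A.Ob} (w : Word A.Hom X Z) (hw : 0 < w.length)
    {ρ : Word B.Hom (f.obj X) (f.obj Z) → M} (hρ : MLin k ρ) :
    Word.hat f.f w ρ = w.sumCuts fun _ l r => Word.hat f.f r fun t => ρ (.cons (f.f _ _ l) t) := by
  cases w with
  | nil => simp at hw
  | cons x w =>
    rw [Word.hat_cons, Word.sumCuts_cons, f.f_nil, ← f.headHom_apply _ hρ, map_zero, zero_add]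

/-- An `A∞`-functor, extended to words, commutes with the coderivations `b`. -/
lemma ins_hat_f : ∀ (N : ℕ) {X Z : A.Ob} (w : Word A.Hom X Z) (_ : w.length ≤ N)
    {ρ : Word B.Hom (f.obj X) (f.obj Z) → M} (_ : MLin k ρ),
    (A.ins 1 A.b w fun z => Word.hat f.f z ρ) = Word.hat f.f w fun z => B.ins 1 B.b z ρ
  | _, _, _, .nil X, _, ρ, _ => by simp
  | 0, _, _, .cons x w, h, ρ, _ => absurd h (by simp)
  | N + 1, _, _, .cons x w, h, ρ, hρ => by
    rw [GrQuiver.ins_congr_of_length _ _ _ _ fun z hz =>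
      f.hat_cons_eq_sumCuts z hz hρ, GrQuiver.ins_conv, Word.sumCuts_cons, GrQuiver.ins_nil,
      zero_add]
    -- The artificial term with an empty first block. What remains has b inserted either into the
    -- first block, where `comm_ins` applies, or into the shorter rest, where the induction does.
    have h0 : (A.ins 1 A.b (.cons x w) fun r => Word.hat f.f r fun t =>
        ρ (.cons (f.f _ _ (.nil _)) t)) = 0 := by
      simp only [f.f_nil, (hρ.head _).map_zero, Word.hat_zero, GrQuiver.ins_zero]
    rw [h0, zero_add, Word.hat_cons, Word.sumCuts_add]
    simp only [GrQuiver.ins_cons (A := B.toGrQuiver), Word.hat_add,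
      Word.sumCuts_add, Word.hat_conv _ _ _ le_rfl]
    rw [← Word.sumCuts_assoc]
    congr 1
    · refine Word.sumCuts_congr' w fun Y s r => ?_
      have h1 := GrQuiver.map_ins A.toGrQuiver 1 A.b (f.headHom (A.koszulW 1 r) hρ) (.cons x s)
        (f.f _ _)
      rw [f.comm_ins, Word.hat_cons, Word.map_sumCuts] at h1
      refine h1.symm.trans (Word.sumCuts_congr' s fun V a b => ?_)
      rw [Word.map_hat]
      refine Word.hat_congr _ _ fun z => ?_
      rw [headHom_apply]
      exact (f.hat_koszulW 1 _ r le_rfl fun t => ρ (.cons _ t)).symm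
    · refine Word.sumCuts_congr w fun Y l r hlr => ?_
      have hr : r.length ≤ N := by
        have := congrArg Word.length hlr
        simp only [Word.length_append, Word.length_cons] at this h
        omega
      exact ins_hat_f N r hr (hρ.cons_left _)

end AInfFunctor

-- Transformations as coderivations, and B₁B₁ = 0

section Coderivation

variable {A B : OpQuiver k} (f g : AInfFunctor A B) {M : Type*} [AddCommGroup M]

/-- The extension of `r : f → g` of degree `d` to words: the sum of `ρ (f(l) · r(c) · g(q))` over
all decompositions `w = l · c · q`. -/
noncomputable def cod (d : ℤ) (r : ∀ X Y, Word A.Hom X Y → B.Hom (f.obj X) (g.obj Y))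
    {X Z : A.Ob} (w : Word A.Hom X Z) (ρ : Word B.Hom (f.obj X) (g.obj Z) → M) : M :=
  w.sumCuts fun _ l s => s.sumCuts fun _ c q => Word.hat f.f l fun l' =>
    Word.hat g.f (A.koszulW d q) fun q' => ρ (l'.append (.cons (r _ _ c) q'))

lemma sandwich_eq_cod (d : ℤ) (r : ∀ X Y, Word A.Hom X Y → B.Hom (f.obj X) (g.obj Y))
    {X Z : A.Ob} (w : Word A.Hom X Z) : sandwich f g d r w = cod f g d r w (B.b _ _) := by
  rw [cod, ← Word.sum_map_cuts₃ w fun _ _ l c q => Word.hat f.f l fun l' =>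
    Word.hat g.f (A.koszulW d q) fun q' => B.b _ _ (l'.append (.cons (r _ _ c) q'))]
  rfl

variable [Module k M]

/-- Evaluation of `ρ` on `f(l) · y · g(q)`, as a function of the letter `y`. -/
noncomputable def midHom {X Y Y' Z : A.Ob} (l : Word A.Hom X Y) (q : Word A.Hom Y' Z)
    {ρ : Word B.Hom (f.obj X) (g.obj Z) → M} (hρ : MLin k ρ) : B.Hom (f.obj Y) (g.obj Y') →ₗ[k] M :=
  IsLinearMap.mk' (fun y => Word.hat f.f l fun l' => Word.hat g.f q fun q' =>
      ρ (l'.append (.cons y q')))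
    (isLinearMap_hat _ _ fun l' => isLinearMap_hat _ _ fun q' => hρ.isLinear l' q')

variable {f g}

lemma cod_eq_sumCuts_midHom (d : ℤ) (r : ∀ X Y, Word A.Hom X Y → B.Hom (f.obj X) (g.obj Y))
    {X Z : A.Ob} (w : Word A.Hom X Z) {ρ : Word B.Hom (f.obj X) (g.obj Z) → M} (hρ : MLin k ρ) :
    cod f g d r w ρ = w.sumCuts fun _ l s => s.sumCuts fun _ c q =>
      midHom f g l (A.koszulW d q) hρ (r _ _ c) := rfl

lemma cod_sub_zsmul (d n : ℤ) (r s : ∀ X Y, Word A.Hom X Y → B.Hom (f.obj X) (g.obj Y))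
    {X Z : A.Ob} (w : Word A.Hom X Z) {ρ : Word B.Hom (f.obj X) (g.obj Z) → M} (hρ : MLin k ρ) :
    cod f g d (fun X Y v => r X Y v - n • s X Y v) w ρ = cod f g d r w ρ - n • cod f g d s w ρ := by
  simp only [cod_eq_sumCuts_midHom _ _ _ hρ, map_sub, map_zsmul]
  simp only [sub_eq_add_neg, Word.sumCuts_add, Word.sumCuts_neg, Word.sumCuts_zsmul]

lemma mlin_cod (d : ℤ) {r : ∀ X Y, Word A.Hom X Y → B.Hom (f.obj X) (g.obj Y)}
    (hr : ∀ X Y, MLin k (r X Y)) {X Z : A.Ob}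
    {ρ : Word B.Hom (f.obj X) (g.obj Z) → M} (hρ : MLin k ρ) :
    MLin k fun w => cod f g d r w ρ := by
  have h1 : ∀ {V W : A.Ob} (y : B.Hom (f.obj V) (g.obj W)) (q : Word A.Hom W Z),
      MLin k fun l' => Word.hat g.f q fun q' => ρ (Word.append l' (.cons y q')) := fun y q =>
    ⟨fun p s => isLinearMap_hat _ _ fun q' => (hρ.append_right _).isLinear p s⟩
  refine MLin.sumCuts (fun Y s => ⟨fun p q => isLinearMap_sumCuts _ fun V c v =>
    (MLin.hat f.mlin (h1 _ _)).isLinear p q⟩) fun Y l => MLin.sumCuts (fun V q => ?_) fun V c => ?_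
  · exact (hr _ _).comp (φ := midHom f g l (A.koszulW d q) hρ) (LinearMap.isLinear _)
  · refine ⟨fun p q => isLinearMap_hat _ _ fun l' => ?_⟩
    exact ((MLin.hat g.mlin ((hρ.append_left l').cons_left (r _ _ c))).koszulW d).isLinear p q

/-- The insertions of `b` into the words `f(l) · r(c) · g(q)`, first summand: `b` is inserted into
`f(l)`. -/
noncomputable def codLeft (f g : AInfFunctor A B) (d : ℤ)
    (r : ∀ X Y, Word A.Hom X Y → B.Hom (f.obj X) (g.obj Y))
    {X Z : A.Ob} (w : Word A.Hom X Z) (ρ : Word B.Hom (f.obj X) (g.obj Z) → M) : M :=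
  w.sumCuts fun _ l s => s.sumCuts fun _ c q => Word.hat f.f l fun l' =>
    Word.hat g.f (A.koszulW (d + 1) q) fun q' =>
      B.ins 1 B.b l' fun z => ρ (z.append (.cons (r _ _ (A.koszulW 1 c)) q'))

/-- The insertions of `b` into the words `f(l) · r(c) · g(q)`, third summand: `b` is inserted into
`g(q)`. -/
noncomputable def codRight (f g : AInfFunctor A B) (d : ℤ)
    (r : ∀ X Y, Word A.Hom X Y → B.Hom (f.obj X) (g.obj Y))
    {X Z : A.Ob} (w : Word A.Hom X Z) (ρ : Word B.Hom (f.obj X) (g.obj Z) → M) : M :=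
  w.sumCuts fun _ l s => s.sumCuts fun _ c q => Word.hat f.f l fun l' =>
    Word.hat g.f (A.koszulW d q) fun q' =>
      B.ins 1 B.b q' fun z => ρ (l'.append (.cons (r _ _ c) z))

/-- The middle summand: `b` is applied to a piece that contains `r(c)`. -/
lemma cod_mid (d : ℤ) (r : ∀ X Y, Word A.Hom X Y → B.Hom (f.obj X) (g.obj Y))
    {X Z : A.Ob} (w : Word A.Hom X Z) {ρ : Word B.Hom (f.obj X) (g.obj Z) → M} (hρ : MLin k ρ) :
    (w.sumCuts fun _ l s => s.sumCuts fun _ c q => Word.hat f.f l fun l' =>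
      Word.hat g.f (A.koszulW d q) fun q' => l'.sumCuts fun _ l₁ l₂ => q'.sumCuts fun _ q₁ q₂ =>
        ρ (l₁.append (.cons (B.b _ _ (l₂.append (.cons (r _ _ c) q₁))) (B.koszulW 1 q₂)))) =
    cod f g (d + 1) (fun _ _ v => cod f g d r v (B.b _ _)) w ρ := by
  rw [cod_eq_sumCuts_midHom _ _ _ hρ]
  simp only [cod]
  have h1 : ∀ {V Y Y' W : A.Ob} (la : Word A.Hom X V) (lb : Word A.Hom V Y)
      (y : B.Hom (f.obj Y) (g.obj Y')) (qa : Word A.Hom Y' W) (qb : Word A.Hom W Z),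
      (Word.hat f.f la fun l₁ => Word.hat f.f lb fun l₂ => Word.hat g.f (A.koszulW d qa) fun q₁ =>
        Word.hat g.f (A.koszulW d qb) fun q₂ =>
        ρ (l₁.append (.cons (B.b _ _ (l₂.append (.cons y q₁))) (B.koszulW 1 q₂)))) =
      Word.hat f.f lb fun l₂ => Word.hat g.f (A.koszulW d qa) fun q₁ =>
        midHom f g la (A.koszulW (d + 1) qb) hρ (B.b _ _ (l₂.append (.cons y q₁))) := by
    intro V Y Y' W la lb y qa qb
    rw [Word.hat_comm f.f f.f la lb]
    refine Word.hat_congr _ _ fun l₂ => ?_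
    rw [Word.hat_comm f.f g.f la]
    refine Word.hat_congr _ _ fun q₁ => ?_
    change _ = Word.hat f.f la fun l₁ => Word.hat g.f (A.koszulW (d + 1) qb) fun q₂ =>
      ρ (l₁.append (.cons (B.b _ _ (l₂.append (.cons y q₁))) q₂))
    refine Word.hat_congr _ _ fun l₁ => ?_
    rw [g.hat_koszulW 1 _ _ le_rfl fun q₂ => ρ (l₁.append (.cons _ q₂)), A.koszulW_koszulW,
      add_comm 1 d]
  simp only [Word.hat_sumCuts, Word.hat_conv _ _ _ le_rfl, A.sumCuts_koszulW, h1]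
  have h2 : ∀ {V W Y Y' : A.Ob} (la : Word A.Hom X V) (qb : Word A.Hom W Z) (v : Word A.Hom Y Y')
      (F : ∀ U, Word A.Hom Y U → Word A.Hom U Y' → B.Hom (f.obj V) (g.obj W)),
      midHom f g la (A.koszulW (d + 1) qb) hρ (v.sumCuts F) = v.sumCuts fun U a b =>
        midHom f g la (A.koszulW (d + 1) qb) hρ (F U a b) := fun la qb v F =>
    Word.map_sumCuts (midHom f g la (A.koszulW (d + 1) qb) hρ).toAddMonoidHom v F
  have h3 : ∀ {V W : A.Ob} (la : Word A.Hom X V) (qb : Word A.Hom W Z) {Y Y' : A.Ob}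
      (l : Word A.Hom Y Y') (F : Word B.Hom (f.obj Y) (f.obj Y') → B.Hom (f.obj V) (g.obj W)),
      midHom f g la (A.koszulW (d + 1) qb) hρ (Word.hat f.f l F) = Word.hat f.f l fun z =>
        midHom f g la (A.koszulW (d + 1) qb) hρ (F z) := fun la qb _ _ l F =>
    Word.map_hat f.f (midHom f g la (A.koszulW (d + 1) qb) hρ).toAddMonoidHom l F
  have h4 : ∀ {V W : A.Ob} (la : Word A.Hom X V) (qb : Word A.Hom W Z) {Y Y' : A.Ob}
      (l : Word A.Hom Y Y') (F : Word B.Hom (g.obj Y) (g.obj Y') → B.Hom (f.obj V) (g.obj W)),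
      midHom f g la (A.koszulW (d + 1) qb) hρ (Word.hat g.f l F) = Word.hat g.f l fun z =>
        midHom f g la (A.koszulW (d + 1) qb) hρ (F z) := fun la qb _ _ l F =>
    Word.map_hat g.f (midHom f g la (A.koszulW (d + 1) qb) hρ).toAddMonoidHom l F
  simp only [h2, h3, h4]
  -- Both sides are now sums over decompositions of w into five pieces la·lb·c·qa·qb, nested
  -- differently: b^B is applied to lb·c·qa, while la and qb stay outside. After the order of
  -- summation is changed, three uses of coassociativity match the nestings.
  have h5 : ∀ {Y : A.Ob} (l : Word A.Hom X Y) (s : Word A.Hom Y Z)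
      (F : ∀ V, Word A.Hom Y V → Word A.Hom V Z → ∀ U, Word A.Hom X U → Word A.Hom U Y → M),
      (s.sumCuts fun V c q => l.sumCuts (F V c q)) =
        l.sumCuts fun U la lb => s.sumCuts fun V c q => F V c q U la lb := fun l s F =>
    Word.sumCuts_comm s l F
  simp only [h5]
  rw [Word.sumCuts_assoc w fun V Y la lb s => s.sumCuts fun Y' c q => q.sumCuts fun W qa qb =>
    Word.hat f.f lb fun l₂ => Word.hat g.f (A.koszulW d qa) fun q₁ =>
      midHom f g la (A.koszulW (d + 1) qb) hρ (B.b _ _ (l₂.append (.cons (r _ _ c) q₁)))]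
  refine Word.sumCuts_congr' w fun V la s => ?_
  rw [Word.sumCuts_assoc s fun Y W lb t qb => t.sumCuts fun Y' c qa =>
    Word.hat f.f lb fun l₂ => Word.hat g.f (A.koszulW d qa) fun q₁ =>
      midHom f g la (A.koszulW (d + 1) qb) hρ (B.b _ _ (l₂.append (.cons (r _ _ c) q₁)))]
  refine Word.sumCuts_congr' s fun Y lb t => ?_
  rw [Word.sumCuts_assoc t fun Y' W c qa qb =>
    Word.hat f.f lb fun l₂ => Word.hat g.f (A.koszulW d qa) fun q₁ =>
      midHom f g la (A.koszulW (d + 1) qb) hρ (B.b _ _ (l₂.append (.cons (r _ _ c) q₁)))]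

/-- The coderivation of r followed by that of b^B: b hits letters in front of r(c), a piece
containing r(c), or letters after it. In the first case b, being to the left of r(c), puts its
Koszul operator on r(c), and moving this operator into the argument gives (-1)^d. -/
lemma cod_ins {d : ℤ} {r : ∀ X Y, Word A.Hom X Y → B.Hom (f.obj X) (g.obj Y)}
    (hr : r ∈ Trans f g d) {X Z : A.Ob} (w : Word A.Hom X Z)
    {ρ : Word B.Hom (f.obj X) (g.obj Z) → M} (hρ : MLin k ρ) :
    (cod f g d r w fun z => B.ins 1 B.b z ρ) =
      (d.negOnePow : ℤ) • codLeft f g d r w ρ +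
      cod f g (d + 1) (fun _ _ v => cod f g d r v (B.b _ _)) w ρ + codRight f g d r w ρ := by
  rw [cod]
  simp only [GrQuiver.ins_append_cons, Word.hat_add, Word.sumCuts_add]
  rw [cod_mid d r w hρ]
  congr 2
  rw [codLeft]
  simp only [← Word.sumCuts_zsmul, ← Word.hat_zsmul]
  refine Word.sumCuts_congr' w fun Y l s => Word.sumCuts_congr' s fun V c q =>
    Word.hat_congr _ _ fun l' => ?_
  rw [← add_comm 1 d, ← A.koszulW_koszulW, ← g.hat_koszulW 1 _ _ le_rfl]
  refine Word.hat_congr _ _ fun q' => ?_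
  rw [← GrQuiver.ins_zsmul]
  congr 1
  funext z
  have h := koszul_apply (hr.1.mlin (N := fun X Y => B.Hom (f.obj X) (g.obj Y)) Y V)
    (hr.2 _ _) 1 c
  rw [B.koszulW_cons, h, one_mul, (hρ.isLinear z _).map_zsmul']

/-- The opposite order: the coderivation of b^A followed by that of r. The outer terms agree with
those of `cod_ins` because f and g commute with b (`ins_hat_f`); this time the sign (-1)^d appears
on the right, where b meets the operator of degree d in front of g. -/
lemma ins_cod {d : ℤ} {r : ∀ X Y, Word A.Hom X Y → B.Hom (f.obj X) (g.obj Y)}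
    {X Z : A.Ob} (w : Word A.Hom X Z)
    {ρ : Word B.Hom (f.obj X) (g.obj Z) → M} (hρ : MLin k ρ) :
    (A.ins 1 A.b w fun z => cod f g d r z ρ) =
      codLeft f g d r w ρ + cod f g (d + 1) (fun X Y v => A.ins 1 A.b v (r X Y)) w ρ +
        (d.negOnePow : ℤ) • codRight f g d r w ρ := by
  have h1 : ∀ {V W : A.Ob} (y : B.Hom (f.obj V) (g.obj W)) (q : Word A.Hom W Z),
      MLin k fun l' => Word.hat g.f q fun q' => ρ (Word.append l' (.cons y q')) := fun y q =>
    ⟨fun p s => isLinearMap_hat _ _ fun q' => (hρ.append_right _).isLinear p s⟩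
  simp only [cod, GrQuiver.ins_conv, Word.sumCuts_add, A.sumCuts_koszulW, GrQuiver.ins_sumCuts,
    A.koszulW_koszulW]
  rw [add_assoc]
  congr 1
  · refine Word.sumCuts_congr' w fun Y l s => Word.sumCuts_congr' s fun V c q => ?_
    rw [f.ins_hat_f _ l le_rfl (h1 _ _)]
    exact Word.hat_congr _ _ fun l' => GrQuiver.ins_hat _ _ _ _ _ _ _
  · congr 1
    · refine Word.sumCuts_congr' w fun Y l s => Word.sumCuts_congr' s fun V c q => ?_
      exact (GrQuiver.map_ins A.toGrQuiver 1 A.b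
        (midHom f g l (A.koszulW (d + 1) q) hρ).toAddMonoidHom c (r _ _)).symm
    · rw [codRight]
      simp only [← Word.sumCuts_zsmul, ← Word.hat_zsmul]
      refine Word.sumCuts_congr' w fun Y l s => Word.sumCuts_congr' s fun V c q => ?_
      rw [GrQuiver.ins_hat]
      refine Word.hat_congr _ _ fun l' => ?_
      have hσ := (hρ.append_left l').cons_left (r _ _ c)
      rw [GrQuiver.ins_koszulW (ε := (d.negOnePow : ℤ)) (fun w => A.koszul_b d w) q
        (MLin.hat g.mlin hσ), g.ins_hat_f _ _ le_rfl hσ, Word.hat_zsmul]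

lemma B₁_eq (d : ℤ) {r : ∀ X Y, Word A.Hom X Y → B.Hom (f.obj X) (g.obj Y)}
    (hr : IsMultilinear k (N := fun X Y => B.Hom (f.obj X) (g.obj Y)) r) :
    B₁ f g d r = fun X Y w =>
      cod f g d r w (B.b _ _) - (d.negOnePow : ℤ) • A.ins 1 A.b w (r X Y) := by
  funext X Y w
  rw [B₁, sandwich_eq_cod, A.innerSum_eq_ins (N := fun X Y => B.Hom (f.obj X) (g.obj Y))
    (hr.mlin (N := fun X Y => B.Hom (f.obj X) (g.obj Y)) X Y)]

lemma isMultilinear_B₁ (d : ℤ) {r : ∀ X Y, Word A.Hom X Y → B.Hom (f.obj X) (g.obj Y)}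
    (hr : IsMultilinear k (N := fun X Y => B.Hom (f.obj X) (g.obj Y)) r) :
    IsMultilinear k (N := fun X Y => B.Hom (f.obj X) (g.obj Y)) (B₁ f g d r) := by
  rw [B₁_eq d hr]
  have hr' := hr.mlin (N := fun X Y => B.Hom (f.obj X) (g.obj Y))
  exact isMultilinear_of_mlin (N := fun X Y => B.Hom (f.obj X) (g.obj Y)) fun X Y =>
    (mlin_cod d hr' (B.mlin_b _ _)).sub ((GrQuiver.mlin_ins A.mlin_b (hr' X Y)).zsmul _)

/-- The differential of transformations squares to zero if `b · b = 0` for both quivers. -/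
lemma B₁_B₁ (hA : ∀ {X Y} (w : Word A.Hom X Y), A.ins 1 A.b w (A.b X Y) = 0)
    (hB : ∀ {X Y} (w : Word B.Hom X Y), B.ins 1 B.b w (B.b X Y) = 0)
    {d : ℤ} {r : ∀ X Y, Word A.Hom X Y → B.Hom (f.obj X) (g.obj Y)}
    (hr : r ∈ Trans f g d) {X Y : A.Ob} (w : Word A.Hom X Y) :
    B₁ f g (d + 1) (B₁ f g d r) X Y w = 0 := by
  rw [B₁_eq (d + 1) (isMultilinear_B₁ d hr.1), B₁_eq d hr.1]
  have hr' := hr.1.mlin (N := fun X Y => B.Hom (f.obj X) (g.obj Y))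
  have hb := B.mlin_b (f.obj X) (g.obj Y)
  have h1 := cod_ins hr w hb
  have h2 := ins_cod (d := d) (r := r) w hb
  have h3 : (cod f g d r w fun z => B.ins 1 B.b z (B.b _ _)) = 0 := by
    simp only [hB, cod, Word.hat_zero, Word.sumCuts_zero]
  have h4 : (A.ins 1 A.b w fun v => A.ins 1 A.b v (r X Y)) = 0 := by
    rw [A.ins_ins w (hr' X Y)]
    refine GrQuiver.ins_eq_zero _ _ _ _ fun Y Y' l c s _ _ => ?_
    rw [hA, ((hr' _ _).isLinear l _).map_zero]
  have h5 : (A.ins 1 A.b w fun v => cod f g d r v (B.b _ _) -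
      (d.negOnePow : ℤ) • A.ins 1 A.b v (r X Y)) =
      (A.ins 1 A.b w fun v => cod f g d r v (B.b _ _)) -
      (d.negOnePow : ℤ) • A.ins 1 A.b w fun v => A.ins 1 A.b v (r X Y) :=
    (map_sub (A.insHom (M := B.Hom (f.obj X) (g.obj Y)) 1 A.b w) _ _).trans
      (congrArg _ (map_zsmul (A.insHom (M := B.Hom (f.obj X) (g.obj Y)) 1 A.b w) _ _))
  simp only [cod_sub_zsmul (d + 1) (d.negOnePow : ℤ) (fun X Y v => cod f g d r v (B.b _ _))
    (fun X Y v => A.ins 1 A.b v (r X Y)) w hb, h5, h4, h2]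
  rw [h3] at h1
  have h6 : ((d + 1).negOnePow : ℤ) = -(d.negOnePow : ℤ) := by simp [Int.negOnePow_succ]
  have h7 : (d.negOnePow : ℤ) * (d.negOnePow : ℤ) = 1 := by
    rw [← Units.val_mul, ← Int.negOnePow_add, Int.negOnePow_even _ ⟨d, rfl⟩]; rfl
  rw [h6, smul_zero, sub_zero, neg_smul, sub_neg_eq_add, smul_add, smul_add, smul_smul, h7, one_smul]
  -- The two terms with b^A inserted before r cancel. The rest is the right hand side of `cod_ins`,
  -- whose left hand side vanishes because b·b = 0 in B.
  rw [eq_comm, h1]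
  abel

end Coderivation

/-! ## Degrees -/

section Degrees

variable {A B : OpQuiver k} {f g : AInfFunctor A B} {M : Type*} [AddCommGroup M] [Module k M]

lemma GrQuiver.HasDeg.ins_mem {A : GrQuiver k} {m : ℤ} {β : ∀ X Y, Word A.Hom X Y → A.Hom X Y}
    (hβ : ∀ {X Y} (w : Word A.Hom X Y) (e : ℤ), A.HasDeg w e → β X Y w ∈ A.sgr X Y (e + m))
    (S : Submodule k M) {X Z : A.Ob} {w : Word A.Hom X Z} {e : ℤ} (hw : A.HasDeg w e)
    {ρ : Word A.Hom X Z → M} (hρ : ∀ z, A.HasDeg z (e + m) → ρ z ∈ S) : A.ins m β w ρ ∈ S := by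
  induction hw with
  | nil => exact S.zero_mem
  | @cons _ _ _ x w a e hx hw ih =>
    refine S.add_mem (Word.sumCuts_mem S w fun Y l r hlr => hρ _ ?_)
      (ih fun z hz => hρ _ (by rw [add_assoc]; exact .cons hx hz))
    subst hlr
    obtain ⟨a', e', hl, hr, rfl⟩ := hw.of_append
    have := GrQuiver.HasDeg.cons (hβ _ _ (.cons hx hl)) (hr.koszulW m)
    convert this using 1
    ring

lemma AInfFunctor.hat_mem (f : AInfFunctor A B) (S : Submodule k M) : ∀ (N : ℕ) {X Z : A.Ob}
    (w : Word A.Hom X Z) (_ : w.length ≤ N) (e : ℤ) (_ : A.HasDeg w e)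
    (ρ : Word B.Hom (f.obj X) (f.obj Z) → M) (_ : ∀ z, B.HasDeg z e → ρ z ∈ S),
    Word.hat f.f w ρ ∈ S
  | _, _, _, .nil X, _, e, he, ρ, hρ => by
    rw [Word.hat_nil]
    obtain rfl := he.eq_zero
    exact hρ _ (.nil _)
  | 0, _, _, .cons x w, h, _, _, ρ, _ => absurd h (by simp)
  | N + 1, _, _, .cons x w, h, e, he, ρ, hρ => by
    rw [Word.hat_cons]
    refine Word.sumCuts_mem S w fun Y l r hlr => ?_
    have hr : r.length ≤ N := by
      have := congrArg Word.length hlr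
      simp only [Word.length_append, Word.length_cons] at this h
      omega
    rw [← hlr, ← Word.cons_append] at he
    obtain ⟨a', e', hl', hr', rfl⟩ := he.of_append
    exact hat_mem f S N r hr e' hr' _ fun z hz => hρ _ (.cons (f.f_degree _ _ hl') hz)

lemma cod_mem {d : ℤ} {r : ∀ X Y, Word A.Hom X Y → B.Hom (f.obj X) (g.obj Y)}
    (hr : r ∈ Trans f g d) (S : Submodule k M) {X Z : A.Ob}
    {w : Word A.Hom X Z} {e : ℤ} (he : A.HasDeg w e) {ρ : Word B.Hom (f.obj X) (g.obj Z) → M}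
    (hρ : ∀ z, B.HasDeg z (e + d) → ρ z ∈ S) : cod f g d r w ρ ∈ S := by
  refine Word.sumCuts_mem S w fun Y l s hls => Word.sumCuts_mem S s fun V c q hcq => ?_
  subst hls
  obtain ⟨e₁, e', hl, hs, rfl⟩ := he.of_append
  subst hcq
  obtain ⟨e₂, e₃, hc, hq, rfl⟩ := hs.of_append
  refine f.hat_mem S _ l le_rfl _ hl _ fun l' hl' => g.hat_mem S _ _ le_rfl _ (hq.koszulW d) _
    fun q' hq' => hρ _ ?_
  have := hl'.append (.cons (hr.2 _ _ c _ hc) hq')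
  convert this using 1
  ring

lemma B₁_mem {d : ℤ} {r : ∀ X Y, Word A.Hom X Y → B.Hom (f.obj X) (g.obj Y)}
    (hr : r ∈ Trans f g d) : B₁ f g d r ∈ Trans f g (d + 1) := by
  refine ⟨isMultilinear_B₁ d hr.1, fun X Y w e hw => ?_⟩
  rw [B₁_eq d hr.1]
  refine Submodule.sub_mem _ ?_ (zsmul_mem ?_ _)
  · refine cod_mem hr _ hw fun z hz => ?_
    have := B.b_degree _ _ hz
    rwa [add_assoc] at this
  · refine hw.ins_mem (A := A.toGrQuiver) (fun v e h => A.b_degree v e h) _ fun z hz => ?_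
    have := hr.2 X Y z _ hz
    convert this using 1
    ring_nf

end Degrees

/-! ## The part of the inner sum with at least one outer letter -/

section InnerSumPos

variable {A : OpQuiver k}

lemma Word.sumCuts_eq_nil_left {O : Type u} {H : O → O → Type u} {M : Type*} [AddCommGroup M]
    {X Z : O} (w : Word H X Z) {F : ∀ Y, Word H X Y → Word H Y Z → M}
    (h : ∀ Y l r, 0 < l.length → F Y l r = 0) : w.sumCuts F = F X (.nil X) w := by
  cases w with
  | nil => rfl
  | cons x w =>
    rw [Word.sumCuts_cons, add_eq_left]
    exact (Word.sumCuts_congr' w fun Y l r => h _ _ _ (by simp)).trans (Word.sumCuts_zero w)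

lemma Word.sumCuts_eq_nil_right {O : Type u} {H : O → O → Type u} {M : Type*} [AddCommGroup M]
    {X Z : O} (w : Word H X Z) {F : ∀ Y, Word H X Y → Word H Y Z → M}
    (h : ∀ Y l r, 0 < r.length → F Y l r = 0) : w.sumCuts F = F Z w (.nil Z) := by
  induction w with
  | nil => rfl
  | cons x w ih =>
    rw [Word.sumCuts_cons, h _ _ _ (by simp), zero_add, ih fun Y l r hr => h _ _ _ hr]

lemma sum_map_filter_add {ι M : Type*} [AddCommGroup M] (L : List ι) (p : ι → Prop)
    [DecidablePred p] (F : ι → M) :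
    ((L.filter p).map F).sum + (L.map fun i => if p i then 0 else F i).sum = (L.map F).sum := by
  induction L with
  | nil => simp
  | cons a L ih =>
    rw [List.map_cons, List.map_cons, List.sum_cons, List.sum_cons, ← ih]
    by_cases h : p a
    · rw [List.filter_cons_of_pos (by simpa using h), List.map_cons, List.sum_cons, if_pos h]
      abel
    · rw [List.filter_cons_of_neg (by simpa using h), if_neg h]
      abel

/-- The only decomposition without outer letters is the one whose middle piece is w. Its term is the
one for which the recurrent formula is solved. -/
lemma innerSum_eq_add {N : A.Ob → A.Ob → Type u} [∀ X Y, AddCommGroup (N X Y)]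
    (r : ∀ X Y, Word A.Hom X Y → N X Y) {X Y : A.Ob} (w : Word A.Hom X Y) :
    innerSum A r w = innerSumPos A r w + r X Y (.single (A.b X Y w)) := by
  rw [innerSum, innerSumPos, ← sum_map_filter_add w.cuts₃
    (fun c => 0 < c.left.length + c.right.length)]
  congr 1
  refine (Word.sum_map_cuts₃ w fun _ _ l c s => if 0 < l.length + s.length then 0 else
    r X Y (l.append (.cons (A.b _ _ c) (A.koszulW 1 s)))).trans ?_
  rw [Word.sumCuts_eq_nil_left, Word.sumCuts_eq_nil_right]
  · simp [Word.single]
  · intro Y l s hs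
    rw [if_pos (by omega)]
  · intro Y l s hl
    refine (Word.sumCuts_congr' s fun _ _ _ => if_pos (by omega)).trans (Word.sumCuts_zero s)

lemma innerSumPos_eq_sumCuts {N : A.Ob → A.Ob → Type u} [∀ X Y, AddCommGroup (N X Y)]
    (r : ∀ X Y, Word A.Hom X Y → N X Y) {X Y : A.Ob} (w : Word A.Hom X Y) :
    innerSumPos A r w = w.sumCuts fun _ l s => s.sumCuts fun _ c q =>
      if 0 < l.length + q.length then r X Y (l.append (.cons (A.b _ _ c) (A.koszulW 1 q)))
      else 0 := by
  rw [← Word.sum_map_cuts₃ w fun _ _ l c q => if 0 < l.length + q.length then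
    r X Y (l.append (.cons (A.b _ _ c) (A.koszulW 1 q))) else 0, innerSumPos]
  induction w.cuts₃ with
  | nil => rfl
  | cons c L ih =>
    rw [List.map_cons, List.sum_cons, ← ih]
    by_cases h : 0 < c.left.length + c.right.length
    · rw [List.filter_cons_of_pos (by simpa using h), List.map_cons, List.sum_cons, if_pos h]
    · rw [List.filter_cons_of_neg (by simpa using h), if_neg h, zero_add]

end InnerSumPos

namespace Free

open PTree

variable (Q : DGQuiver k)

/-! ## Concatenation of tensors -/

/-- S is a family over all end points Y, so that the equality X = Y carried by a basis element can
be eliminated. -/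
lemma T_zero_induction {X : Q.Ob} (S : ∀ Y, Submodule k (T Q 0 X Y)) (h : one Q X ∈ S X) {Y : Q.Ob}
    (z : T Q 0 X Y) : z ∈ S Y := by
  change (PLift (X = Y) →₀ k) at z
  induction z using Finsupp.induction_linear with
  | zero => exact (S Y).zero_mem
  | add a b ha hb => exact (S Y).add_mem ha hb
  | single i r =>
    obtain ⟨rfl⟩ := i
    have : (Finsupp.single ⟨rfl⟩ r : PLift (X = X) →₀ k) =
        r • (Finsupp.single ⟨rfl⟩ 1 : PLift (X = X) →₀ k) := by
      rw [Finsupp.smul_single, smul_eq_mul, mul_one]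
    rw [this]
    exact (S X).smul_mem r h

lemma concat_one (n : ℕ) (X Z : Q.Ob) (b : T Q n X Z) : concat Q 0 n X X Z (one Q X) b = b := by
  rw [concat, one]
  erw [Finsupp.lsum_single]
  simp

lemma concat_cons (m n : ℕ) (X V Y Z : Q.Ob) (x : Q.Hom X V) (a : T Q m V Y) (b : T Q n Y Z) :
    concat Q (m + 1) n X Y Z (cons Q m X V Y x a) b =
      cons Q (n + m) X V Z x (concat Q m n V Y Z a b) := by
  rw [concat, lift_cons]
  rfl

/-- To check a property of linear nature of all tensors of positive length, it suffices to consider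
tensors `x ⊗ y`. -/
lemma T_succ_induction {n : ℕ} {X Y : Q.Ob} (S : Submodule k (T Q (n + 1) X Y))
    (h : ∀ Z x y, cons Q n X Z Y x y ∈ S) (z : T Q (n + 1) X Y) : z ∈ S := by
  rw [T_induction Q S h]; trivial

lemma koszulT_cons (j : ℤ) (n : ℕ) (X Z Y : Q.Ob) (x : Q.Hom X Z) (y : T Q n Z Y) :
    koszulT Q j (n + 1) X Y (cons Q n X Z Y x y) =
      cons Q n X Z Y (Q.koszul j x) (koszulT Q j n Z Y y) := by
  rw [koszulT, lift_cons]
  rfl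

lemma dT_cons (n : ℕ) (X Z Y : Q.Ob) (x : Q.Hom X Z) (y : T Q n Z Y) :
    dT Q (n + 1) X Y (cons Q n X Z Y x y) =
      cons Q n X Z Y (Q.diff X Z x) (koszulT Q 1 n Z Y y) + cons Q n X Z Y x (dT Q n Z Y y) := by
  rw [dT, lift_cons]
  rfl

lemma concat_eq_of_one {n : ℕ} {X Z : Q.Ob} {N : Type*} [AddCommGroup N] [Module k N]
    (F G : ∀ Y, T Q 0 X Y →ₗ[k] T Q n Y Z →ₗ[k] N)
    (h : ∀ b, F X (one Q X) b = G X (one Q X) b) {Y : Q.Ob} (a : T Q 0 X Y) (b : T Q n Y Z) :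
    F Y a b = G Y a b := by
  have := T_zero_induction Q (fun Y => LinearMap.eqLocus (F Y) (G Y)) (LinearMap.ext h) a
  exact LinearMap.congr_fun this b

lemma concat_eq_of_cons {m n : ℕ} {X Y Z : Q.Ob} {N : Type*} [AddCommGroup N] [Module k N]
    (F G : T Q (m + 1) X Y →ₗ[k] T Q n Y Z →ₗ[k] N)
    (h : ∀ V x a b, F (cons Q m X V Y x a) b = G (cons Q m X V Y x a) b)
    (a : T Q (m + 1) X Y) (b : T Q n Y Z) : F a b = G a b := by
  have := T_succ_induction Q (LinearMap.eqLocus F G) (fun V x a => LinearMap.ext (h V x a)) a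
  exact LinearMap.congr_fun this b

lemma koszulT_concat (j : ℤ) : ∀ (m n : ℕ) (X Y Z : Q.Ob) (a : T Q m X Y) (b : T Q n Y Z),
    koszulT Q j (n + m) X Z (concat Q m n X Y Z a b) =
      concat Q m n X Y Z (koszulT Q j m X Y a) (koszulT Q j n Y Z b)
  | 0, n, X, Y, Z, a, b => by
    refine concat_eq_of_one Q (fun Y => (concat Q 0 n X Y Z).compr₂ (koszulT Q j n X Z))
      (fun Y => (concat Q 0 n X Y Z).compl₁₂ (koszulT Q j 0 X Y) (koszulT Q j n Y Z))
      (fun b => ?_) a b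
    change koszulT Q j n X Z (concat Q 0 n X X Z (one Q X) b) =
      concat Q 0 n X X Z (one Q X) (koszulT Q j n X Z b)
    rw [concat_one, concat_one]
  | m + 1, n, X, Y, Z, a, b => by
    refine concat_eq_of_cons Q ((concat Q (m + 1) n X Y Z).compr₂ (koszulT Q j (n + m + 1) X Z))
      ((concat Q (m + 1) n X Y Z).compl₁₂ (koszulT Q j (m + 1) X Y) (koszulT Q j n Y Z))
      (fun V x a b => ?_) a b
    change koszulT Q j (n + m + 1) X Z (concat Q (m + 1) n X Y Z (cons Q m X V Y x a) b) =
      concat Q (m + 1) n X Y Z (koszulT Q j (m + 1) X Y (cons Q m X V Y x a)) (koszulT Q j n Y Z b)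
    rw [concat_cons, koszulT_cons, koszulT_cons, concat_cons, koszulT_concat j m n]

lemma koszulT_koszulT (i j : ℤ) : ∀ (n : ℕ) (X Y : Q.Ob) (y : T Q n X Y),
    koszulT Q i n X Y (koszulT Q j n X Y y) = koszulT Q (i + j) n X Y y
  | 0, _, _, _ => rfl
  | n + 1, X, Y, y => by
    refine T_succ_induction Q (LinearMap.eqLocus (koszulT Q i (n + 1) X Y ∘ₗ koszulT Q j (n + 1) X Y)
      (koszulT Q (i + j) (n + 1) X Y)) (fun Z x y => ?_) y
    change koszulT Q i (n + 1) X Y (koszulT Q j (n + 1) X Y (cons Q n X Z Y x y)) =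
      koszulT Q (i + j) (n + 1) X Y (cons Q n X Z Y x y)
    rw [koszulT_cons, koszulT_cons, koszulT_cons, Q.koszul_koszul, koszulT_koszulT i j n]

lemma koszulT_even {j : ℤ} (hj : Even j) : ∀ (n : ℕ) (X Y : Q.Ob) (y : T Q n X Y),
    koszulT Q j n X Y y = y
  | 0, _, _, _ => rfl
  | n + 1, X, Y, y => by
    refine T_succ_induction Q (LinearMap.eqLocus (koszulT Q j (n + 1) X Y) LinearMap.id)
      (fun Z x y => ?_) y
    change koszulT Q j (n + 1) X Y (cons Q n X Z Y x y) = cons Q n X Z Y x y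
    rw [koszulT_cons, Q.koszul_even hj, koszulT_even hj n]

lemma koszulT_of_mem (j : ℤ) : ∀ (n : ℕ) (X Y : Q.Ob) (e : ℤ), ∀ y ∈ grT Q n X Y e,
    koszulT Q j n X Y y = ((j * e).negOnePow : ℤ) • y
  | 0, _, _, e, y, hy => by
    by_cases he : e = 0
    · subst he
      simp [koszulT]
    · simp only [grT, he, if_false, Submodule.mem_bot] at hy
      subst hy
      simp
  | n + 1, X, Y, e, y, hy => by
    refine grT_succ_le Q (LinearMap.eqLocus (koszulT Q j (n + 1) X Y)
      (((j * e).negOnePow : ℤ) • LinearMap.id)) (fun Z a e' x y hx hy hd => ?_) hy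
    change koszulT Q j (n + 1) X Y (cons Q n X Z Y x y) =
      ((j * e).negOnePow : ℤ) • cons Q n X Z Y x y
    rw [koszulT_cons, Q.koszul_of_mem j hx, koszulT_of_mem j n Z Y e' y hy, map_zsmul, map_zsmul,
      LinearMap.smul_apply, smul_smul, ← hd, mul_add, Int.negOnePow_add, mul_comm]
    rfl

lemma diff_koszul (j : ℤ) {X Y : Q.Ob} (x : Q.Hom X Y) :
    Q.diff X Y (Q.koszul j x) = (j.negOnePow : ℤ) • Q.koszul j (Q.diff X Y x) := by
  refine Q.hom_induction (LinearMap.eqLocus (Q.diff X Y ∘ₗ Q.koszul j)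
    ((j.negOnePow : ℤ) • (Q.koszul j ∘ₗ Q.diff X Y))) (fun d x hx => ?_) x
  change Q.diff X Y (Q.koszul j x) = (j.negOnePow : ℤ) • Q.koszul j (Q.diff X Y x)
  have h : Q.diff X Y x ∈ Q.sgr X Y (d + 1) := Q.diff_degree _ x hx
  rw [Q.koszul_of_mem j hx, Q.koszul_of_mem j h, map_zsmul, smul_smul, mul_add, mul_one,
    ← Units.val_mul, ← Int.negOnePow_add, show j + (j * d + j) = j * d + (j + j) by ring,
    Int.negOnePow_add, Int.negOnePow_even _ ⟨j, rfl⟩, mul_one]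

lemma dT_koszulT (j : ℤ) : ∀ (n : ℕ) (X Y : Q.Ob) (y : T Q n X Y),
    dT Q n X Y (koszulT Q j n X Y y) = (j.negOnePow : ℤ) • koszulT Q j n X Y (dT Q n X Y y)
  | 0, _, _, _ => by simp [dT]
  | n + 1, X, Y, y => by
    refine T_succ_induction Q (LinearMap.eqLocus (dT Q (n + 1) X Y ∘ₗ koszulT Q j (n + 1) X Y)
      ((j.negOnePow : ℤ) • (koszulT Q j (n + 1) X Y ∘ₗ dT Q (n + 1) X Y))) (fun Z x y => ?_) y
    change dT Q (n + 1) X Y (koszulT Q j (n + 1) X Y (cons Q n X Z Y x y)) =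
      (j.negOnePow : ℤ) • koszulT Q j (n + 1) X Y (dT Q (n + 1) X Y (cons Q n X Z Y x y))
    rw [koszulT_cons, dT_cons, dT_cons, map_add, koszulT_cons, koszulT_cons, diff_koszul,
      dT_koszulT j n, koszulT_koszulT, koszulT_koszulT, add_comm 1 j, smul_add, map_zsmul,
      map_zsmul, LinearMap.smul_apply]

lemma dT_concat : ∀ (m n : ℕ) (X Y Z : Q.Ob) (a : T Q m X Y) (b : T Q n Y Z),
    dT Q (n + m) X Z (concat Q m n X Y Z a b) =
      concat Q m n X Y Z (dT Q m X Y a) (koszulT Q 1 n Y Z b) +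
        concat Q m n X Y Z a (dT Q n Y Z b)
  | 0, n, X, Y, Z, a, b => by
    refine concat_eq_of_one Q (fun Y => (concat Q 0 n X Y Z).compr₂ (dT Q n X Z))
      (fun Y => (concat Q 0 n X Y Z).compl₁₂ (dT Q 0 X Y) (koszulT Q 1 n Y Z) +
        (concat Q 0 n X Y Z).compl₂ (dT Q n Y Z)) (fun b => ?_) a b
    change dT Q n X Z (concat Q 0 n X X Z (one Q X) b) =
      concat Q 0 n X X Z 0 (koszulT Q 1 n X Z b) + concat Q 0 n X X Z (one Q X) (dT Q n X Z b)
    rw [concat_one, concat_one, map_zero, LinearMap.zero_apply, zero_add]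
  | m + 1, n, X, Y, Z, a, b => by
    refine concat_eq_of_cons Q ((concat Q (m + 1) n X Y Z).compr₂ (dT Q (n + m + 1) X Z))
      ((concat Q (m + 1) n X Y Z).compl₁₂ (dT Q (m + 1) X Y) (koszulT Q 1 n Y Z) +
        (concat Q (m + 1) n X Y Z).compl₂ (dT Q n Y Z)) (fun V x a b => ?_) a b
    change dT Q (n + m + 1) X Z (concat Q (m + 1) n X Y Z (cons Q m X V Y x a) b) =
      concat Q (m + 1) n X Y Z (dT Q (m + 1) X Y (cons Q m X V Y x a)) (koszulT Q 1 n Y Z b) +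
      concat Q (m + 1) n X Y Z (cons Q m X V Y x a) (dT Q n Y Z b)
    rw [concat_cons, dT_cons, dT_cons, map_add, LinearMap.add_apply, concat_cons, concat_cons,
      concat_cons, dT_concat m n, koszulT_concat, map_add]
    exact (add_assoc _ _ _).symm

/-- The two products lie in tensor powers with exponents `n + (m + l)` and `n + m + l`, which are
equal but not definitionally so. Comparing them under a family Φ of maps on all tensor powers avoids
transport along this equality. -/
lemma concat_assoc : ∀ (l m n : ℕ) (X Y Z W : Q.Ob) (a : T Q l X Y) (b : T Q m Y Z) (c : T Q n Z W)
    {N : Type u} [AddCommGroup N] [Module k N] (Φ : ∀ i, T Q i X W →ₗ[k] N),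
    Φ _ (concat Q (m + l) n X Z W (concat Q l m X Y Z a b) c) =
      Φ _ (concat Q l (n + m) X Y W a (concat Q m n Y Z W b c))
  | 0, m, n, X, Y, Z, W, a, b, c, N, _, _, Φ => by
    refine concat_eq_of_one Q
      (fun Y => (concat Q 0 m X Y Z).compr₂ ((concat Q m n X Z W).flip c) |>.compr₂ (Φ (n + m)))
      (fun Y => ((concat Q 0 (n + m) X Y W).compl₂ ((concat Q m n Y Z W).flip c)).compr₂ (Φ (n + m)))
      (fun b => ?_) a b
    change Φ (n + m) (concat Q m n X Z W (concat Q 0 m X X Z (one Q X) b) c) =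
      Φ (n + m) (concat Q 0 (n + m) X X W (one Q X) (concat Q m n X Z W b c))
    rw [concat_one, concat_one]
  | l + 1, m, n, X, Y, Z, W, a, b, c, N, _, _, Φ => by
    refine concat_eq_of_cons Q
      ((concat Q (l + 1) m X Y Z).compr₂ ((concat Q (m + l + 1) n X Z W).flip c)
        |>.compr₂ (Φ (n + (m + l) + 1)))
      (((concat Q (l + 1) (n + m) X Y W).compl₂ ((concat Q m n Y Z W).flip c)).compr₂
        (Φ (n + m + l + 1))) (fun V x a b => ?_) a b
    change Φ (n + (m + l) + 1) (concat Q (m + l + 1) n X Z W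
        (concat Q (l + 1) m X Y Z (cons Q l X V Y x a) b) c) =
      Φ (n + m + l + 1) (concat Q (l + 1) (n + m) X Y W (cons Q l X V Y x a)
        (concat Q m n Y Z W b c))
    rw [concat_cons, concat_cons, concat_cons]
    exact concat_assoc l m n V Y Z W a b c fun i => Φ (i + 1) ∘ₗ cons Q i X V W x

end Free

namespace Free

open PTree

variable (Q : DGQuiver k)

/-! ## Forest tensors -/

open Classical in
/-- The inclusion of the summand `Tⁿ sQ(X,Y)` indexed by a forest with `n` inputs (`0` if the
number of inputs is different from `n`). -/
noncomputable def genFn (f : List PTree) (n : ℕ) (X Y : Q.Ob) : T Q n X Y →ₗ[k] FHom Q X Y :=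
  if h : leavesF f = n then h ▸ genF Q f X Y else 0

lemma genFn_self (f : List PTree) (X Y : Q.Ob) : genFn Q f (leavesF f) X Y = genF Q f X Y := by
  simp [genFn]

variable {Q}

lemma hom_gen_induction {X Y : Q.Ob} (S : Submodule k (Hom Q X Y))
    (h : ∀ t y, gen Q t t.leaves X Y y ∈ S) (z : Hom Q X Y) : z ∈ S := by
  classical
  induction z using DirectSum.induction_on with
  | zero => exact S.zero_mem
  | add x y hx hy => exact S.add_mem hx hy
  | of t y =>
    have := h t y
    rwa [gen_self] at this

lemma fhom_gen_induction {X Y : Q.Ob} (S : Submodule k (FHom Q X Y))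
    (h : ∀ f y, genF Q f X Y y ∈ S) (z : FHom Q X Y) : z ∈ S := by
  classical
  induction z using DirectSum.induction_on with
  | zero => exact S.zero_mem
  | add x y hx hy => exact S.add_mem hx hy
  | of f y => exact h f y

/-- The linear map on `FHom` with given values on the summands. -/
noncomputable def liftF {X Y : Q.Ob} {N : Type*} [AddCommGroup N] [Module k N]
    (φ : ∀ f, T Q (leavesF f) X Y →ₗ[k] N) : FHom Q X Y →ₗ[k] N :=
  open Classical in DirectSum.toModule k (List PTree) N φ

@[simp] lemma liftF_genF {X Y : Q.Ob} {N : Type*} [AddCommGroup N] [Module k N]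
    (φ : ∀ f, T Q (leavesF f) X Y →ₗ[k] N) (f : List PTree) (y : T Q (leavesF f) X Y) :
    liftF φ (genF Q f X Y y) = φ f y := by
  classical
  rw [liftF, genF]
  erw [DirectSum.toModule_lof]

/-- Forest tensors with `l` trees. -/
noncomputable def lenF (Q : DGQuiver k) (l : ℕ) (X Y : Q.Ob) : Submodule k (FHom Q X Y) :=
  Submodule.span k {z | ∃ (f : List PTree) (y : T Q (leavesF f) X Y),
    f.length = l ∧ z = genF Q f X Y y}

lemma genF_mem_lenF {f : List PTree} {l : ℕ} (h : f.length = l) {X Y : Q.Ob}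
    (y : T Q (leavesF f) X Y) : genF Q f X Y y ∈ lenF Q l X Y :=
  Submodule.subset_span ⟨f, y, h, rfl⟩

lemma lenF_induction {l : ℕ} {X Y : Q.Ob} (S : Submodule k (FHom Q X Y))
    (h : ∀ f y, f.length = l → genF Q f X Y y ∈ S) {z : FHom Q X Y} (hz : z ∈ lenF Q l X Y) :
    z ∈ S := by
  refine (Submodule.span_le.2 ?_ : lenF Q l X Y ≤ S) hz
  rintro _ ⟨f, y, hf, rfl⟩
  exact h f y hf

lemma mul_genFn {t : PTree} {f : List PTree} {m n : ℕ} (ht : t.leaves = m) (hf : leavesF f = n)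
    {X Y Z : Q.Ob} (a : T Q m X Y) (v : T Q n Y Z) :
    mul Q X Y Z (gen Q t m X Y a) (genFn Q f n Y Z v) =
      ((t.size * sizeF f : ℤ).negOnePow : ℤ) • genFn Q (t :: f) (n + m) X Z
        (concat Q m n X Y Z a (koszulT Q t.size n Y Z v)) := by
  subst ht hf
  rw [genFn_self, mul_gen]
  congr 1
  exact (LinearMap.congr_fun (genFn_self Q (t :: f) X Z) _).symm

lemma close_genFn {f : List PTree} {n : ℕ} (hf : leavesF f = n) {X Y : Q.Ob} (y : T Q n X Y) :
    close Q X Y (genFn Q f n X Y y) = gen Q (graft f) n X Y y := by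
  classical
  subst hf
  rw [genFn_self, close, genF]
  erw [DirectSum.toModule_lof]

lemma close_genF (f : List PTree) {X Y : Q.Ob} (y : T Q (leavesF f) X Y) :
    close Q X Y (genF Q f X Y y) = gen Q (graft f) (leavesF f) X Y y := by
  rw [← genFn_self, close_genFn rfl]

variable (Q) in
/-- The Koszul operator on forest tensors. -/
noncomputable def koszulF (j : ℤ) (X Y : Q.Ob) : FHom Q X Y →ₗ[k] FHom Q X Y :=
  liftF fun f => ((j * sizeF f).negOnePow : ℤ) • (genF Q f X Y ∘ₗ koszulT Q j (leavesF f) X Y)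

lemma koszulF_genF (j : ℤ) (f : List PTree) {X Y : Q.Ob} (y : T Q (leavesF f) X Y) :
    koszulF Q j X Y (genF Q f X Y y) =
      ((j * sizeF f).negOnePow : ℤ) • genF Q f X Y (koszulT Q j (leavesF f) X Y y) := by
  rw [koszulF, liftF_genF]
  rfl

variable (Q) in
/-- Concatenation of forest tensors. -/
noncomputable def mulF (X Y Z : Q.Ob) : FHom Q X Y →ₗ[k] FHom Q Y Z →ₗ[k] FHom Q X Z :=
  liftF fun f => LinearMap.flip <| liftF fun g => LinearMap.flip <|
    ((sizeF f * sizeF g : ℤ).negOnePow : ℤ) •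
      ((concat Q (leavesF f) (leavesF g) X Y Z).compl₂
        (koszulT Q (sizeF f) (leavesF g) Y Z)).compr₂ (genFn Q (f ++ g) (leavesF g + leavesF f) X Z)

lemma mulF_genF (f g : List PTree) (X Y Z : Q.Ob) (x : T Q (leavesF f) X Y)
    (y : T Q (leavesF g) Y Z) :
    mulF Q X Y Z (genF Q f X Y x) (genF Q g Y Z y) =
      ((sizeF f * sizeF g : ℤ).negOnePow : ℤ) • genFn Q (f ++ g) (leavesF g + leavesF f) X Z
        (concat Q (leavesF f) (leavesF g) X Y Z x (koszulT Q (sizeF f) (leavesF g) Y Z y)) := by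
  rw [mulF, liftF_genF, LinearMap.flip_apply, liftF_genF]
  rfl

lemma mulF_genFn {f g : List PTree} {m n : ℕ} (hf : leavesF f = m) (hg : leavesF g = n)
    (X Y Z : Q.Ob) (x : T Q m X Y) (y : T Q n Y Z) :
    mulF Q X Y Z (genFn Q f m X Y x) (genFn Q g n Y Z y) =
      ((sizeF f * sizeF g : ℤ).negOnePow : ℤ) • genFn Q (f ++ g) (n + m) X Z
        (concat Q m n X Y Z x (koszulT Q (sizeF f) n Y Z y)) := by
  subst hf hg
  rw [genFn_self, genFn_self, mulF_genF]

lemma mulF_one {X Z : Q.Ob} (G : FHom Q X Z) :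
    mulF Q X X Z (genF Q [] X X (one Q X)) G = G := by
  refine fhom_gen_induction (LinearMap.eqLocus (mulF Q X X Z (genF Q [] X X (one Q X)))
    LinearMap.id) (fun g y => ?_) G
  change mulF Q X X Z (genF Q [] X X (one Q X)) (genF Q g X Z y) = genF Q g X Z y
  refine (mulF_genF [] g X X Z (one Q X) y).trans ?_
  have h1 : (((sizeF [] : ℕ) : ℤ) * (sizeF g : ℤ)).negOnePow = 1 := by simp [sizeF]
  have h2 : koszulT Q ((sizeF [] : ℕ) : ℤ) (leavesF g) X Z y = y :=
    koszulT_even Q (by simp [sizeF]) _ _ _ _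
  rw [h1, h2]
  have h3 : concat Q (leavesF []) (leavesF g) X X Z (one Q X) y = y := concat_one Q _ X Z y
  rw [h3]
  rw [Units.val_one, one_smul]
  exact LinearMap.congr_fun (genFn_self Q g X Z) y

/-- Apart from `concat_assoc`, the content is the equality of the sign exponents |t||f| + (|t| +
|f|)|g| and |f||g| + |t|(|f| + |g|). -/
lemma mul_mulF {X Y Z W : Q.Ob} (x : Hom Q X Y) (F : FHom Q Y Z) (G : FHom Q Z W) :
    mulF Q X Z W (mul Q X Y Z x F) G = mul Q X Y W x (mulF Q Y Z W F G) := by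
  refine hom_gen_induction (LinearMap.eqLocus
    (((mulF Q X Z W).flip G) ∘ₗ (mul Q X Y Z).flip F) ((mul Q X Y W).flip (mulF Q Y Z W F G)))
    (fun t a => ?_) x
  refine fhom_gen_induction (LinearMap.eqLocus
    (((mulF Q X Z W).flip G) ∘ₗ mul Q X Y Z (gen Q t t.leaves X Y a))
    (mul Q X Y W (gen Q t t.leaves X Y a) ∘ₗ (mulF Q Y Z W).flip G)) (fun f b => ?_) F
  refine fhom_gen_induction (LinearMap.eqLocus
    (mulF Q X Z W (mul Q X Y Z (gen Q t t.leaves X Y a) (genF Q f Y Z b)))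
    (mul Q X Y W (gen Q t t.leaves X Y a) ∘ₗ mulF Q Y Z W (genF Q f Y Z b))) (fun g c => ?_) G
  change mulF Q X Z W (mul Q X Y Z (gen Q t t.leaves X Y a) (genF Q f Y Z b)) (genF Q g Z W c) =
    mul Q X Y W (gen Q t t.leaves X Y a) (mulF Q Y Z W (genF Q f Y Z b) (genF Q g Z W c))
  rw [← genFn_self, ← genFn_self, mul_genFn rfl rfl, mulF_genFn rfl rfl, map_zsmul,
    LinearMap.smul_apply, map_zsmul, mulF_genFn (by rfl) rfl,
    mul_genFn rfl (by rw [leavesF_append]), koszulT_concat, koszulT_koszulT, smul_smul, smul_smul]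
  have h1 : ((t :: f) ++ g) = t :: (f ++ g) := rfl
  rw [concat_assoc Q _ _ _ _ _ _ _ _ _ _ fun i => genFn Q (t :: f ++ g) i X W]
  have h2 : ((sizeF (t :: f) : ℕ) : ℤ) = t.size + sizeF f := by simp [sizeF]
  have h3 : ((sizeF (f ++ g) : ℕ) : ℤ) = sizeF f + sizeF g := by rw [sizeF_append]; push_cast; rfl
  rw [h2, h3, ← Units.val_mul, ← Units.val_mul, ← Int.negOnePow_add, ← Int.negOnePow_add, h1]
  congr 3
  ring

lemma fold_append : ∀ {X Y Z : Q.Ob} (u : Word (Hom Q) X Y) (v : Word (Hom Q) Y Z),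
    fold Q (u.append v) = mulF Q X Y Z (fold Q u) (fold Q v)
  | _, _, _, .nil _, v => (mulF_one (fold Q v)).symm
  | _, _, _, .cons x u, v => by
    rw [Word.cons_append, fold, fold, fold_append u v, mul_mulF]

lemma mul_mem_lenF {l : ℕ} {X Y Z : Q.Ob} (x : Hom Q X Y) {F : FHom Q Y Z}
    (hF : F ∈ lenF Q l Y Z) : mul Q X Y Z x F ∈ lenF Q (l + 1) X Z := by
  refine hom_gen_induction ((lenF Q (l + 1) X Z).comap ((mul Q X Y Z).flip F)) (fun t a => ?_) x
  refine lenF_induction ((lenF Q (l + 1) X Z).comap (mul Q X Y Z (gen Q t t.leaves X Y a)))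
    (fun f b hf => ?_) hF
  rw [Submodule.mem_comap, mul_gen]
  exact zsmul_mem (genF_mem_lenF (by simp [hf]) _) _

lemma fold_mem_lenF {X Y : Q.Ob} (w : Word (Hom Q) X Y) : fold Q w ∈ lenF Q w.length X Y := by
  induction w with
  | nil X =>
    rw [fold]
    exact genF_mem_lenF (f := []) (l := 0) rfl (one Q X)
  | cons x w ih =>
    rw [fold]
    exact mul_mem_lenF x ih

lemma mlin_fold (X Y : Q.Ob) : MLin k (fold Q : Word (Hom Q) X Y → FHom Q X Y) :=
  ⟨fun p q => ⟨fun x y => fold_add Q p x y q, fun a x => fold_smul Q p a x q⟩⟩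

/-- On homogeneous words both sides multiply by (-1)^{j·deg w}: the degree of a forest tensor is
that of its tensor part plus the number of internal vertices, which is the sign built into
`koszulF`. -/
lemma fold_koszulW (j : ℤ) {X Y : Q.Ob} (w : Word (Hom Q) X Y) :
    fold Q ((quiver Q).koszulW j w) = koszulF Q j X Y (fold Q w) := by
  refine MLin.ext_homogeneous (A := quiver Q) (ρ' := fun w => koszulF Q j X Y (fold Q w))
    ((mlin_fold X Y).koszulW (A := quiver Q) j)
    ((mlin_fold X Y).comp (φ := koszulF Q j X Y) (LinearMap.isLinear _)) (fun w d hw => ?_) w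
  rw [(mlin_fold X Y).koszulW_of_hasDeg (A := quiver Q) j hw]
  have h := fold_mem Q w d hw
  rw [grF] at h
  generalize fold Q w = z at h
  induction h using Submodule.span_induction with
  | zero => simp
  | add x y _ _ hx hy => rw [smul_add, hx, hy, map_add]
  | smul a x _ hx => rw [smul_comm, hx, map_smul]
  | mem z hz =>
    obtain ⟨f, e, y, _, hy, rfl, rfl⟩ := hz
    rw [koszulF_genF, koszulT_of_mem Q j _ _ _ e y hy, map_zsmul, smul_smul, mul_add,
      Int.negOnePow_add, mul_comm]
    rfl

end Free

/-! ## Sums over decompositions by lengths -/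

lemma Word.sumCuts_length {O : Type u} {H : O → O → Type u} {M : Type*} [AddCommGroup M]
    {X Z : O} (w : Word H X Z) (G : ℕ → ℕ → M) :
    (w.sumCuts fun _ l r => G l.length r.length) =
      ∑ i ∈ Finset.range (w.length + 1), G i (w.length - i) := by
  induction w generalizing G with
  | nil => simp
  | cons x w ih =>
    simp only [Word.sumCuts_cons, Word.length_cons, Word.length_nil]
    rw [ih fun i j => G (i + 1) j, Finset.sum_range_succ' _ (w.length + 1), add_comm]
    simp

lemma PTree.sum_map_listCuts {M : Type*} [AddCommGroup M] (L : List PTree)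
    (G : List PTree → List PTree → M) :
    ((listCuts L).map fun c => G c.1 c.2).sum =
      ∑ i ∈ Finset.range (L.length + 1), G (L.take i) (L.drop i) := by
  induction L generalizing G with
  | nil => simp [listCuts]
  | cons a L ih =>
    rw [listCuts, List.map_cons, List.sum_cons, List.map_map]
    have := ih fun l r => G (a :: l) r
    simp only [Function.comp_def]
    rw [this, List.length_cons, Finset.sum_range_succ' _ (L.length + 1), add_comm]
    simp

lemma sum_map_flatMap {ι κ M : Type*} [AddCommGroup M] (L : List ι) (g : ι → List κ) (F : κ → M) :
    ((L.flatMap g).map F).sum = (L.map fun a => ((g a).map F).sum).sum := by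
  induction L with
  | nil => rfl
  | cons a L ih => rw [List.flatMap_cons, List.map_append, List.sum_append, ih, List.map_cons,
      List.sum_cons]

lemma sum_map_filter {ι M : Type*} [AddCommGroup M] (L : List ι) (p : ι → Prop) [DecidablePred p]
    (F : ι → M) : ((L.filter p).map F).sum = (L.map fun a => if p a then F a else 0).sum := by
  induction L with
  | nil => rfl
  | cons a L ih =>
    rw [List.map_cons, List.sum_cons, ← ih]
    by_cases h : p a
    · rw [List.filter_cons_of_pos (by simpa using h), List.map_cons, List.sum_cons, if_pos h]
    · rw [List.filter_cons_of_neg (by simpa using h), if_neg h, zero_add]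

lemma list_sum_apply {ι V M : Type*} [AddCommGroup V] [Module k V] [AddCommGroup M] [Module k M]
    (L : List ι) (φ : ι → V →ₗ[k] M) (y : V) :
    (L.map φ).sum y = (L.map fun i => φ i y).sum := by
  induction L with
  | nil => rfl
  | cons a L ih => rw [List.map_cons, List.sum_cons, LinearMap.add_apply, ih, List.map_cons,
      List.sum_cons]

lemma smul_list_sum {ι M : Type*} [AddCommGroup M] (n : ℤ) (L : List ι) (F : ι → M) :
    n • (L.map F).sum = (L.map fun i => n • F i).sum := by
  have := map_list_sum (DistribSMul.toAddMonoidHom M n) (L.map F)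
  rw [List.map_map] at this
  exact this

namespace Free

open PTree

variable {Q : DGQuiver k}

/-! ## The free `A∞`-category satisfies `b · b = 0` on words of length at least two -/

variable (Q) in
/-- The differential of forest tensors induced by `b₁` on the tensor factors. -/
noncomputable def DF (X Y : Q.Ob) : FHom Q X Y →ₗ[k] FHom Q X Y :=
  liftF fun f => ((sizeF f : ℤ).negOnePow : ℤ) • (genF Q f X Y ∘ₗ dT Q (leavesF f) X Y) +
    ((expansionsF f).map fun c =>
      (((1 + c.1 : ℕ) : ℤ).negOnePow : ℤ) • genFn Q c.2 (leavesF f) X Y).sum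

lemma DF_genFn {f : List PTree} {n : ℕ} (hf : leavesF f = n) {X Y : Q.Ob} (y : T Q n X Y) :
    DF Q X Y (genFn Q f n X Y y) =
      ((sizeF f : ℤ).negOnePow : ℤ) • genFn Q f n X Y (dT Q n X Y y) +
      ((expansionsF f).map fun c =>
        (((1 + c.1 : ℕ) : ℤ).negOnePow : ℤ) • genFn Q c.2 n X Y y).sum := by
  subst hf
  rw [genFn_self, DF, liftF_genF, LinearMap.add_apply, list_sum_apply]
  rfl

lemma b₁_gen' {t : PTree} {n : ℕ} (ht : t.leaves = n) {X Y : Q.Ob} (y : T Q n X Y) :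
    b₁ Q X Y (gen Q t n X Y y) = ((t.size : ℤ).negOnePow : ℤ) • gen Q t n X Y (dT Q n X Y y) +
      (t.expansions.map fun c =>
        (((1 + c.1 : ℕ) : ℤ).negOnePow : ℤ) • gen Q c.2 n X Y y).sum := by
  subst ht
  exact b₁_gen Q t X Y y

lemma koszulF_genFn (j : ℤ) {f : List PTree} {n : ℕ} (hf : leavesF f = n) {X Y : Q.Ob}
    (y : T Q n X Y) :
    koszulF Q j X Y (genFn Q f n X Y y) =
      ((j * sizeF f).negOnePow : ℤ) • genFn Q f n X Y (koszulT Q j n X Y y) := by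
  subst hf
  rw [genFn_self, koszulF_genF]

lemma negOnePow_congr {a b : ℤ} (h : Even (a - b)) : (a.negOnePow : ℤ) = b.negOnePow := by
  rw [(Int.negOnePow_eq_iff a b).2 h]

/-- Leibniz rule for the differential of forest tensors. A new edge lies in the first tree or in the
remaining forest, and d acts on the inputs of the one or of the other; each of these four cases is a
parity check. -/
lemma DF_mul {X Y Z : Q.Ob} (x : Hom Q X Y) (F : FHom Q Y Z) :
    DF Q X Z (mul Q X Y Z x F) =
      mul Q X Y Z (b₁ Q X Y x) (koszulF Q 1 Y Z F) + mul Q X Y Z x (DF Q Y Z F) := by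
  refine hom_gen_induction (LinearMap.eqLocus (DF Q X Z ∘ₗ (mul Q X Y Z).flip F)
    ((mul Q X Y Z).flip (koszulF Q 1 Y Z F) ∘ₗ b₁ Q X Y + (mul Q X Y Z).flip (DF Q Y Z F)))
    (fun t a => ?_) x
  refine fhom_gen_induction (LinearMap.eqLocus (DF Q X Z ∘ₗ mul Q X Y Z (gen Q t t.leaves X Y a))
    (mul Q X Y Z (b₁ Q X Y (gen Q t t.leaves X Y a)) ∘ₗ koszulF Q 1 Y Z +
      mul Q X Y Z (gen Q t t.leaves X Y a) ∘ₗ DF Q Y Z)) (fun f v => ?_) F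
  change DF Q X Z (mul Q X Y Z (gen Q t t.leaves X Y a) (genF Q f Y Z v)) =
    mul Q X Y Z (b₁ Q X Y (gen Q t t.leaves X Y a)) (koszulF Q 1 Y Z (genF Q f Y Z v)) +
      mul Q X Y Z (gen Q t t.leaves X Y a) (DF Q Y Z (genF Q f Y Z v))
  rw [← genFn_self, mul_genFn rfl rfl, map_zsmul, DF_genFn (by rfl), b₁_gen' rfl,
    koszulF_genFn 1 rfl, DF_genFn rfl, dT_concat, dT_koszulT, koszulT_koszulT]
  have hl : ∀ (L : List (ℕ × PTree)) (F : ℕ × PTree → Hom Q X Y) (z : FHom Q Y Z),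
      mul Q X Y Z ((L.map F).sum) z = (L.map fun c => mul Q X Y Z (F c) z).sum := fun L F z => by
    have := map_list_sum ((mul Q X Y Z).flip z) (L.map F)
    rwa [List.map_map] at this
  have hr : ∀ (L : List (ℕ × List PTree)) (F : ℕ × List PTree → FHom Q Y Z) (x : Hom Q X Y),
      mul Q X Y Z x ((L.map F).sum) = (L.map fun c => mul Q X Y Z x (F c)).sum := fun L F x => by
    have := map_list_sum (mul Q X Y Z x) (L.map F)
    rwa [List.map_map] at this
  have hz : ∀ (n : ℤ) (x : Hom Q X Y) (z : FHom Q Y Z),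
      mul Q X Y Z (n • x) z = n • mul Q X Y Z x z := fun n x z => by
    rw [map_zsmul, LinearMap.smul_apply]
  have hz' : ∀ (n : ℤ) (x : Hom Q X Y) (z : FHom Q Y Z),
      mul Q X Y Z x (n • z) = n • mul Q X Y Z x z := fun n x z => map_zsmul _ _ _
  have h1 : expansionsF (t :: f) = ((expansions t).map fun c => (c.1, c.2 :: f)) ++
      ((expansionsF f).map fun c => (size t + c.1, t :: c.2)) := by rw [expansionsF]
  have h2 : ((sizeF (t :: f) : ℕ) : ℤ) = t.size + sizeF f := by simp [sizeF]
  rw [h1, List.map_append, List.sum_append, List.map_map, List.map_map, LinearMap.map_add₂,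
    map_add (mul Q X Y Z _), hl, hr, smul_add, smul_add]
  -- Edge in the first tree: its number of vertices grows by one, which changes the sign of `mul` by
  -- (-1)^{|f|} and its Koszul operator by one; both changes are undone by `koszulF Q 1`.
  have e1 : ((expansions t).map fun c => mul Q X Y Z
        ((((1 + c.1 : ℕ) : ℤ).negOnePow : ℤ) • gen Q c.2 t.leaves X Y a)
        (((1 * (sizeF f : ℤ)).negOnePow : ℤ) • genFn Q f (leavesF f) Y Z
          (koszulT Q 1 (leavesF f) Y Z v))) =
      (expansions t).map fun c => ((t.size * sizeF f : ℤ).negOnePow : ℤ) •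
        ((((1 + c.1 : ℕ) : ℤ).negOnePow : ℤ) • genFn Q (c.2 :: f) (leavesF f + t.leaves) X Z
        (concat Q t.leaves (leavesF f) X Y Z a (koszulT Q t.size (leavesF f) Y Z v))) := by
    refine List.map_congr_left fun c hc => ?_
    obtain ⟨h3, h4⟩ := expansions_spec t c hc
    rw [hz, hz', mul_genFn h3 rfl, koszulT_koszulT, h4,
      show ((t.size + 1 : ℕ) : ℤ) + 1 = t.size + 2 by push_cast; ring, ← koszulT_koszulT,
      koszulT_even Q even_two, smul_smul, smul_smul, smul_smul, ← Units.val_mul, ← Units.val_mul,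
      ← Units.val_mul, ← Int.negOnePow_add, ← Int.negOnePow_add, ← Int.negOnePow_add]
    congr 1
    refine negOnePow_congr ⟨(sizeF f : ℤ), ?_⟩
    push_cast
    ring
  -- Edge in the remaining forest: heights are shifted by |t|, which compensates the change of the
  -- sign of `mul` when |f| grows by one.
  have e2 : ((expansionsF f).map fun c => mul Q X Y Z (gen Q t t.leaves X Y a)
        ((((1 + c.1 : ℕ) : ℤ).negOnePow : ℤ) • genFn Q c.2 (leavesF f) Y Z v)) =
      (expansionsF f).map fun c => ((t.size * sizeF f : ℤ).negOnePow : ℤ) •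
        ((((1 + (t.size + c.1) : ℕ) : ℤ).negOnePow : ℤ) •
        genFn Q (t :: c.2) (leavesF f + t.leaves) X Z
        (concat Q t.leaves (leavesF f) X Y Z a (koszulT Q t.size (leavesF f) Y Z v))) := by
    refine List.map_congr_left fun c hc => ?_
    obtain ⟨h3, h4⟩ := expansionsF_spec f c hc
    rw [hz', mul_genFn rfl h3, h4, smul_smul, smul_smul, ← Units.val_mul, ← Units.val_mul,
      ← Int.negOnePow_add, ← Int.negOnePow_add]
    congr 1
    refine negOnePow_congr ⟨0, ?_⟩
    push_cast
    ring
  rw [e1, e2, smul_list_sum, smul_list_sum, hz, hz', hz', mul_genFn rfl rfl, mul_genFn rfl rfl,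
    koszulT_koszulT, map_add (genFn Q _ _ X Z), map_zsmul, map_zsmul, h2, add_comm (1 : ℤ) t.size]
  simp only [smul_add, smul_smul, ← Units.val_mul, ← Int.negOnePow_add, Function.comp_def]
  have e3 : ((t.size * sizeF f + (t.size + sizeF f) : ℤ).negOnePow : ℤ) =
      ((t.size + 1 * sizeF f + t.size * sizeF f : ℤ).negOnePow : ℤ) :=
    negOnePow_congr ⟨0, by ring⟩
  have e4 : ((t.size * sizeF f + (t.size + sizeF f + t.size) : ℤ).negOnePow : ℤ) =
      ((sizeF f + t.size * sizeF f : ℤ).negOnePow : ℤ) :=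
    negOnePow_congr ⟨t.size, by ring⟩
  rw [e3, e4]
  abel_nf

end Free

-- Grafting at the root and the relation b·b = 0 on long words

namespace Free

open PTree

variable {Q : DGQuiver k}

variable (Q) in
/-- Grafting the trees of a forest at the positions `i + 1, …, i + j` onto a new root vertex. -/
noncomputable def rootF (i j : ℕ) (X Y : Q.Ob) : FHom Q X Y →ₗ[k] FHom Q X Y :=
  liftF fun f => ((sizeF (f.take i) : ℤ).negOnePow : ℤ) •
    genFn Q (f.take i ++ graft ((f.drop i).take j) :: (f.drop i).drop j) (leavesF f) X Y

lemma rootF_genFn (i j : ℕ) {f : List PTree} {n : ℕ} (hf : leavesF f = n) {X Y : Q.Ob}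
    (y : T Q n X Y) :
    rootF Q i j X Y (genFn Q f n X Y y) = ((sizeF (f.take i) : ℤ).negOnePow : ℤ) •
      genFn Q (f.take i ++ graft ((f.drop i).take j) :: (f.drop i).drop j) n X Y y := by
  subst hf
  rw [genFn_self, rootF, liftF_genF]
  rfl

/-- This identifies `rootF` with inserting b_j, j ≥ 2, after i letters. Grafting the middle forest
adds one vertex to it: the product with L changes by (-1)^{|A|}, the sign in `rootF`, while the
change in the product with V is absorbed by the Koszul operator that b, of degree 1, puts on V. -/
lemma rootF_mulF {i j : ℕ} (hj : 2 ≤ j) {X Y Z W : Q.Ob} {L : FHom Q X Y} {M : FHom Q Y Z}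
    (V : FHom Q Z W) (hL : L ∈ lenF Q i X Y) (hM : M ∈ lenF Q j Y Z) :
    rootF Q i j X W (mulF Q X Y W L (mulF Q Y Z W M V)) =
      mulF Q X Y W L (mul Q Y Z W (close Q Y Z M) (koszulF Q 1 Z W V)) := by
  refine lenF_induction (LinearMap.eqLocus
    (rootF Q i j X W ∘ₗ (mulF Q X Y W).flip (mulF Q Y Z W M V))
    ((mulF Q X Y W).flip (mul Q Y Z W (close Q Y Z M) (koszulF Q 1 Z W V)))) (fun A a hA => ?_) hL
  refine lenF_induction (LinearMap.eqLocus
    (rootF Q i j X W ∘ₗ mulF Q X Y W (genF Q A X Y a) ∘ₗ (mulF Q Y Z W).flip V)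
    (mulF Q X Y W (genF Q A X Y a) ∘ₗ (mul Q Y Z W).flip (koszulF Q 1 Z W V) ∘ₗ close Q Y Z))
    (fun B b hB => ?_) hM
  refine fhom_gen_induction (LinearMap.eqLocus
    (rootF Q i j X W ∘ₗ mulF Q X Y W (genF Q A X Y a) ∘ₗ mulF Q Y Z W (genF Q B Y Z b))
    (mulF Q X Y W (genF Q A X Y a) ∘ₗ mul Q Y Z W (close Q Y Z (genF Q B Y Z b)) ∘ₗ
      koszulF Q 1 Z W)) (fun C c => ?_) V
  change rootF Q i j X W (mulF Q X Y W (genF Q A X Y a)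
      (mulF Q Y Z W (genF Q B Y Z b) (genF Q C Z W c))) =
    mulF Q X Y W (genF Q A X Y a) (mul Q Y Z W (close Q Y Z (genF Q B Y Z b))
      (koszulF Q 1 Z W (genF Q C Z W c)))
  obtain ⟨hg1, hg2⟩ := graft_spec B (hB ▸ hj)
  have hz' : ∀ (n : ℤ) (x : Hom Q Y Z) (z : FHom Q Z W),
      mul Q Y Z W x (n • z) = n • mul Q Y Z W x z := fun n x z => map_zsmul _ _ _
  have hz : ∀ (n : ℤ) (x : FHom Q X Y) (z : FHom Q Y W),
      mulF Q X Y W x (n • z) = n • mulF Q X Y W x z := fun n x z => map_zsmul _ _ _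
  have h1 : (A ++ (B ++ C)).take i = A := by rw [← hA]; simp
  have h2 : (A ++ (B ++ C)).drop i = B ++ C := by rw [← hA]; simp
  have h3 : (B ++ C).take j = B := by rw [← hB]; simp
  have h4 : (B ++ C).drop j = C := by rw [← hB]; simp
  rw [← genFn_self Q A, ← genFn_self Q B, ← genFn_self Q C, mulF_genFn rfl rfl, hz,
    mulF_genFn rfl (leavesF_append B C), map_zsmul, map_zsmul,
    rootF_genFn i j (by rw [leavesF_append, leavesF_append]), h1, h2, h3, h4, close_genFn rfl,
    koszulF_genFn 1 rfl, hz', mul_genFn hg1 rfl, koszulT_koszulT, hz, hz,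
    mulF_genFn rfl (by rw [leavesF, hg1]), hg2, show ((1 + sizeF B : ℕ) : ℤ) + 1 = sizeF B + 2 by
      push_cast; ring, ← koszulT_koszulT, koszulT_even Q even_two]
  simp only [smul_smul, ← Units.val_mul, ← Int.negOnePow_add]
  congr 1
  refine negOnePow_congr ⟨- (sizeF C : ℤ), ?_⟩
  rw [sizeF_append, sizeF, hg2]
  push_cast
  ring

lemma expansions_graft (f : List PTree) (hf : 2 ≤ f.length) :
    expansions (graft f) = rootExpansions f ++
      (expansionsF f).map fun c => (1 + c.1, graft c.2) := by
  match f, hf with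
  | t₁ :: t₂ :: ts, _ =>
    rw [graft, expansions, expansionsF, expansionsF]
    simp only [List.map_append, List.map_map, List.append_assoc]
    rfl

/-- A new edge at the root is indexed by the number i of subtrees to its left and the number j of
subtrees above it; in this form it can be compared with cuts of words through `Word.sumCuts_length`.
-/
lemma sum_map_rootExpansions {M : Type*} [AddCommGroup M] (f : List PTree) (F : ℕ × PTree → M) :
    ((rootExpansions f).map F).sum =
      ∑ i ∈ Finset.range (f.length + 1), ∑ j ∈ Finset.range (f.length - i + 1),
        if 0 < i + (f.length - i - j) ∧ 2 ≤ j then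
          F (1 + sizeF (f.take i) + 1,
            graft (f.take i ++ graft ((f.drop i).take j) :: (f.drop i).drop j)) else 0 := by
  rw [rootExpansions, sum_map_flatMap]
  refine (PTree.sum_map_listCuts f fun A R => ((((listCuts R).filter fun c' =>
    2 ≤ c'.1.length ∧ 0 < A.length + c'.2.length).map fun c' =>
      (1 + sizeF A + 1, graft (A ++ graft c'.1 :: c'.2))).map F).sum).trans ?_
  refine Finset.sum_congr rfl fun i hi => ?_
  rw [Finset.mem_range] at hi
  rw [List.map_map, sum_map_filter]
  refine (PTree.sum_map_listCuts (f.drop i) fun B C =>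
    if 2 ≤ B.length ∧ 0 < (f.take i).length + C.length then
      F (1 + sizeF (f.take i) + 1, graft (f.take i ++ graft B :: C)) else 0).trans ?_
  rw [List.length_drop]
  refine Finset.sum_congr rfl fun j hj => ?_
  rw [Finset.mem_range] at hj
  simp only [List.length_take, List.length_drop, min_eq_left (show i ≤ f.length by omega),
    min_eq_left (show j ≤ f.length - i by omega), and_comm]

/-- The root vertex adds one to the number of vertices and to all heights inside the subtrees,
whence the minus sign at `DF`. A new edge at the root after the forest A has height |A| + 2, hence
the sign (-1)^{|A|+3}, which is minus that of `rootF`. -/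
lemma b₁_close {n : ℕ} (hn : 2 ≤ n) {X Y : Q.Ob} {F : FHom Q X Y} (hF : F ∈ lenF Q n X Y) :
    b₁ Q X Y (close Q X Y F) = -close Q X Y (DF Q X Y F) -
      ∑ i ∈ Finset.range (n + 1), ∑ j ∈ Finset.range (n - i + 1),
        if 0 < i + (n - i - j) ∧ 2 ≤ j then close Q X Y (rootF Q i j X Y F) else 0 := by
  refine (lenF_induction (LinearMap.eqLocus (b₁ Q X Y ∘ₗ close Q X Y)
    (-(close Q X Y ∘ₗ DF Q X Y) - ∑ i ∈ Finset.range (n + 1), ∑ j ∈ Finset.range (n - i + 1),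
        if 0 < i + (n - i - j) ∧ 2 ≤ j then close Q X Y ∘ₗ rootF Q i j X Y else 0))
    (fun f y hf => ?_) hF).trans ?_
  swap
  · rw [LinearMap.sub_apply, LinearMap.neg_apply]
    simp only [LinearMap.sum_apply, apply_ite (fun φ : FHom Q X Y →ₗ[k] Hom Q X Y => φ F)]
    rfl
  subst hf
  rw [LinearMap.mem_eqLocus, LinearMap.sub_apply, LinearMap.neg_apply]
  simp only [LinearMap.sum_apply,
    apply_ite (fun φ : FHom Q X Y →ₗ[k] Hom Q X Y => φ (genF Q f X Y y)),
    LinearMap.comp_apply, LinearMap.zero_apply]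
  obtain ⟨hg1, hg2⟩ := graft_spec f hn
  rw [← genFn_self, close_genFn rfl, b₁_gen' hg1, DF_genFn rfl, expansions_graft f hn,
    List.map_append, List.sum_append, List.map_map, map_add, map_zsmul, close_genFn rfl,
    map_list_sum, List.map_map, hg2, sum_map_rootExpansions]
  have h1 : ((expansionsF f).map ((fun c : ℕ × PTree =>
        (((1 + c.1 : ℕ) : ℤ).negOnePow : ℤ) • gen Q c.2 (leavesF f) X Y y) ∘
        fun c => (1 + c.1, graft c.2))).sum =
      -((expansionsF f).map (close Q X Y ∘ fun c =>
        (((1 + c.1 : ℕ) : ℤ).negOnePow : ℤ) • genFn Q c.2 (leavesF f) X Y y)).sum := by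
    rw [← neg_one_zsmul, smul_list_sum]
    congr 1
    refine List.map_congr_left fun c hc => ?_
    obtain ⟨h3, h4⟩ := expansionsF_spec f c hc
    simp only [Function.comp_apply]
    rw [map_zsmul, close_genFn h3, smul_smul]
    congr 1
    rw [show (-1 : ℤ) = ((1 : ℤ).negOnePow : ℤ) by simp, ← Units.val_mul, ← Int.negOnePow_add]
    refine negOnePow_congr ⟨0, ?_⟩
    push_cast
    ring
  have h2 : (∑ i ∈ Finset.range (f.length + 1), ∑ j ∈ Finset.range (f.length - i + 1),
      if 0 < i + (f.length - i - j) ∧ 2 ≤ j then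
        (((1 + (1 + sizeF (f.take i) + 1) : ℕ) : ℤ).negOnePow : ℤ) •
          gen Q (graft (f.take i ++ graft ((f.drop i).take j) :: (f.drop i).drop j))
            (leavesF f) X Y y else 0) =
      -∑ i ∈ Finset.range (f.length + 1), ∑ j ∈ Finset.range (f.length - i + 1),
      if 0 < i + (f.length - i - j) ∧ 2 ≤ j then
        close Q X Y (rootF Q i j X Y (genFn Q f (leavesF f) X Y y)) else 0 := by
    rw [← Finset.sum_neg_distrib]
    refine Finset.sum_congr rfl fun i hi => ?_
    rw [← Finset.sum_neg_distrib]
    refine Finset.sum_congr rfl fun j hj => ?_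
    rw [Finset.mem_range] at hi hj
    split_ifs with h
    · rw [rootF_genFn i j rfl, map_zsmul]
      have hB := graft_spec ((f.drop i).take j) (by simp; omega)
      rw [close_genFn, ← neg_one_zsmul, smul_smul]
      · congr 1
        rw [show (-1 : ℤ) = ((1 : ℤ).negOnePow : ℤ) by simp, ← Units.val_mul, ← Int.negOnePow_add]
        refine negOnePow_congr ⟨1, ?_⟩
        push_cast
        ring
      · have h3 : leavesF f = leavesF (f.take i ++ ((f.drop i).take j ++ (f.drop i).drop j)) := by
          rw [List.take_append_drop, List.take_append_drop]
        rw [h3, leavesF_append, leavesF, leavesF_append, leavesF_append, hB.1]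
    · rw [neg_zero]
  rw [h1, h2, show ((1 + sizeF f : ℕ) : ℤ) = sizeF f + 1 by push_cast; ring, Int.negOnePow_succ]
  rw [Units.val_neg, neg_smul]
  abel

/-- The part of `b` on words of length one. -/
noncomputable def bOne (Q : DGQuiver k) : ∀ X Y, Word (Hom Q) X Y → Hom Q X Y
  | _, _, .nil _ => 0
  | _, _, .cons x (.nil _) => b₁ Q _ _ x
  | _, _, .cons _ (.cons _ _) => 0

lemma b_eq_close {X Y : Q.Ob} (w : Word (Hom Q) X Y) (hw : 2 ≤ w.length) :
    b Q X Y w = close Q X Y (fold Q w) := by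
  match w, hw with
  | .cons x (.cons y w), _ => rw [b]

/-- `DF` is a derivation of the product of forests that restricts to b₁ on single trees, so on a
product of letters it applies b₁ to one letter at a time. -/
lemma ins_bOne {X Y : Q.Ob} (w : Word (Hom Q) X Y) :
    (quiver Q).ins 1 (bOne Q) w (fold Q) = DF Q X Y (fold Q w) := by
  induction w with
  | nil X =>
    have h1 := DF_genFn (Q := Q) (f := []) rfl (X := X) (Y := X) (one Q X)
    rw [genFn_self] at h1
    have h2 : dT Q (leavesF []) X X (one Q X) = 0 := rfl
    refine Eq.trans ?_ h1.symm
    rw [GrQuiver.ins_nil]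
    erw [h2]
    simp [expansionsF]
  | cons x w ih =>
    rw [GrQuiver.ins_cons, Word.sumCuts_eq_nil_left]
    · change _ = DF Q _ _ (mul Q _ _ _ x (fold Q w))
      rw [DF_mul, ← ih, ← fold_koszulW]
      congr 1
      exact ((quiver Q).map_ins 1 (bOne Q) (mul Q _ _ _ x).toAddMonoidHom w (fold Q)).symm
    · intro Y l r hl
      cases l with
      | nil => simp at hl
      | cons y l =>
        rw [bOne, fold, map_zero, LinearMap.zero_apply]

/-- The relation `b · b = 0` of the free `A∞`-category on words of length at least two. -/
lemma ins_b_b_of_two_le {X Y : Q.Ob} (w : Word (Hom Q) X Y) (hw : 2 ≤ w.length) :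
    (FQ Q).ins 1 (FQ Q).b w ((FQ Q).b X Y) = 0 := by
  rw [← (FQ Q).innerSum_eq_ins (N := (FQ Q).Hom) ((FQ Q).mlin_b X Y), innerSum_eq_add,
    innerSumPos_eq_sumCuts]
  have hb : ∀ {X Y : Q.Ob} (w : Word (Hom Q) X Y), 2 ≤ w.length →
      (FQ Q).b X Y w = close Q X Y (fold Q w) := fun w hw => b_eq_close w hw
  -- Insertions with at least one outer letter, by the length of c: empty c gives zero, one letter
  -- gives the `bOne` term, two or more letters give `rootF`. The `bOne` term needs no condition
  -- since w has at least two letters. Here `s.length - c.length` is the length of q.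
  have key : ∀ Y₁ (l : Word (Hom Q) X Y₁) (s : Word (Hom Q) Y₁ Y), l.append s = w →
      ∀ Y₂ (c : Word (Hom Q) Y₁ Y₂) (q : Word (Hom Q) Y₂ Y), c.append q = s →
      (if 0 < l.length + q.length then
        (FQ Q).b X Y (l.append (.cons ((FQ Q).b _ _ c) ((FQ Q).koszulW 1 q))) else 0) =
      close Q X Y (fold Q (l.append (.cons (bOne Q _ _ c) ((FQ Q).koszulW 1 q)))) +
      if 0 < l.length + (s.length - c.length) ∧ 2 ≤ c.length then
        close Q X Y (rootF Q l.length c.length X Y (fold Q w)) else 0 := by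
    intro Y₁ l s hls Y₂ c q hcq
    have hz : ∀ {V : Q.Ob} (l : Word (Hom Q) X V) {V' : Q.Ob} (q : Word (Hom Q) V' Y),
        fold Q (l.append (.cons (0 : Hom Q V V') q)) = 0 := fun l _ q =>
      ((mlin_fold X Y).isLinear l q).map_zero
    have hl1 := congrArg Word.length hls
    have hl2 := congrArg Word.length hcq
    rw [Word.length_append] at hl1 hl2
    match c, hcq, hl2 with
    | .nil _, hcq, hl2 =>
      rw [if_neg (c := 0 < l.length + (s.length - (Word.nil Y₁ : Word (Hom Q) Y₁ Y₁).length) ∧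
        2 ≤ (Word.nil Y₁ : Word (Hom Q) Y₁ Y₁).length) (by simp), bOne, hz, map_zero, add_zero]
      have : (FQ Q).b X Y (l.append (.cons ((FQ Q).b Y₁ Y₁ (.nil Y₁)) ((FQ Q).koszulW 1 q))) = 0 :=
        (((FQ Q).mlin_b X Y).isLinear l _).map_zero
      rw [this, ite_self]
    | .cons x (.nil _), hcq, hl2 =>
      simp only [Word.length_cons, Word.length_nil] at hl2
      have hk := (FQ Q).length_koszulW 1 q
      rw [if_neg (c := 0 < l.length + (s.length - (Word.cons x (.nil Y₂)).length) ∧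
        2 ≤ (Word.cons x (.nil Y₂)).length) (by simp), if_pos (by omega),
        hb _ (by rw [Word.length_append, Word.length_cons]; omega), add_zero]
      rfl
    | .cons x (.cons y c), hcq, hl2 =>
      rw [bOne, hz, map_zero, zero_add]
      simp only [Word.length_cons] at hl2
      have hk := (FQ Q).length_koszulW 1 q
      by_cases h : 0 < l.length + q.length
      · rw [if_pos h, if_pos (by simp only [Word.length_cons]; omega), 
          hb _ (by rw [Word.length_append, Word.length_cons]; omega), ← hls, ← hcq, fold_append, fold_append l, fold_append (.cons x (.cons y c)),
          rootF_mulF (by simp) _ (fold_mem_lenF l) (fold_mem_lenF _), ← fold_koszulW,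
          ← b_eq_close _ (by simp)]
        rfl
      · rw [if_neg h, if_neg (by simp only [Word.length_cons]; omega)]
  rw [Word.sumCuts_congr w fun Y₁ l s hls => Word.sumCuts_congr s fun Y₂ c q hcq =>
    key Y₁ l s hls Y₂ c q hcq]
  simp only [Word.sumCuts_add]
  have h1 : (w.sumCuts fun _ l s => s.sumCuts fun _ c q => close Q X Y
      (fold Q (l.append (.cons (bOne Q _ _ c) ((FQ Q).koszulW 1 q))))) =
      close Q X Y (DF Q X Y (fold Q w)) := by
    rw [← ins_bOne, ← GrQuiver.sumCuts_eq_ins (A := quiver Q) (fun _ => rfl) w (mlin_fold X Y)]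
    refine Eq.trans ?_ (Word.map_sumCuts (close Q X Y).toAddMonoidHom w _).symm
    refine Word.sumCuts_congr' w fun _ l s => ?_
    exact (Word.map_sumCuts (close Q X Y).toAddMonoidHom s _).symm
  have h2 : (w.sumCuts fun _ l s => s.sumCuts fun _ c q =>
      if 0 < l.length + (s.length - c.length) ∧ 2 ≤ c.length then
        close Q X Y (rootF Q l.length c.length X Y (fold Q w)) else 0) =
      ∑ i ∈ Finset.range (w.length + 1), ∑ j ∈ Finset.range (w.length - i + 1),
        if 0 < i + (w.length - i - j) ∧ 2 ≤ j then
          close Q X Y (rootF Q i j X Y (fold Q w)) else 0 := by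
    rw [← Word.sumCuts_length w fun i n => ∑ j ∈ Finset.range (n + 1),
        if 0 < i + (n - j) ∧ 2 ≤ j then close Q X Y (rootF Q i j X Y (fold Q w)) else 0]
    refine Word.sumCuts_congr' w fun _ l s => ?_
    exact Word.sumCuts_length s fun j _ => if 0 < l.length + (s.length - j) ∧ 2 ≤ j then
      close Q X Y (rootF Q l.length j X Y (fold Q w)) else 0
  rw [h1, h2]
  have h3 : b Q X Y (.single (b Q X Y w)) = b₁ Q X Y (close Q X Y (fold Q w)) := by
    rw [← b_eq_close w hw]
    rfl
  -- The missing term c = w is b₁ of the grafted forest, which is minus the sum of the two groups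
  -- above.
  rw [h3, b₁_close hw (fold_mem_lenF w)]
  abel

end Free

namespace Free

open PTree

variable {Q : DGQuiver k}

/-! ## The free `A∞`-category is generated by `Q` -/

lemma grT_zero_eq_zero {X Y : Q.Ob} {e : ℤ} {z : T Q 0 X Y} (hz : z ∈ grT Q 0 X Y e)
    (he : e ≠ 0) : z = 0 := by
  simpa [grT, he] using hz

lemma one_mem (X : Q.Ob) : one Q X ∈ grT Q 0 X X 0 := by simp [grT]

/-- Used to split the inputs of a forest into those of its first tree and the others, with control
of degrees. -/
lemma grT_concat_induction {n : ℕ} : ∀ (m : ℕ) {X Z : Q.Ob} {d : ℤ}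
    (S : Submodule k (T Q (n + m) X Z)),
    (∀ Y a b e e', a ∈ grT Q m X Y e → b ∈ grT Q n Y Z e' → e + e' = d →
      concat Q m n X Y Z a b ∈ S) → grT Q (n + m) X Z d ≤ S
  | 0, X, Z, d, S, h => fun z hz => by
    have := h X (one Q X) z 0 d (one_mem X) hz (zero_add d)
    rwa [concat_one] at this
  | m + 1, X, Z, d, S, h => by
    refine grT_succ_le Q S fun V a e x y hx hy hd => ?_
    refine grT_concat_induction m (d := e) (S.comap (cons Q (n + m) X V Z x))
      (fun Y a' b e₁ e₂ ha hb he => ?_) hy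
    have := h Y (cons Q m X V Y x a') b (a + e₁) e₂ (cons_mem Q hx ha rfl) hb (by omega)
    rwa [concat_cons] at this

/-- All letters of `w` lie in `S`, with degrees that add up to `d`. -/
inductive LettersIn (S : ∀ X Y : Q.Ob, ℤ → Submodule k (Hom Q X Y)) :
    {X Y : Q.Ob} → Word (Hom Q) X Y → ℤ → Prop
  | nil (X : Q.Ob) : LettersIn S (.nil X) 0
  | cons {X Y Z : Q.Ob} {x : Hom Q X Y} {w : Word (Hom Q) Y Z} {a e : ℤ}
      (hx : x ∈ S X Y a) (hw : LettersIn S w e) : LettersIn S (.cons x w) (a + e)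

lemma size_le_of_mem {t : PTree} : ∀ {f : List PTree}, t ∈ f → t.size ≤ sizeF f
  | s :: f, h => by
    rw [sizeF]
    rcases List.mem_cons.1 h with rfl | h
    · omega
    · have := size_le_of_mem h
      omega

/-- Forest tensors are spanned by products of tree tensors. -/
lemma genF_mem_span (S : ∀ X Y : Q.Ob, ℤ → Submodule k (Hom Q X Y)) : ∀ (f : List PTree)
    (_ : ∀ t ∈ f, ∀ X Y e, ∀ y ∈ grT Q t.leaves X Y e, gen Q t t.leaves X Y y ∈ S X Y (e + t.size))
    (X Y : Q.Ob) (e : ℤ), ∀ y ∈ grT Q (leavesF f) X Y e, genF Q f X Y y ∈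
      Submodule.span k {z | ∃ w : Word (Hom Q) X Y, w.length = f.length ∧
        LettersIn S w (e + sizeF f) ∧ fold Q w = z}
  | [], _, X, Y, e, y, hy => by
    by_cases he : e = 0
    · subst he
      refine T_zero_induction Q (fun Y => (Submodule.span k {z | ∃ w : Word (Hom Q) X Y,
        w.length = 0 ∧ LettersIn S w (0 + sizeF []) ∧ fold Q w = z}).comap (genF Q [] X Y)) ?_ y
      exact Submodule.subset_span ⟨.nil X, rfl, .nil X, rfl⟩
    · have : y = 0 := grT_zero_eq_zero hy he
      rw [this, map_zero]
      exact Submodule.zero_mem _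
  | t :: f, h, X, Z, e, y, hy => by
    refine grT_concat_induction t.leaves ((Submodule.span k {z | ∃ w : Word (Hom Q) X Z,
      w.length = (t :: f).length ∧ LettersIn S w (e + sizeF (t :: f)) ∧ fold Q w = z}).comap
        (genF Q (t :: f) X Z)) (fun Y a b e₁ e₂ ha hb he => ?_) hy
    -- Applying the Koszul operator to b beforehand undoes the one in `mul`, its square being the
    -- identity. So the concatenation is a `mul` up to sign.
    have h1 := mul_gen Q t f X Y Z a (koszulT Q t.size (leavesF f) Y Z b)
    rw [koszulT_koszulT, koszulT_even Q ⟨_, rfl⟩] at h1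
    have h2 : genF Q (t :: f) X Z (concat Q t.leaves (leavesF f) X Y Z a b) =
        ((t.size * sizeF f : ℤ).negOnePow : ℤ) • mul Q X Y Z (gen Q t t.leaves X Y a)
          (genF Q f Y Z (koszulT Q t.size (leavesF f) Y Z b)) := by
      rw [h1, smul_smul, ← Units.val_mul, ← Int.negOnePow_add, Int.negOnePow_even _ ⟨_, rfl⟩,
        Units.val_one, one_smul]
    change genF Q (t :: f) X Z (concat Q t.leaves (leavesF f) X Y Z a b) ∈ Submodule.span k _
    rw [h2]
    refine zsmul_mem ?_ _
    have ih := genF_mem_span S f (fun t ht => h t (List.mem_cons_of_mem _ ht)) Y Z e₂ _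
      (koszulT_mem Q t.size _ _ _ _ b hb)
    have ht := h t List.mem_cons_self X Y e₁ a ha
    generalize genF Q f Y Z (koszulT Q t.size (leavesF f) Y Z b) = z at ih
    induction ih using Submodule.span_induction with
    | zero => rw [map_zero]; exact Submodule.zero_mem _
    | add x y _ _ hx hy => rw [map_add]; exact Submodule.add_mem _ hx hy
    | smul a x _ hx => rw [map_smul]; exact Submodule.smul_mem _ a hx
    | mem z hz =>
      obtain ⟨w, hw, hl, rfl⟩ := hz
      refine Submodule.subset_span ⟨.cons (gen Q t t.leaves X Y a) w, by simp [hw], ?_, rfl⟩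
      have := LettersIn.cons ht hl
      convert this using 1
      rw [← he, sizeF]
      push_cast
      ring

/-- A graded family of submodules which contains `Q` and is closed under the operations `b_n`,
`n ≥ 2`, contains the free `A∞`-category. -/
lemma grS_induction (S : ∀ X Y : Q.Ob, ℤ → Submodule k (Hom Q X Y))
    (h₁ : ∀ X Y e, ∀ x ∈ Q.sgr X Y e, incl Q X Y x ∈ S X Y e)
    (h₂ : ∀ X Y (w : Word (Hom Q) X Y) e, 2 ≤ w.length → LettersIn S w e →
      b Q X Y w ∈ S X Y (e + 1)) (X Y : Q.Ob) (e : ℤ) : grS Q X Y e ≤ S X Y e := by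
  have key : ∀ (n : ℕ) (t : PTree), t.size ≤ n → ∀ X Y e, ∀ y ∈ grT Q t.leaves X Y e,
      gen Q t t.leaves X Y y ∈ S X Y (e + t.size) := by
    intro n
    induction n with
    | zero =>
      intro t ht X Y e y hy
      match t, ht with
      | .leaf, _ =>
        refine grT_succ_le Q (n := 0) ((S X Y (e + (0 : ℕ))).comap (gen Q .leaf 1 X Y))
          (fun Z a e' x y hx hy hd => ?_) hy
        -- For the trivial tree, T¹ is spanned by x ⊗ y with y in T⁰, which is concentrated in
        -- degree 0 and spanned by units; these tensors come from `incl`.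
        by_cases he : e' = 0
        · subst he
          revert x
          refine fun x hx => T_zero_induction Q (fun Y => ((S X Y (e + (0 : ℕ))).comap
            (gen Q .leaf 1 X Y)).comap (cons Q 0 X Z Y x)) ?_ y
          have := h₁ X Z a x hx
          rw [← hd]
          simpa [incl] using this
        · rw [grT_zero_eq_zero hy he, map_zero]
          exact Submodule.zero_mem _
      | .node t₁ t₂ ts, ht => simp [size] at ht
    | succ n ih =>
      intro t ht X Y e y hy
      match t, ht, y, hy with
      | .leaf, _, y, hy => exact ih .leaf (by simp [size]) X Y e y hy
      | .node t₁ t₂ ts, ht, y, hy =>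
        have h := genF_mem_span S (t₁ :: t₂ :: ts) (fun t hm => ih t (by
          have := size_le_of_mem hm
          simp only [size, sizeF] at this ht
          omega)) X Y e y hy
        have h3 := close_genF (t₁ :: t₂ :: ts) (X := X) (Y := Y) y
        change gen Q (graft (t₁ :: t₂ :: ts)) (leavesF (t₁ :: t₂ :: ts)) X Y y ∈ _
        rw [← h3]
        generalize genF Q (t₁ :: t₂ :: ts) X Y y = z at h
        induction h using Submodule.span_induction with
        | zero => rw [map_zero]; exact Submodule.zero_mem _
        | add x y _ _ hx hy => rw [map_add]; exact Submodule.add_mem _ hx hy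
        | smul a x _ hx => rw [map_smul]; exact Submodule.smul_mem _ a hx
        | mem z hz =>
          obtain ⟨w, hw, hl, rfl⟩ := hz
          have h4 : 2 ≤ w.length := by simp [hw]
          rw [← b_eq_close w h4]
          have := h₂ X Y w _ h4 hl
          convert this using 2
          simp only [size, sizeF]
          push_cast
          ring
  rw [grS, Submodule.span_le]
  rintro _ ⟨t, e', y, hy, rfl, rfl⟩
  exact key _ t le_rfl X Y e' y hy

lemma LettersIn.hasDeg {S : ∀ X Y : Q.Ob, ℤ → Submodule k (Hom Q X Y)}
    (hS : ∀ X Y e, S X Y e ≤ grS Q X Y e) {X Y : Q.Ob} {w : Word (Hom Q) X Y} {e : ℤ}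
    (h : LettersIn S w e) : (quiver Q).HasDeg w e := by
  induction h with
  | nil X => exact .nil (A := quiver Q) X
  | cons hx hw ih => exact .cons (A := quiver Q) (by rw [quiver_sgr]; exact hS _ _ _ hx) ih

/-- All letters of `w` lie in `S`. -/
def AllIn (S : ∀ X Y : Q.Ob, Set (Hom Q X Y)) : {X Y : Q.Ob} → Word (Hom Q) X Y → Prop
  | _, _, .nil _ => True
  | _, _, .cons x w => x ∈ S _ _ ∧ AllIn S w

lemma LettersIn.allIn {S : ∀ X Y : Q.Ob, Submodule k (Hom Q X Y)} {X Y : Q.Ob}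
    {w : Word (Hom Q) X Y} {e : ℤ} (h : LettersIn (fun X Y _ => S X Y) w e) :
    AllIn (fun X Y => S X Y) w := by
  induction h with
  | nil X => trivial
  | cons hx hw ih => exact ⟨hx, ih⟩

lemma AllIn.of_append {S : ∀ X Y : Q.Ob, Set (Hom Q X Y)} : ∀ {X Y Z : Q.Ob}
    {v : Word (Hom Q) X Y} {w : Word (Hom Q) Y Z}, AllIn S (v.append w) → AllIn S v ∧ AllIn S w
  | _, _, _, .nil _, _, h => ⟨trivial, h⟩
  | _, _, _, .cons _ _, _, h => ⟨⟨h.1, (AllIn.of_append h.2).1⟩, (AllIn.of_append h.2).2⟩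

/-- A family of submodules which contains `Q` and is closed under the operations `b_n`,
`n ≥ 2`, contains the free `A∞`-category. -/
lemma hom_induction (S : ∀ X Y : Q.Ob, Submodule k (Hom Q X Y))
    (h₁ : ∀ X Y x, incl Q X Y x ∈ S X Y)
    (h₂ : ∀ X Y (w : Word (Hom Q) X Y), 2 ≤ w.length → AllIn (fun X Y => S X Y) w →
      b Q X Y w ∈ S X Y)
    {X Y : Q.Ob} (x : Hom Q X Y) : x ∈ S X Y := by
  have h : ⨆ e, grS Q X Y e ≤ S X Y := iSup_le fun e =>
    grS_induction (fun X Y _ => S X Y) (fun X Y _ x _ => h₁ X Y x)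
      (fun X Y w _ hw hl => h₂ X Y w hw hl.allIn) X Y e
  rw [(grS_internal Q X Y).submodule_iSup_eq_top] at h
  exact h trivial

/-! ## The relations of the free `A∞`-category -/

/-- Only b₁b₁ = 0 is left, and it holds by generation. On sQ it is d² = 0. For closure under b_k,
b·(b·b) and (b·b)·b agree by `ins_ins`. The side that applies b·b to subwords of w vanishes, by
assumption on letters and by `ins_b_b_of_two_le` on longer subwords; on the other side all terms but
b_k b₁ b₁ apply b·b to words of length at least two. -/
lemma ins_b_b {X Y : Q.Ob} (w : Word (Hom Q) X Y) :
    (FQ Q).ins 1 (FQ Q).b w ((FQ Q).b X Y) = 0 := by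
  have hm : ∀ X Y, MLin k fun v : Word (FQ Q).Hom X Y => (FQ Q).ins 1 (FQ Q).b v ((FQ Q).b X Y) :=
    fun X Y => GrQuiver.mlin_ins (fun X Y => (FQ Q).mlin_b X Y) ((FQ Q).mlin_b X Y)
  have hl : ∀ X Y, IsLinearMap k fun x : Hom Q X Y =>
    (FQ Q).ins 1 (FQ Q).b (.single x) ((FQ Q).b X Y) := fun X Y => (hm X Y).isLinear (.nil X) (.nil Y)
  have key : ∀ {X Y : Q.Ob} (x : Hom Q X Y),
      (FQ Q).ins 1 (FQ Q).b (.single x) ((FQ Q).b X Y) = 0 := by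
    intro X Y x
    refine hom_induction (fun X Y => LinearMap.ker (IsLinearMap.mk' _ (hl X Y)))
      (fun X Y x => ?_) (fun X Y w hw hS => ?_) x
    · change (FQ Q).b X Y (.single ((FQ Q).b X Y (.single (incl Q X Y x)))) + 0 = 0
      rw [b_incl, b_incl, Q.diff_diff, map_zero, add_zero]
    · change (FQ Q).ins 1 (FQ Q).b (.single ((FQ Q).b X Y w)) ((FQ Q).b X Y) = 0
      have h1 := (FQ Q).ins_ins w ((FQ Q).mlin_b X Y)
      have h2 : (FQ Q).ins 2 (fun X Y v => (FQ Q).ins 1 (FQ Q).b v ((FQ Q).b X Y)) w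
          ((FQ Q).b X Y) = 0 := by
        refine GrQuiver.ins_eq_zero _ _ _ _ fun Y₁ Y₂ l c s hc hlcs => ?_
        have h3 : (FQ Q).ins 1 (FQ Q).b c ((FQ Q).b Y₁ Y₂) = 0 := by
          subst hlcs
          have h4 := hS.of_append.2.of_append.1
          match c, hc with
          | .cons x (.nil _), _ => exact h4.1
          | .cons x (.cons y c), _ => exact ins_b_b_of_two_le _ (by simp)
        rw [h3]
        exact (((FQ Q).mlin_b X Y).isLinear l _).map_zero
      rw [h2, ← (FQ Q).innerSum_eq_ins (N := (FQ Q).Hom)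
        (r := fun X Y z => (FQ Q).ins 1 (FQ Q).b z ((FQ Q).b X Y)) (hm X Y), innerSum_eq_add] at h1
      have h3 : innerSumPos (FQ Q) (N := (FQ Q).Hom)
          (fun X Y z => (FQ Q).ins 1 (FQ Q).b z ((FQ Q).b X Y)) w = 0 := by
        rw [innerSumPos_eq_sumCuts]
        refine (Word.sumCuts_congr' w fun _ l s => ?_).trans (Word.sumCuts_zero w)
        refine (Word.sumCuts_congr' s fun _ c q => ?_).trans (Word.sumCuts_zero s)
        have hk := (FQ Q).length_koszulW 1 q
        split_ifs with h
        · exact ins_b_b_of_two_le _ (by rw [Word.length_append, Word.length_cons]; omega)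
        · rfl
      rwa [h3, zero_add] at h1
  match w with
  | .nil _ => rfl
  | .cons x (.nil _) => exact key x
  | .cons x (.cons y w) => exact ins_b_b_of_two_le _ (by simp)

end Free

namespace Free

open PTree

variable {Q : DGQuiver k} {M : Type u} [AddCommGroup M] [Module k M]

/-! ## Linear maps on the free `A∞`-category with prescribed composites with `b_n`, `n ≥ 2` -/

lemma lift_add {n : ℕ} {X Y : Q.Ob} (φ φ' : ∀ Z, Q.Hom X Z →ₗ[k] T Q n Z Y →ₗ[k] M) :
    lift Q (φ + φ') = lift Q φ + lift Q φ' :=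
  LinearMap.ext fun z => T_succ_induction Q (LinearMap.eqLocus (lift Q (φ + φ'))
    (lift Q φ + lift Q φ')) (fun V x y => by
      rw [LinearMap.mem_eqLocus, LinearMap.add_apply, lift_cons, lift_cons, lift_cons]; rfl) z

lemma lift_smul {n : ℕ} {X Y : Q.Ob} (a : k) (φ : ∀ Z, Q.Hom X Z →ₗ[k] T Q n Z Y →ₗ[k] M) :
    lift Q (a • φ) = a • lift Q φ :=
  LinearMap.ext fun z => T_succ_induction Q (LinearMap.eqLocus (lift Q (a • φ))
    (a • lift Q φ)) (fun V x y => by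
      rw [LinearMap.mem_eqLocus, LinearMap.smul_apply, lift_cons, lift_cons]; rfl) z

/-- The linear map on `T⁰(X,Y)` with a given value at `1_X`, if `X = Y`. -/
noncomputable def liftZero {X Y : Q.Ob} {N : Type*} [AddCommGroup N] [Module k N] (c : X = Y → N) :
    T Q 0 X Y →ₗ[k] N :=
  (Finsupp.lsum k fun h => LinearMap.toSpanSingleton k N (c h.down) :
    (PLift (X = Y) →₀ k) →ₗ[k] N)

@[simp] lemma liftZero_one {X : Q.Ob} {N : Type*} [AddCommGroup N] [Module k N] (c : X = X → N) :
    liftZero c (one Q X) = c rfl := by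
  rw [liftZero, one]
  erw [Finsupp.lsum_single]
  simp

/-- The linear map on `T^{m+n}` with given composites with concatenation. -/
noncomputable def unc : ∀ (m n : ℕ) (X Z : Q.Ob),
    (∀ Y, T Q m X Y →ₗ[k] T Q n Y Z →ₗ[k] M) →ₗ[k] (T Q (n + m) X Z →ₗ[k] M)
  | 0, _, X, _ => (LinearMap.applyₗ (one Q X)) ∘ₗ LinearMap.proj X
  | m + 1, n, X, Z =>
    { toFun φ := lift Q fun V => unc m n V Z ∘ₗ LinearMap.pi fun Y => (cons Q m X V Y).compr₂ (φ Y)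
      map_add' φ φ' := by
        rw [← lift_add]
        congr 1
        funext V
        exact LinearMap.ext fun x => (unc m n V Z).map_add
          (fun Y => (cons Q m X V Y).compr₂ (φ Y) x) fun Y => (cons Q m X V Y).compr₂ (φ' Y) x
      map_smul' a φ := by
        rw [RingHom.id_apply, ← lift_smul]
        congr 1
        funext V
        exact LinearMap.ext fun x => (unc m n V Z).map_smul a
          fun Y => (cons Q m X V Y).compr₂ (φ Y) x }

lemma unc_concat : ∀ (m n : ℕ) {X Z : Q.Ob} (φ : ∀ Y, T Q m X Y →ₗ[k] T Q n Y Z →ₗ[k] M) {Y : Q.Ob}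
    (a : T Q m X Y) (b : T Q n Y Z), unc m n X Z φ (concat Q m n X Y Z a b) = φ Y a b
  | 0, n, X, Z, φ, Y, a, b => by
    refine concat_eq_of_one Q (fun Y => (concat Q 0 n X Y Z).compr₂ (unc 0 n X Z φ)) φ
      (fun b => ?_) a b
    change unc 0 n X Z φ (concat Q 0 n X X Z (one Q X) b) = _
    rw [concat_one]
    rfl
  | m + 1, n, X, Z, φ, Y, a, b => by
    refine concat_eq_of_cons Q ((concat Q (m + 1) n X Y Z).compr₂ (unc (m + 1) n X Z φ)) (φ Y)
      (fun V x a b => ?_) a b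
    change unc (m + 1) n X Z φ (concat Q (m + 1) n X Y Z (cons Q m X V Y x a) b) = _
    rw [concat_cons]
    exact (lift_cons Q _ V x _).trans (unc_concat m n _ a b)

variable (Q M) in
/-- The module of multilinear functions on the words from `X` to `Y`. -/
def mlinSub (X Y : Q.Ob) : Submodule k (Word (Hom Q) X Y → M) where
  carrier := {ρ | MLin k ρ}
  add_mem' h h' := h.add h'
  zero_mem' := MLin.zero
  smul_mem' a _ h := h.comp (φ := fun x => a • x) (LinearMap.lsmul k M a).isLinear

/-- Inserting a first letter. -/
noncomputable def shift (X Y Z : Q.Ob) : Hom Q X Y →ₗ[k] mlinSub Q M X Z →ₗ[k] mlinSub Q M Y Z :=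
  LinearMap.mk₂ k (fun x ρ => ⟨fun w => ρ.1 (.cons x w), ρ.2.cons_left x⟩)
    (fun x y ρ => Subtype.ext <| funext fun w => (ρ.2.head w).map_add x y)
    (fun a x ρ => Subtype.ext <| funext fun w => (ρ.2.head w).map_smul a x)
    (fun _ _ _ => rfl) (fun _ _ _ => rfl)

/-- The linear map on forest tensors which corresponds to a multilinear function on words. -/
noncomputable def evalF : ∀ (f : List PTree) (X Z : Q.Ob),
    mlinSub Q M X Z →ₗ[k] (T Q (leavesF f) X Z →ₗ[k] M)
  | [], X, Z =>
    (liftZero fun h : X = Z => LinearMap.proj (h ▸ .nil X) ∘ₗ (mlinSub Q M X Z).subtype).flip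
  | t :: f, X, Z => unc t.leaves (leavesF f) X Z ∘ₗ LinearMap.pi fun Y => LinearMap.flip <|
      ((shift X Y Z).comp (gen Q t t.leaves X Y)).compr₂ <|
        ((t.size * sizeF f : ℤ).negOnePow : ℤ) •
          (LinearMap.lcomp k M (koszulT Q t.size (leavesF f) Y Z) ∘ₗ evalF f Y Z)

lemma evalF_nil {X : Q.Ob} (ρ : mlinSub Q M X X) : evalF [] X X ρ (one Q X) = ρ.1 (.nil X) := by
  exact LinearMap.congr_fun (liftZero_one _) ρ

lemma evalF_cons (t : PTree) (f : List PTree) {X Y Z : Q.Ob} (ρ : mlinSub Q M X Z)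
    (a : T Q t.leaves X Y) (b : T Q (leavesF f) Y Z) :
    evalF (t :: f) X Z ρ (concat Q t.leaves (leavesF f) X Y Z a b) =
      ((t.size * sizeF f : ℤ).negOnePow : ℤ) •
        evalF f Y Z (shift X Y Z (gen Q t t.leaves X Y a) ρ) (koszulT Q t.size (leavesF f) Y Z b) :=
  unc_concat t.leaves (leavesF f) _ a b

/-- The sign and the Koszul operator of `mul` are repeated in `evalF`, so each occurs twice and
cancels. -/
lemma liftF_mul {X Y Z : Q.Ob} (ρ : mlinSub Q M X Z) (x : Hom Q X Y) (F : FHom Q Y Z) :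
    liftF (fun f => evalF f X Z ρ) (mul Q X Y Z x F) =
      liftF (fun f => evalF f Y Z (shift X Y Z x ρ)) F := by
  refine fhom_gen_induction (LinearMap.eqLocus (liftF (fun f => evalF f X Z ρ) ∘ₗ mul Q X Y Z x)
    (liftF fun f => evalF f Y Z (shift X Y Z x ρ))) (fun f b => ?_) F
  change liftF (fun f => evalF f X Z ρ) (mul Q X Y Z x (genF Q f Y Z b)) =
      liftF (fun f => evalF f Y Z (shift X Y Z x ρ)) (genF Q f Y Z b)
  rw [liftF_genF]
  refine hom_gen_induction (LinearMap.eqLocus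
    (liftF (fun f => evalF f X Z ρ) ∘ₗ (mul Q X Y Z).flip (genF Q f Y Z b))
    (LinearMap.applyₗ b ∘ₗ evalF f Y Z ∘ₗ (shift X Y Z).flip ρ)) (fun t a => ?_) x
  change liftF (fun f => evalF f X Z ρ) (mul Q X Y Z (gen Q t t.leaves X Y a) (genF Q f Y Z b)) =
    evalF f Y Z (shift X Y Z (gen Q t t.leaves X Y a) ρ) b
  rw [mul_gen, map_zsmul]
  refine (congrArg _ ((liftF_genF _ (t :: f) _).trans (evalF_cons t f ρ a _))).trans ?_
  rw [smul_smul, ← Units.val_mul, ← Int.negOnePow_add, Int.negOnePow_even _ ⟨_, rfl⟩,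
        Units.val_one, one_smul, koszulT_koszulT, koszulT_even Q ⟨_, rfl⟩]

/-- Every multilinear function on words factors through `fold`: forest tensors are the tensor
products of the modules of letters. -/
lemma liftF_fold {X Y : Q.Ob} (w : Word (Hom Q) X Y) (ρ : mlinSub Q M X Y) :
    liftF (fun f => evalF f X Y ρ) (fold Q w) = ρ.1 w := by
  induction w with
  | nil X => exact (liftF_genF _ [] _).trans (evalF_nil ρ)
  | cons x w ih => rw [fold, liftF_mul, ih]; rfl

/-- The restriction of `homLift` to the summand of a tree. -/
noncomputable def evalTree {X Y : Q.Ob} (l : Q.Hom X Y →ₗ[k] M) (ρ : mlinSub Q M X Y) :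
    ∀ t : PTree, T Q t.leaves X Y →ₗ[k] M
  | .leaf => lift Q (n := 0) fun V => (liftZero fun h : V = Y => (h ▸ l : Q.Hom X V →ₗ[k] M)).flip
  | .node t₁ t₂ ts => evalF (t₁ :: t₂ :: ts) X Y ρ

/-- The linear map on `sFQ(X,Y)` with the given restriction to `sQ` and with the given composites
with `b_n`, `n ≥ 2`. -/
noncomputable def homLift {X Y : Q.Ob} (l : Q.Hom X Y →ₗ[k] M) (ρ : mlinSub Q M X Y) :
    Hom Q X Y →ₗ[k] M :=
  open Classical in DirectSum.toModule k PTree M (evalTree l ρ)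

lemma homLift_gen {X Y : Q.Ob} (l : Q.Hom X Y →ₗ[k] M) (ρ : mlinSub Q M X Y) (t : PTree)
    (y : T Q t.leaves X Y) : homLift l ρ (gen Q t t.leaves X Y y) = evalTree l ρ t y := by
  classical
  rw [gen_self, homLift]
  erw [DirectSum.toModule_lof]

lemma homLift_incl {X Y : Q.Ob} (l : Q.Hom X Y →ₗ[k] M) (ρ : mlinSub Q M X Y) (x : Q.Hom X Y) :
    homLift l ρ (incl Q X Y x) = l x := by
  refine (homLift_gen l ρ .leaf (cons Q 0 X Y Y x (one Q Y))).trans ?_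
  refine (lift_cons Q _ Y x (one Q Y)).trans ?_
  exact LinearMap.congr_fun (liftZero_one _) x

/-- For at least two letters b is `close` after `fold`, and `close` sends the summand of a forest to
the summand of the tree grafted from it. On that summand `homLift` was defined by `evalF`. -/
lemma homLift_b {X Y : Q.Ob} (l : Q.Hom X Y →ₗ[k] M) (ρ : mlinSub Q M X Y)
    {w : Word (Hom Q) X Y} (hw : 2 ≤ w.length) : homLift l ρ (b Q X Y w) = ρ.1 w := by
  rw [b_eq_close w hw, ← liftF_fold w ρ]
  refine lenF_induction (LinearMap.eqLocus (homLift l ρ ∘ₗ close Q X Y)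
    (liftF fun f => evalF f X Y ρ)) (fun f y hf => ?_) (fold_mem_lenF w)
  change homLift l ρ (close Q X Y (genF Q f X Y y)) = liftF (fun f => evalF f X Y ρ) (genF Q f X Y y)
  rw [liftF_genF, close_genF]
  match f, hf, y with
  | [], hf, y => simp at hf; omega
  | [_], hf, y => simp at hf; omega
  | t₁ :: t₂ :: ts, hf, y => exact homLift_gen l ρ (.node t₁ t₂ ts) y

/-- `grS_induction` asks for a family over all pairs of objects; the condition is imposed at the
given pair only and is void elsewhere. The intersection with `grS` makes the degrees of the letters
available in the inductive step. -/
lemma homLift_mem {X Y : Q.Ob} (l : Q.Hom X Y →ₗ[k] M) (ρ : mlinSub Q M X Y)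
    (S : ℤ → Submodule k M) (hl : ∀ e, ∀ x ∈ Q.sgr X Y e, l x ∈ S e)
    (hρ : ∀ w e, (quiver Q).HasDeg w e → ρ.1 w ∈ S (e + 1)) (e : ℤ) {x : Hom Q X Y}
    (hx : x ∈ grS Q X Y e) : homLift l ρ x ∈ S e := by
  classical
  have h := grS_induction (Q := Q) (fun X' Y' e => grS Q X' Y' e ⊓
    if h : X' = X ∧ Y' = Y then (S e).comap (homLift (h.1 ▸ h.2 ▸ l) (h.1 ▸ h.2 ▸ ρ)) else ⊤)
    ?_ ?_ X Y e hx
  · have := h.2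
    simpa using this
  · intro X' Y' e z hz
    have hi := incl_mem Q hz
    refine ⟨by rw [← quiver_sgr]; exact hi, ?_⟩
    split_ifs with h
    · obtain ⟨rfl, rfl⟩ := h
      change homLift l ρ _ ∈ S e
      rw [homLift_incl]
      exact hl e z hz
    · trivial
  · intro X' Y' w e hw hd
    have hd' := hd.hasDeg fun _ _ _ => inf_le_left
    refine ⟨b_mem Q w e hd', ?_⟩
    split_ifs with h
    · obtain ⟨rfl, rfl⟩ := h
      change homLift l ρ _ ∈ S (e + 1)
      rw [homLift_b l ρ hw]
      exact hρ w e hd'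
    · trivial

end Free

namespace Free

open Filter

variable {Q : DGQuiver k} {A : OpQuiver k} {φ ψ : AInfFunctor (FQ Q) A} {d : ℤ}

/-! ## The recurrent formula -/

/-- This makes the recurrent formula a genuine recursion. In `sandwich`, r is applied to subwords of
w, so its component of length one only sees letters of w; in `innerSumPos`, r is applied to words
with an outer letter besides the inserted one, so that component does not occur. -/
lemma sandwich_innerSumPos_congr {r r' : ∀ X Y : Q.Ob, Word (Hom Q) X Y → A.Hom (φ.obj X) (ψ.obj Y)}
    (h : ∀ X Y w, w.length ≠ 1 → r X Y w = r' X Y w) {X Y : Q.Ob} {w : Word (Hom Q) X Y}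
    (hw : AllIn (fun X Y => {x | r X Y (.single x) = r' X Y (.single x)}) w) :
    sandwich φ ψ d r w = sandwich φ ψ d r' w ∧
      innerSumPos (FQ Q) (N := fun X Y => A.Hom (φ.obj X) (ψ.obj Y)) r w =
        innerSumPos (FQ Q) (N := fun X Y => A.Hom (φ.obj X) (ψ.obj Y)) r' w := by
  constructor
  · refine (Word.sum_map_cuts₃ w fun _ _ l c s => (l.blocks.map fun β =>
      (((FQ Q).koszulW d s).blocks.map fun γ => A.b _ _ ((β.map φ.obj φ.f).append
        (.cons (r _ _ c) (γ.map ψ.obj ψ.f)))).sum).sum).trans (Eq.trans ?_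
      (Word.sum_map_cuts₃ w fun _ _ l c s => (l.blocks.map fun β =>
      (((FQ Q).koszulW d s).blocks.map fun γ => A.b _ _ ((β.map φ.obj φ.f).append
        (.cons (r' _ _ c) (γ.map ψ.obj ψ.f)))).sum).sum).symm)
    refine Word.sumCuts_congr w fun _ l s hls => Word.sumCuts_congr s fun _ c q hcq => ?_
    have h1 : r _ _ c = r' _ _ c := by
      subst hls hcq
      have h2 := hw.of_append.2.of_append.1
      match c, h2 with
      | .nil _, _ => exact h _ _ _ (by simp)
      | .cons x (.nil _), h2 => exact h2.1
      | .cons x (.cons y c), _ => exact h _ _ _ (by simp)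
    rw [h1]
  · rw [innerSumPos_eq_sumCuts, innerSumPos_eq_sumCuts]
    refine Word.sumCuts_congr' w fun _ l s => Word.sumCuts_congr' s fun _ c q => ?_
    have hk := (FQ Q).length_koszulW 1 q
    split_ifs with h0
    · exact h _ _ _ (by rw [Word.length_append, Word.length_cons]; omega)
    · rfl

lemma isLinear_single {r : ∀ X Y : Q.Ob, Word (Hom Q) X Y → A.Hom (φ.obj X) (ψ.obj Y)}
    (hr : IsMultilinear k (N := fun X Y => A.Hom (φ.obj X) (ψ.obj Y)) r) (X Y : Q.Ob) :
    IsLinearMap k fun x : Hom Q X Y => r X Y (.single x) :=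
  (hr.mlin (N := fun X Y => A.Hom (φ.obj X) (ψ.obj Y)) X Y).isLinear (.nil X) (.nil Y)

variable (φ ψ d) in
/-- The right hand side of the recurrent formula, with `e` in place of `(pd)u`. -/
noncomputable def recRhs (e r : ∀ X Y : Q.Ob, Word (Hom Q) X Y → A.Hom (φ.obj X) (ψ.obj Y))
    {X Y : Q.Ob} (w : Word (Hom Q) X Y) : A.Hom (φ.obj X) (ψ.obj Y) :=
  -e X Y w + sandwich φ ψ d r w - (d.negOnePow : ℤ) •
    innerSumPos (FQ Q) (N := fun X Y => A.Hom (φ.obj X) (ψ.obj Y)) r w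

/-- Hence the recurrent formula at w says that e and rB₁ agree at w, and multilinearity and degree
of its right hand side are inherited from B₁. -/
lemma recRhs_eq (e r : ∀ X Y : Q.Ob, Word (Hom Q) X Y → A.Hom (φ.obj X) (ψ.obj Y))
    {X Y : Q.Ob} (w : Word (Hom Q) X Y) : recRhs φ ψ d e r w =
      B₁ φ ψ d r X Y w - e X Y w + (d.negOnePow : ℤ) • r X Y (.single (b Q X Y w)) := by
  have h := innerSum_eq_add (A := FQ Q) (N := fun X Y => A.Hom (φ.obj X) (ψ.obj Y)) r w
  rw [recRhs, B₁, h, smul_add]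
  abel

lemma negOnePow_smul_smul {M : Type*} [AddCommGroup M] (d : ℤ) (x : M) :
    (d.negOnePow : ℤ) • (d.negOnePow : ℤ) • x = x := by
  rw [smul_smul, ← Units.val_mul, ← Int.negOnePow_add, Int.negOnePow_even _ ⟨_, rfl⟩,
    Units.val_one, one_smul]

/-- A solution of the recurrent formula is determined by its restriction to `Q` and by its
components of length different from one. -/
lemma eq_of_recurrence {e r r' : ∀ X Y : Q.Ob, Word (Hom Q) X Y → A.Hom (φ.obj X) (ψ.obj Y)}
    (hr : r ∈ Trans φ ψ d) (hr' : r' ∈ Trans φ ψ d)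
    (h : ∀ X Y w, w.length ≠ 1 → r X Y w = r' X Y w)
    (hi : ∀ X Y x, r X Y (.single (incl Q X Y x)) = r' X Y (.single (incl Q X Y x)))
    (he : ∀ X Y w, 2 ≤ w.length →
      (d.negOnePow : ℤ) • r X Y (.single (b Q X Y w)) = recRhs φ ψ d e r w)
    (he' : ∀ X Y w, 2 ≤ w.length →
      (d.negOnePow : ℤ) • r' X Y (.single (b Q X Y w)) = recRhs φ ψ d e r' w) : r = r' := by
  have key : ∀ {X Y : Q.Ob} (x : Hom Q X Y), r X Y (.single x) = r' X Y (.single x) := fun x =>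
    hom_induction (fun X Y => LinearMap.eqLocus (IsLinearMap.mk' _ (isLinear_single hr.1 X Y))
      (IsLinearMap.mk' _ (isLinear_single hr'.1 X Y))) hi (fun X Y w hw hS => by
        obtain ⟨h1, h2⟩ := sandwich_innerSumPos_congr (d := d) h hS
        have h3 := (he X Y w hw).trans (Eq.trans (by rw [recRhs, recRhs, h1, h2])
          (he' X Y w hw).symm)
        have h4 := congrArg ((d.negOnePow : ℤ) • ·) h3
        simp only [negOnePow_smul_smul] at h4
        exact h4) x
  funext X Y w
  by_cases hw : w.length = 1
  · match w, hw with
    | .cons x (.nil _), _ => exact key x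
  · exact h X Y w hw

/-- The system of maps with the component of length one replaced. -/
def setOne (c : ∀ X Y : Q.Ob, Word (Hom Q) X Y → A.Hom (φ.obj X) (ψ.obj Y))
    (L : ∀ X Y : Q.Ob, Hom Q X Y → A.Hom (φ.obj X) (ψ.obj Y)) :
    ∀ X Y : Q.Ob, Word (Hom Q) X Y → A.Hom (φ.obj X) (ψ.obj Y)
  | _, _, .nil X => c X X (.nil X)
  | _, _, .cons x (.nil _) => L _ _ x
  | _, _, .cons x (.cons y w) => c _ _ (.cons x (.cons y w))

lemma setOne_of_length_ne_one (c : ∀ X Y : Q.Ob, Word (Hom Q) X Y → A.Hom (φ.obj X) (ψ.obj Y))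
    (L : ∀ X Y : Q.Ob, Hom Q X Y → A.Hom (φ.obj X) (ψ.obj Y)) {X Y : Q.Ob} {w : Word (Hom Q) X Y}
    (hw : w.length ≠ 1) : setOne c L X Y w = c X Y w := by
  match w, hw with
  | .nil _, _ => rfl
  | .cons x (.cons y w), _ => rfl
  | .cons x (.nil _), hw => simp at hw

lemma setOne_mem {c : ∀ X Y : Q.Ob, Word (Hom Q) X Y → A.Hom (φ.obj X) (ψ.obj Y)}
    (hc : c ∈ Trans φ ψ d) {L : ∀ X Y : Q.Ob, Hom Q X Y → A.Hom (φ.obj X) (ψ.obj Y)}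
    (hL : ∀ X Y, IsLinearMap k (L X Y))
    (hL' : ∀ X Y e, ∀ x ∈ grS Q X Y e, L X Y x ∈ A.sgr (φ.obj X) (ψ.obj Y) (e + d)) :
    setOne c L ∈ Trans φ ψ d := by
  refine ⟨isMultilinear_of_mlin (N := fun X Y => A.Hom (φ.obj X) (ψ.obj Y)) fun X W =>
    ⟨fun p q => ?_⟩, fun X Y w e hw => ?_⟩
  · by_cases h : p.length + q.length = 0
    · cases p with
      | nil =>
        cases q with
        | nil => exact hL _ _
        | cons => simp at h
      | cons => simp at h
    · have : (fun x => setOne c L X W (p.append (.cons x q))) =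
          fun x => c X W (p.append (.cons x q)) := funext fun x =>
        setOne_of_length_ne_one c L (by rw [Word.length_append, Word.length_cons]; omega)
      rw [this]
      exact (hc.1.mlin (N := fun X Y => A.Hom (φ.obj X) (ψ.obj Y)) X W).isLinear p q
  · by_cases h : w.length = 1
    · match w, h with
      | .cons x (.nil _), _ =>
        obtain ⟨a, e', hx, hn, rfl⟩ := hw.exists_eq
        obtain rfl := hn.eq_zero
        rw [add_zero]
        exact hL' _ _ a x ((quiver_sgr Q _ _ _) ▸ hx)
    · rw [setOne_of_length_ne_one c L h]
      exact hc.2 X Y w e hw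

-- Existence of solutions by successive approximation

section Iteration

variable {c e : ∀ X Y : Q.Ob, Word (Hom Q) X Y → A.Hom (φ.obj X) (ψ.obj Y)}
  (l : ∀ X Y, Q.Hom X Y →ₗ[k] A.Hom (φ.obj X) (ψ.obj Y))

lemma mlin_recRhs (he : e ∈ Trans φ ψ (d + 1)) {r : ∀ X Y : Q.Ob, Word (Hom Q) X Y →
    A.Hom (φ.obj X) (ψ.obj Y)} (hr : r ∈ Trans φ ψ d) (X Y : Q.Ob) :
    MLin k fun w : Word (Hom Q) X Y => (d.negOnePow : ℤ) • recRhs φ ψ d e r w := by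
  refine MLin.zsmul ?_ _
  rw [show recRhs φ ψ d e r = _ from funext fun w : Word (Hom Q) X Y => recRhs_eq e r w]
  refine (((B₁_mem hr).1.mlin (N := fun X Y => A.Hom (φ.obj X) (ψ.obj Y)) X Y).sub
    (he.1.mlin (N := fun X Y => A.Hom (φ.obj X) (ψ.obj Y)) X Y)).add (MLin.zsmul ?_ _)
  exact ((FQ Q).mlin_b X Y).comp (isLinear_single hr.1 X Y)

lemma recRhs_mem (he : e ∈ Trans φ ψ (d + 1)) {r : ∀ X Y : Q.Ob, Word (Hom Q) X Y →
    A.Hom (φ.obj X) (ψ.obj Y)} (hr : r ∈ Trans φ ψ d) {X Y : Q.Ob} {w : Word (Hom Q) X Y} {i : ℤ}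
    (hw : (quiver Q).HasDeg w i) : recRhs φ ψ d e r w ∈ A.sgr (φ.obj X) (ψ.obj Y) (i + 1 + d) := by
  rw [recRhs_eq, show i + 1 + d = i + (d + 1) by ring]
  refine Submodule.add_mem _ (Submodule.sub_mem _ ((B₁_mem hr).2 _ _ w i hw) (he.2 _ _ w i hw))
    (zsmul_mem ?_ _)
  have h := hr.2 X Y (.single (b Q X Y w)) (i + 1 + 0)
    (.cons (A := quiver Q) ((FQ Q).b_degree w i hw) (.nil (A := quiver Q) Y))
  rwa [add_zero, show i + 1 + d = i + (d + 1) by ring] at h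

open Classical in
variable (c e d) in
/-- Successive approximations of the component of length one of a solution. -/
noncomputable def approx : ℕ → ∀ X Y, Hom Q X Y →ₗ[k] A.Hom (φ.obj X) (ψ.obj Y)
  | 0, _, _ => 0
  | n + 1, X, Y => if h : MLin k fun w : Word (Hom Q) X Y => (d.negOnePow : ℤ) •
        recRhs φ ψ d e (setOne c fun X Y => approx n X Y) w then
      homLift (l X Y) ⟨_, h⟩ else 0

/-- Each approximation gives a transformation of degree d, so the multilinearity test in `approx`
always succeeds. -/
lemma setOne_approx_mem (hc : c ∈ Trans φ ψ d) (he : e ∈ Trans φ ψ (d + 1))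
    (hl : ∀ X Y i, ∀ x ∈ Q.sgr X Y i, l X Y x ∈ A.sgr (φ.obj X) (ψ.obj Y) (i + d)) (n : ℕ) :
    setOne c (fun X Y => approx d c e l n X Y) ∈ Trans φ ψ d := by
  refine setOne_mem hc (fun X Y => LinearMap.isLinear _) ?_
  induction n with
  | zero => exact fun X Y i x hx => Submodule.zero_mem _
  | succ n ih =>
    intro X Y i x hx
    have hn := setOne_mem hc (fun X Y => LinearMap.isLinear _) ih
    rw [approx, dif_pos (mlin_recRhs he hn X Y)]
    exact homLift_mem _ _ (fun i => A.sgr (φ.obj X) (ψ.obj Y) (i + d)) (hl X Y)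
      (fun w i hw => zsmul_mem (recRhs_mem he hn hw) _) i hx

/-- Existence of solutions of the recurrent formula with given restriction to `Q` and given
components of length different from one. -/
lemma exists_recurrence (hc : c ∈ Trans φ ψ d) (he : e ∈ Trans φ ψ (d + 1))
    (hl : ∀ X Y i, ∀ x ∈ Q.sgr X Y i, l X Y x ∈ A.sgr (φ.obj X) (ψ.obj Y) (i + d)) :
    ∃ r ∈ Trans φ ψ d, (∀ X Y w, w.length ≠ 1 → r X Y w = c X Y w) ∧
      (∀ X Y x, r X Y (.single (incl Q X Y x)) = l X Y x) ∧
      ∀ X Y w, 2 ≤ w.length →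
        (d.negOnePow : ℤ) • r X Y (.single (b Q X Y w)) = recRhs φ ψ d e r w := by
  classical
  have hm := setOne_approx_mem l hc he hl
  have hs : ∀ n X Y, ∃ h, approx d c e l (n + 1) X Y = homLift (l X Y)
      ⟨fun w : Word (Hom Q) X Y => (d.negOnePow : ℤ) •
        recRhs φ ψ d e (setOne c fun X Y => approx d c e l n X Y) w, h⟩ := fun n X Y =>
    ⟨mlin_recRhs he (hm n) X Y, by rw [approx, dif_pos (mlin_recRhs he (hm n) X Y)]⟩
  have hi : ∀ n X Y x, approx d c e l (n + 1) X Y (incl Q X Y x) = l X Y x := fun n X Y x => by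
    obtain ⟨h, h'⟩ := hs n X Y
    rw [h', homLift_incl]
  have hb : ∀ n X Y (w : Word (Hom Q) X Y), 2 ≤ w.length →
      approx d c e l (n + 1) X Y (b Q X Y w) = (d.negOnePow : ℤ) •
        recRhs φ ψ d e (setOne c fun X Y => approx d c e l n X Y) w := fun n X Y w hw => by
    obtain ⟨h, h'⟩ := hs n X Y
    rw [h', homLift_b _ _ hw]
  -- The stationary value of the approximations at x. The default 0 turns out to be never taken, by
  -- `hconv`.
  let lim : ∀ X Y, Hom Q X Y → A.Hom (φ.obj X) (ψ.obj Y) := fun X Y x =>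
    if h : ∃ y, ∀ᶠ n in atTop, approx d c e l n X Y x = y then h.choose else 0
  have hlim : ∀ {X Y} {x : Hom Q X Y} (y), (∀ᶠ n in atTop, approx d c e l n X Y x = y) →
      ∀ᶠ n in atTop, approx d c e l n X Y x = lim X Y x := fun {X Y x} y hy => by
    have h : ∃ y, ∀ᶠ n in atTop, approx d c e l n X Y x = y := ⟨y, hy⟩
    simp only [lim, dif_pos h]
    exact h.choose_spec
  have hall : ∀ {X Y : Q.Ob} {w : Word (Hom Q) X Y}, AllIn (fun X Y =>
      {x | ∀ᶠ n in atTop, approx d c e l n X Y x = lim X Y x}) w →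
      ∀ᶠ n in atTop, AllIn (fun X Y => {x | setOne c (fun X Y => approx d c e l n X Y) X Y
        (.single x) = setOne c lim X Y (.single x)}) w := by
    intro X Y w hw
    induction w with
    | nil => exact Eventually.of_forall fun _ => trivial
    | cons x w ih => exact hw.1.and (ih hw.2)
  -- A word has finitely many letters, so from some N on the approximations are stationary on all of
  -- them. Approximation n + 1 at b(w) only reads approximation n on these letters, hence is
  -- stationary from N + 1 on.
  have hrec : ∀ {X Y : Q.Ob} {w : Word (Hom Q) X Y}, 2 ≤ w.length → AllIn (fun X Y =>
      {x | ∀ᶠ n in atTop, approx d c e l n X Y x = lim X Y x}) w →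
      ∀ᶠ n in atTop, approx d c e l n X Y (b Q X Y w) =
        (d.negOnePow : ℤ) • recRhs φ ψ d e (setOne c lim) w := by
    intro X Y w hw h
    obtain ⟨N, hN⟩ := eventually_atTop.1 (hall h)
    refine eventually_atTop.2 ⟨N + 1, fun n hn => ?_⟩
    obtain ⟨n, rfl⟩ : ∃ m, n = m + 1 := ⟨n - 1, by omega⟩
    obtain ⟨h1, h2⟩ := sandwich_innerSumPos_congr (d := d) (fun X Y w hw =>
      (setOne_of_length_ne_one c _ hw).trans (setOne_of_length_ne_one c lim hw).symm)
      (hN n (by omega))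
    rw [hb n X Y w hw, recRhs, recRhs, h1, h2]
  -- The elements at which the approximations become stationary form submodules. They contain sQ,
  -- where the values are constant from index 1 on, and are closed under b_k, k > 1, by `hrec`.
  have hconv : ∀ {X Y : Q.Ob} (x : Hom Q X Y),
      ∀ᶠ n in atTop, approx d c e l n X Y x = lim X Y x := fun x =>
    hom_induction (fun X Y =>
      { carrier := {x | ∀ᶠ n in atTop, approx d c e l n X Y x = lim X Y x}
        add_mem' := fun {x y} hx hy => hlim (lim X Y x + lim X Y y) <| by
          filter_upwards [hx, hy] with n h h'
          rw [map_add, h, h']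
        zero_mem' := hlim 0 (Eventually.of_forall fun n => map_zero _)
        smul_mem' := fun a x hx => hlim (a • lim X Y x) <| by
          filter_upwards [hx] with n h
          rw [map_smul, h] } : ∀ X Y, Submodule k (Hom Q X Y))
      (fun X Y x => hlim (l X Y x) (eventually_atTop.2 ⟨1, fun n hn => by
        obtain ⟨n, rfl⟩ : ∃ m, n = m + 1 := ⟨n - 1, by omega⟩
        exact hi n X Y x⟩)) (fun X Y w hw h => hlim _ (hrec hw h)) x
  have hconst : ∀ {N : Type u} {y z : N}, (∀ᶠ _ in (atTop : Filter ℕ), y = z) → y = z :=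
    fun h => eventually_const.1 h
  have hlin : ∀ X Y, IsLinearMap k (lim X Y) := fun X Y =>
    ⟨fun x y => hconst <| by
      filter_upwards [hconv x, hconv y, hconv (x + y)] with n h h' h''
      rw [← h, ← h', ← h'', map_add],
    fun a x => hconst <| by
      filter_upwards [hconv x, hconv (a • x)] with n h h'
      rw [← h, ← h', map_smul]⟩
  have hallIn : ∀ {X Y : Q.Ob} (w : Word (Hom Q) X Y), AllIn (fun X Y =>
      {x | ∀ᶠ n in atTop, approx d c e l n X Y x = lim X Y x}) w := by
    intro X Y w
    induction w with
    | nil => trivial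
    | cons x w ih => exact ⟨hconv x, ih⟩
  refine ⟨setOne c lim, setOne_mem hc hlin fun X Y i x hx => ?_,
    fun X Y w hw => setOne_of_length_ne_one c lim hw, fun X Y x => hconst ?_, fun X Y w hw => ?_⟩
  · obtain ⟨n, hn⟩ := (hconv x).exists
    rw [← hn]
    have := (hm n).2 X Y (.single x) (i + 0)
      (.cons (A := quiver Q) ((quiver_sgr Q X Y i).symm ▸ hx) (.nil (A := quiver Q) Y))
    rwa [add_zero] at this
  · filter_upwards [hconv (incl Q X Y x), eventually_ge_atTop 1] with n h hn
    obtain ⟨n, rfl⟩ : ∃ m, n = m + 1 := ⟨n - 1, by omega⟩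
    rw [← hi n X Y x, h]
    rfl
  · have h : lim X Y (b Q X Y w) = (d.negOnePow : ℤ) • recRhs φ ψ d e (setOne c lim) w :=
      hconst <| by
        filter_upwards [hconv (b Q X Y w), hrec hw (hallIn w)] with n h h'
        rw [← h, h']
    change (d.negOnePow : ℤ) • lim X Y (b Q X Y w) = _
    rw [h, negOnePow_smul_smul]

end Iteration

end Free

/-! ## Linearity of the differential -/

section Linearity

variable {A B : OpQuiver k} (f g : AInfFunctor A B) (d : ℤ)

lemma isLinearMap_sandwich {X Y : A.Ob} (w : Word A.Hom X Y) :
    IsLinearMap k fun r : ∀ X Y, Word A.Hom X Y → B.Hom (f.obj X) (g.obj Y) =>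
      sandwich f g d r w :=
  isLinearMap_list_sum _ fun _ => isLinearMap_list_sum _ fun β => isLinearMap_list_sum _ fun γ =>
    isLinearMap_comp (f := fun x => B.b _ _ ((β.map f.obj f.f).append
      (.cons x (γ.map g.obj g.f)))) ((B.mlin_b _ _).isLinear _ _) ⟨fun _ _ => rfl, fun _ _ => rfl⟩

lemma isLinearMap_innerSum {N : A.Ob → A.Ob → Type u} [∀ X Y, AddCommGroup (N X Y)]
    [∀ X Y, Module k (N X Y)] {X Y : A.Ob} (w : Word A.Hom X Y) :
    IsLinearMap k fun r : ∀ X Y, Word A.Hom X Y → N X Y => innerSum A r w :=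
  isLinearMap_list_sum _ fun _ => ⟨fun _ _ => rfl, fun _ _ => rfl⟩

lemma isLinearMap_innerSumPos {N : A.Ob → A.Ob → Type u} [∀ X Y, AddCommGroup (N X Y)]
    [∀ X Y, Module k (N X Y)] {X Y : A.Ob} (w : Word A.Hom X Y) :
    IsLinearMap k fun r : ∀ X Y, Word A.Hom X Y → N X Y => innerSumPos A r w :=
  isLinearMap_list_sum _ fun _ => ⟨fun _ _ => rfl, fun _ _ => rfl⟩

lemma isLinearMap_B₁ {X Y : A.Ob} (w : Word A.Hom X Y) :
    IsLinearMap k fun r : ∀ X Y, Word A.Hom X Y → B.Hom (f.obj X) (g.obj Y) =>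
      B₁ f g d r X Y w :=
  (IsLinearMap.mk' _ (isLinearMap_sandwich f g d w) - (d.negOnePow : ℤ) •
    IsLinearMap.mk' _ (isLinearMap_innerSum (N := fun X Y => B.Hom (f.obj X) (g.obj Y)) w)).isLinear

/-- Joint linearity in e and r: when p varies, (pd)u and pu vary together, and sums and multiples of
solutions are again solutions. -/
lemma isLinearMap_recRhs {Q : DGQuiver k} {φ ψ : AInfFunctor (FQ Q) B} {X Y : Q.Ob}
    (w : Word (Free.Hom Q) X Y) :
    IsLinearMap k fun p : (∀ X Y : Q.Ob, Word (Free.Hom Q) X Y → B.Hom (φ.obj X) (ψ.obj Y)) ×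
      (∀ X Y : Q.Ob, Word (Free.Hom Q) X Y → B.Hom (φ.obj X) (ψ.obj Y)) =>
        Free.recRhs φ ψ d p.1 p.2 w := by
  have h1 := isLinearMap_sandwich φ ψ d w
  have h2 := isLinearMap_innerSumPos (A := FQ Q) (k := k)
    (N := fun X Y => B.Hom (φ.obj X) (ψ.obj Y)) w
  refine ⟨fun p q => ?_, fun a p => ?_⟩
  · simp only [Free.recRhs]
    rw [Prod.snd_add, h1.map_add, h2.map_add, smul_add, Prod.fst_add, Pi.add_apply, Pi.add_apply,
      Pi.add_apply]
    abel
  · simp only [Free.recRhs]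
    rw [Prod.smul_snd, h1.map_smul, h2.map_smul, smul_comm, Prod.smul_fst, Pi.smul_apply,
      Pi.smul_apply, Pi.smul_apply, smul_sub, smul_add, smul_neg]

end Linearity

/-! ## The differential on words with at most one letter -/

section Short

variable {A B : OpQuiver k} {f g : AInfFunctor A B} (d : ℤ)
  {r : ∀ X Y, Word A.Hom X Y → B.Hom (f.obj X) (g.obj Y)}

lemma B₁_nil (hr : IsMultilinear k (N := fun X Y => B.Hom (f.obj X) (g.obj Y)) r) (X : A.Ob) :
    B₁ f g d r X X (.nil X) = B.b _ _ (.single (r X X (.nil X))) := by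
  rw [B₁, A.innerSum_eq_ins (N := fun X Y => B.Hom (f.obj X) (g.obj Y)) (hr.mlin
    (N := fun X Y => B.Hom (f.obj X) (g.obj Y)) X X), GrQuiver.ins_nil, smul_zero, sub_zero]
  simp [sandwich, Word.cuts₃, Word.cuts, Word.blocks, Word.map, GrQuiver.koszulW, Word.mapHom,
    Word.single]

lemma B₁_single (hr : IsMultilinear k (N := fun X Y => B.Hom (f.obj X) (g.obj Y)) r) {X Y : A.Ob}
    (x : A.Hom X Y) :
    B₁ f g d r X Y (.single x) = B.b _ _ (.single (r X Y (.single x)))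
      + B.b _ _ (.cons (f.f X Y (.single x)) (.single (r Y Y (.nil Y))))
      + B.b _ _ (.cons (r X X (.nil X)) (.single (g.f X Y (.single (A.koszul d x)))))
      - (d.negOnePow : ℤ) • r X Y (.single (A.b X Y (.single x))) := by
  have h1 : A.ins 1 A.b (.single x) (r X Y) = r X Y (.single (A.b X Y (.single x))) := by
    rw [Word.single, GrQuiver.ins_cons, GrQuiver.ins_nil, add_zero]
    rfl
  rw [B₁, A.innerSum_eq_ins (N := fun X Y => B.Hom (f.obj X) (g.obj Y)) (hr.mlin
    (N := fun X Y => B.Hom (f.obj X) (g.obj Y)) X Y), h1]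
  congr 1
  simp only [sandwich, Word.cuts₃, Word.cuts, Word.blocks, Word.map, Word.append, GrQuiver.koszulW,
    Word.mapHom, Word.single, List.flatMap_cons, List.flatMap_nil, List.map_cons, List.map_nil,
    List.sum_cons, List.sum_nil, List.append_nil, List.nil_append, List.cons_append, add_zero]
  abel

end Short

lemma koszul_incl (Q : DGQuiver k) (d : ℤ) {X Y : Q.Ob} (x : Q.Hom X Y) :
    (FQ Q).koszul d (incl Q X Y x) = incl Q X Y (Q.koszul d x) :=
  Q.hom_induction (LinearMap.eqLocus ((FQ Q).koszul d ∘ₗ incl Q X Y) (incl Q X Y ∘ₗ Q.koszul d))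
    (fun e x hx => by
      rw [LinearMap.mem_eqLocus, LinearMap.comp_apply, LinearMap.comp_apply,
        (FQ Q).koszul_of_mem d (incl_mem Q hx), Q.koszul_of_mem d hx, map_zsmul]) x

-- Chain maps, the recurrent formula, and solutions for given data

section ChainMaps

variable {Q : DGQuiver k} {A : AInfCat k} {φ ψ : AInfFunctor (FQ Q) A.toOpQuiver}
  {P : CochainComplex (ModuleCat.{u} k) ℤ}

lemma ins_b_b_eq_zero (A : AInfCat k) {X Y : A.Ob} (w : Word A.Hom X Y) :
    A.ins 1 A.b w (A.b X Y) = 0 := by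
  rw [← A.innerSum_eq_ins (N := A.Hom) (A.mlin_b X Y), A.b_b]

lemma B₁_single_incl {d : ℤ} (r : Trans φ ψ d) {X Y : Q.Ob} (x : Q.Hom X Y) :
    B₁ φ ψ d r.1 X Y (.single (incl Q X Y x)) =
      A₁B₁_one φ.restr ψ.restr d (restrTrans φ ψ d r).1 X Y x := by
  rw [B₁_single d r.2.1, b_incl, koszul_incl]
  rfl

/-- By `recRhs_eq` the term with b_k and pu₁ occurs on both sides of the recurrent formula and
cancels. -/
lemma recurrence_iff (u : GMap P fun d => Trans φ ψ d) : Recurrence φ ψ P u ↔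
    ∀ (d : ℤ) (p : P.X d) (X Y : Q.Ob) (w : Word (FQ Q).Hom X Y), 1 < w.length →
      (u (d + 1) ((P.d d (d + 1)).hom p)).1 X Y w = B₁ φ ψ d (u d p).1 X Y w := by
  refine forall₅_congr fun d p X Y w => forall_congr' fun _ => ?_
  change _ = Free.recRhs φ ψ d (u (d + 1) ((P.d d (d + 1)).hom p)).1 (u d p).1 w ↔ _
  rw [Free.recRhs_eq]
  exact right_eq_add.trans (sub_eq_zero.trans eq_comm)

lemma IsChainMap.recurrence {u : GMap P fun d => Trans φ ψ d} (hu : IsChainMap φ ψ P u) :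
    Recurrence φ ψ P u :=
  (recurrence_iff u).2 fun d p X Y w _ => by rw [hu]

lemma IsChainMap.isChainMap₁ {u : GMap P fun d => Trans φ ψ d} (hu : IsChainMap φ ψ P u) :
    IsChainMap₁ (restrData φ ψ P u).1 := by
  refine fun d p => ⟨fun X => ?_, fun X Y x => ?_⟩
  · change (u (d + 1) ((P.d d (d + 1)).hom p)).1 X X (.nil X) = _
    rw [hu, B₁_nil d (u d p).2.1]
    rfl
  · change (u (d + 1) ((P.d d (d + 1)).hom p)).1 X Y (.single (incl Q X Y x)) = _
    rw [hu, B₁_single_incl]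
    rfl

/-- A solution of the recurrent formula is a chain map if its restriction to `Q` is. -/
lemma Recurrence.isChainMap {u : GMap P fun d => Trans φ ψ d} (hu : Recurrence φ ψ P u)
    (hu₁ : IsChainMap₁ (restrData φ ψ P u).1) : IsChainMap φ ψ P u := by
  rw [recurrence_iff] at hu
  intro d p
  have hne : ∀ X Y (w : Word (FQ Q).Hom X Y), w.length ≠ 1 →
      (u (d + 1) ((P.d d (d + 1)).hom p)).1 X Y w = B₁ φ ψ d (u d p).1 X Y w := by
    intro X Y w hw
    match w, hw with
    | .nil X, _ =>
      rw [B₁_nil d (u d p).2.1]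
      exact (hu₁ d p).1 X
    | .cons x (.cons y w), _ => exact hu d p X Y _ (by simp)
    | .cons x (.nil _), hw => simp at hw
  -- The defect Δ = (pd)u - (pu)B₁, to be shown to vanish. By `hne` only its component of length one
  -- is in question.
  have hD : ((u (d + 1) ((P.d d (d + 1)).hom p)).1 - B₁ φ ψ d (u d p).1) ∈ Trans φ ψ (d + 1) :=
    Submodule.sub_mem _ (u _ _).2 (B₁_mem (u d p).2)
  have hB : ∀ X Y (w : Word (FQ Q).Hom X Y), 1 < w.length → B₁ φ ψ (d + 1)
      ((u (d + 1) ((P.d d (d + 1)).hom p)).1 - B₁ φ ψ d (u d p).1) X Y w = 0 := by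
    intro X Y w hw
    refine ((isLinearMap_B₁ φ ψ (d + 1) w).map_sub _ _).trans ?_
    -- ΔB₁ = (pd)uB₁ because B₁B₁ = 0, and on words of length > 1 this is (pdd)u = 0 by the
    -- recurrent formula for pd.
    rw [B₁_B₁ (fun w => Free.ins_b_b w) (fun w => ins_b_b_eq_zero A w) (u d p).2, sub_zero,
      ← hu (d + 1) _ X Y w hw]
    have h0 : (P.d (d + 1) (d + 1 + 1)).hom ((P.d d (d + 1)).hom p) = 0 := by
      rw [← ModuleCat.comp_apply, P.d_comp_d]
      rfl
    rw [h0, map_zero]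
    rfl
  have key : ∀ {X Y : Q.Ob} (x : Free.Hom Q X Y),
      ((u (d + 1) ((P.d d (d + 1)).hom p)).1 - B₁ φ ψ d (u d p).1) X Y (.single x) = 0 := fun x =>
    Free.hom_induction (fun X Y => LinearMap.ker (IsLinearMap.mk' _
      (Free.isLinear_single hD.1 X Y))) (fun X Y x => by
        change (u (d + 1) ((P.d d (d + 1)).hom p)).1 X Y (.single (incl Q X Y x)) -
          B₁ φ ψ d (u d p).1 X Y (.single (incl Q X Y x)) = 0
        exact sub_eq_zero.2 (((hu₁ d p).2 X Y x).trans (B₁_single_incl (u d p) x).symm)) (fun X Y w hw hS => by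
        -- If Δ₁ vanishes on the letters of w, then Δ may be replaced by 0 in all terms of (ΔB₁)(w)
        -- but the one with Δ₁ at b(w); by `hB` this last term vanishes too.
        obtain ⟨h1, h2⟩ := Free.sandwich_innerSumPos_congr (d := d + 1) (r' := 0)
          (r := (u (d + 1) ((P.d d (d + 1)).hom p)).1 - B₁ φ ψ d (u d p).1)
          (fun X Y w hw => sub_eq_zero.2 (hne X Y w hw)) hS
        have h3 := hB X Y w hw
        rw [B₁, innerSum_eq_add (A := FQ Q) (N := fun X Y => A.Hom (φ.obj X) (ψ.obj Y)), h1, h2,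
          (isLinearMap_sandwich φ ψ (d + 1) w).map_zero,
          (isLinearMap_innerSumPos (A := FQ Q) (k := k)
            (N := fun X Y => A.Hom (φ.obj X) (ψ.obj Y)) w).map_zero, zero_add, zero_sub,
          neg_eq_zero] at h3
        have h4 := congrArg (((d + 1).negOnePow : ℤ) • ·) h3
        simp only [Free.negOnePow_smul_smul, smul_zero] at h4
        exact h4) x
  funext X Y w
  by_cases hw : w.length = 1
  · match w, hw with
    | .cons x (.nil _), _ => exact sub_eq_zero.1 (key x)
  · exact hne X Y w hw

/-- The components of length different from one of given data. -/
noncomputable def RestrData.comp (D : RestrData φ ψ P) (d : ℤ) (p : P.X d) :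
    ∀ X Y : Q.Ob, Word (Free.Hom Q) X Y → A.Hom (φ.obj X) (ψ.obj Y)
  | _, _, .nil X => (D.1 d p).1.1 X
  | _, _, .cons _ (.nil _) => 0
  | _, _, .cons x (.cons y w) =>
    (D.2 ⟨w.length + 1 + 1, by omega⟩ d p).1 _ _ ⟨.cons x (.cons y w), rfl⟩

lemma RestrData.comp_of_length (D : RestrData φ ψ P) (d : ℤ) (p : P.X d) {X Y : Q.Ob}
    (w : Word (Free.Hom Q) X Y) {n : ℕ} (hn : 1 < n) (hw : w.length = n) :
    D.comp d p X Y w = (D.2 ⟨n, hn⟩ d p).1 X Y ⟨w, hw⟩ := by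
  subst hw
  match w, hn with
  | .cons x (.cons y w), _ => rfl
  | .cons x (.nil _), hn => simp at hn
  | .nil _, hn => simp at hn

lemma RestrData.comp_mem (D : RestrData φ ψ P) (d : ℤ) (p : P.X d) :
    D.comp d p ∈ Trans φ ψ d := by
  refine ⟨isMultilinear_of_mlin (N := fun X Y => A.Hom (φ.obj X) (ψ.obj Y)) fun X W =>
    ⟨fun {Y Z : Q.Ob} a b => ?_⟩, fun X Y w e hw => ?_⟩
  · by_cases h : a.length + b.length = 0
    · cases a with
      | nil =>
        cases b with
        | nil => exact ⟨fun _ _ => (add_zero _).symm, fun _ _ => (smul_zero _).symm⟩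
        | cons => simp at h
      | cons => simp at h
    · have hl : ∀ x : Free.Hom Q Y Z, (a.append (.cons x b)).length = a.length + (b.length + 1) :=
        fun x => by rw [Word.length_append, Word.length_cons]
      have hn : 1 < a.length + (b.length + 1) := by omega
      refine ⟨fun x y => ?_, fun c x => ?_⟩
      · rw [D.comp_of_length d p _ hn (hl _), D.comp_of_length d p _ hn (hl _),
          D.comp_of_length d p _ hn (hl _)]
        exact (D.2 ⟨_, hn⟩ d p).2.1 a x y b _ _ _
      · rw [D.comp_of_length d p _ hn (hl _), D.comp_of_length d p _ hn (hl _)]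
        exact (D.2 ⟨_, hn⟩ d p).2.2.1 a c x b _ _
  · match w, hw with
    | .nil X, hw =>
      obtain rfl := hw.eq_zero
      rw [zero_add]
      exact (D.1 d p).2.1 X
    | .cons _ (.nil _), _ => exact Submodule.zero_mem _
    | .cons x (.cons y w), hw => exact (D.2 ⟨w.length + 1 + 1, by omega⟩ d p).2.2.2 _ _ ⟨_, rfl⟩ e hw

lemma RestrData.comp_map_add (D : RestrData φ ψ P) (d : ℤ) (p q : P.X d) :
    D.comp d (p + q) = D.comp d p + D.comp d q := by
  funext X Y w
  match w with
  | .nil X => exact congrArg (fun r => r.1.1 X) ((D.1 d).map_add p q)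
  | .cons _ (.nil _) => exact (add_zero _).symm
  | .cons x (.cons y w) =>
    exact congrArg (fun r => r.1 _ _ ⟨.cons x (.cons y w), rfl⟩)
      ((D.2 ⟨w.length + 1 + 1, by omega⟩ d).map_add p q)

lemma RestrData.comp_map_smul (D : RestrData φ ψ P) (d : ℤ) (a : k) (p : P.X d) :
    D.comp d (a • p) = a • D.comp d p := by
  funext X Y w
  match w with
  | .nil X => exact congrArg (fun r => r.1.1 X) ((D.1 d).map_smul a p)
  | .cons _ (.nil _) => exact (smul_zero _).symm
  | .cons x (.cons y w) =>
    exact congrArg (fun r => r.1 _ _ ⟨.cons x (.cons y w), rfl⟩)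
      ((D.2 ⟨w.length + 1 + 1, by omega⟩ d).map_smul a p)

/-- Solution of the recurrent formula for one element of `P`. -/
structure IsSolution (D : RestrData φ ψ P) (d : ℤ) (p : P.X d)
    (r : ∀ X Y : Q.Ob, Word (Free.Hom Q) X Y → A.Hom (φ.obj X) (ψ.obj Y)) : Prop where
  mem : r ∈ Trans φ ψ d
  comp : ∀ X Y w, w.length ≠ 1 → r X Y w = D.comp d p X Y w
  incl : ∀ X Y x, r X Y (.single (incl Q X Y x)) = (D.1 d p).1.2 X Y x
  recurrence : ∀ X Y w, 2 ≤ w.length → (d.negOnePow : ℤ) • r X Y (.single (Free.b Q X Y w)) =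
    Free.recRhs φ ψ d (D.comp (d + 1) ((P.d d (d + 1)).hom p)) r w

/-- The value at p is determined on its own: the term (pd)u_k is taken from the data D and does not
involve the solution at pd. -/
lemma IsSolution.unique {D : RestrData φ ψ P} {d : ℤ} {p : P.X d}
    {r r' : ∀ X Y : Q.Ob, Word (Free.Hom Q) X Y → A.Hom (φ.obj X) (ψ.obj Y)}
    (h : IsSolution D d p r) (h' : IsSolution D d p r') : r = r' :=
  Free.eq_of_recurrence h.mem h'.mem (fun X Y w hw => (h.comp X Y w hw).trans
    (h'.comp X Y w hw).symm) (fun X Y x => (h.incl X Y x).trans (h'.incl X Y x).symm)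
    h.recurrence h'.recurrence

lemma IsSolution.add {D : RestrData φ ψ P} {d : ℤ} {p p' : P.X d}
    {r r' : ∀ X Y : Q.Ob, Word (Free.Hom Q) X Y → A.Hom (φ.obj X) (ψ.obj Y)}
    (h : IsSolution D d p r) (h' : IsSolution D d p' r') : IsSolution D d (p + p') (r + r') where
  mem := Submodule.add_mem _ h.mem h'.mem
  comp X Y w hw := by rw [D.comp_map_add, Pi.add_apply, Pi.add_apply, Pi.add_apply, h.comp X Y w hw,
    h'.comp X Y w hw]; rfl
  incl X Y x := by rw [map_add, Pi.add_apply, Pi.add_apply, Pi.add_apply, h.incl, h'.incl]; rfl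
  recurrence X Y w hw := by
    rw [map_add, D.comp_map_add, Pi.add_apply, Pi.add_apply, Pi.add_apply, smul_add,
      h.recurrence X Y w hw, h'.recurrence X Y w hw]
    exact ((isLinearMap_recRhs d w).map_add (_, _) (_, _)).symm

lemma IsSolution.smul {D : RestrData φ ψ P} {d : ℤ} {p : P.X d}
    {r : ∀ X Y : Q.Ob, Word (Free.Hom Q) X Y → A.Hom (φ.obj X) (ψ.obj Y)}
    (h : IsSolution D d p r) (a : k) : IsSolution D d (a • p) (a • r) where
  mem := Submodule.smul_mem _ a h.mem
  comp X Y w hw := by rw [D.comp_map_smul, Pi.smul_apply, Pi.smul_apply, Pi.smul_apply,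
    h.comp X Y w hw]; rfl
  incl X Y x := by rw [map_smul, Pi.smul_apply, Pi.smul_apply, Pi.smul_apply, h.incl]; rfl
  recurrence X Y w hw := by
    rw [map_smul, D.comp_map_smul, Pi.smul_apply, Pi.smul_apply, Pi.smul_apply, smul_comm,
      h.recurrence X Y w hw]
    exact ((isLinearMap_recRhs d w).map_smul a (_, _)).symm

lemma exists_isSolution (D : RestrData φ ψ P) (d : ℤ) (p : P.X d) : ∃ r, IsSolution D d p r := by
  obtain ⟨r, h1, h2, h3, h4⟩ := Free.exists_recurrence (D.1 d p).1.2 (D.comp_mem d p)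
    (D.comp_mem (d + 1) ((P.d d (d + 1)).hom p)) (fun X Y i x hx => (D.1 d p).2.2 X Y i x hx)
  exact ⟨r, h1, h2, h3, h4⟩

/-- Reduces the problem for u to independent problems for the elements p, since u enters at pd only
through components of length k > 1, which agree with D. -/
lemma isSolution_iff (D : RestrData φ ψ P) (u : GMap P fun d => Trans φ ψ d) :
    (restrData φ ψ P u = D ∧ Recurrence φ ψ P u) ↔ ∀ d p, IsSolution D d p (u d p).1 := by
  constructor
  · rintro ⟨rfl, hu⟩ d p
    have hc : ∀ d (p : P.X d) X Y (w : Word (Free.Hom Q) X Y), w.length ≠ 1 →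
        (u d p).1 X Y w = (restrData φ ψ P u).comp d p X Y w := by
      intro d p X Y w hw
      match w, hw with
      | .nil X, _ => rfl
      | .cons x (.nil _), hw => simp at hw
      | .cons x (.cons y w), _ => rfl
    refine ⟨(u d p).2, hc d p, fun _ _ _ => rfl, fun X Y w hw => (hu d p X Y w hw).trans ?_⟩
    rw [Free.recRhs, hc (d + 1) _ X Y w (by omega)]
  · intro h
    have hc : ∀ d (p : P.X d) X Y (w : Word (Free.Hom Q) X Y), 1 < w.length →
        (u d p).1 X Y w = D.comp d p X Y w := fun d p X Y w hw => (h d p).comp X Y w (by omega)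
    refine ⟨Prod.ext (funext fun d => LinearMap.ext fun p => Subtype.ext (Prod.ext ?_ ?_))
      (funext fun n => funext fun d => LinearMap.ext fun p => Subtype.ext ?_), ?_⟩
    · exact funext fun X => (h d p).comp X X (.nil X) (by simp)
    · exact funext fun X => funext fun Y => LinearMap.ext fun x => (h d p).incl X Y x
    · funext X Y w
      have hw : 1 < w.1.length := by rw [w.2]; exact n.2
      exact (hc d p X Y w.1 hw).trans (D.comp_of_length d p w.1 n.2 w.2)
    · intro d p X Y w hw
      refine ((h d p).recurrence X Y w hw).trans ?_
      rw [Free.recRhs, ← hc (d + 1) _ X Y w hw]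

/-- The recurrent formula has a unique solution for arbitrary given data. -/
lemma existsUnique_recurrence (D : RestrData φ ψ P) :
    ∃ u : GMap P fun d => Trans φ ψ d,
      ∀ v, (restrData φ ψ P v = D ∧ Recurrence φ ψ P v) ↔ v = u := by
  choose r hr using exists_isSolution D
  refine ⟨fun d =>
    { toFun p := ⟨r d p, (hr d p).mem⟩
      -- The values are chosen separately for each p; linearity is a consequence of uniqueness.
      map_add' p q := Subtype.ext ((hr d (p + q)).unique ((hr d p).add (hr d q)))
      map_smul' a p := Subtype.ext ((hr d (a • p)).unique ((hr d p).smul a)) }, fun v => ?_⟩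
  rw [isSolution_iff]
  constructor
  · exact fun h => funext fun d => LinearMap.ext fun p => Subtype.ext ((h d p).unique (hr d p))
  · rintro rfl
    exact hr

end ChainMaps

end AInf

-- Proof of the proposition

theorem mainTheorem5 {k : Type u} [CommRing k] (Q : AInf.DGQuiver k) (A : AInf.AInfCat k)
    (φ ψ : AInf.AInfFunctor (AInf.FQ Q) A.toOpQuiver) (P : CochainComplex (ModuleCat.{u} k) ℤ) :
    Set.BijOn (AInf.restrData φ ψ P)
      {u | AInf.IsChainMap φ ψ P u} {D | AInf.IsChainMap₁ D.1} ∧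
    ∀ D : AInf.RestrData φ ψ P, AInf.IsChainMap₁ D.1 →
      ∃ u, AInf.IsChainMap φ ψ P u ∧ AInf.restrData φ ψ P u = D ∧
        ∀ v, (AInf.restrData φ ψ P v = D ∧ AInf.Recurrence φ ψ P v) ↔ v = u := by
  have key : ∀ D : AInf.RestrData φ ψ P, AInf.IsChainMap₁ D.1 →
      ∃ u, AInf.IsChainMap φ ψ P u ∧ AInf.restrData φ ψ P u = D ∧
        ∀ v, (AInf.restrData φ ψ P v = D ∧ AInf.Recurrence φ ψ P v) ↔ v = u := by
    intro D hD
    -- The recurrent formula is uniquely solvable for any data; the chain condition on u' only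
    -- serves to make the solution a chain map.
    obtain ⟨u, hu⟩ := AInf.existsUnique_recurrence D
    obtain ⟨h1, h2⟩ := (hu u).2 rfl
    exact ⟨u, h2.isChainMap (h1.symm ▸ hD), h1, hu⟩
  refine ⟨⟨fun u hu => hu.isChainMap₁, fun u hu v hv huv => ?_, fun D hD => ?_⟩, key⟩
  -- Injectivity: two chain maps with the same data both solve the recurrent formula for these data,
  -- hence coincide with its only solution.
  · obtain ⟨w, hw⟩ := AInf.existsUnique_recurrence (AInf.restrData φ ψ P v)
    exact ((hw u).1 ⟨huv, hu.recurrence⟩).trans ((hw v).1 ⟨rfl, hv.recurrence⟩).symm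
  · obtain ⟨u, hu, h, -⟩ := key D hD
    exact ⟨u, hu, h⟩
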